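/- **Setting.** Let $(\Omega,\mathcal F,P)$ be a complete probability space with a filtration $(\mathcal F_t)_{t\ge 0}$ satisfying the usual conditions, $H$ and $G$ separable real Hilbert spaces, $U$ a topological space, and $\mathcal R$ a ring of subsets of $U$ that generates $\mathcal B(U)$. Let $M=(M(t,A):t\ge 0,A\in\mathcal R)$ be a cylindrical martingale-valued measure in $H$: each $M(t,A)$ is a linear map $H\to L^0(\Omega,\mathcal F,P)$, continuous for convergence in probability, such that (equalities of random variables being a.s.) 1. $M(0,A)(h)=0$; 2. $M(t,\emptyset)(h)=0$, and $M(t,A\cup B)(h)=M(t,A)(h)+M(t,B)(h)$ for disjoint $A,B\in\mathcal R$; 3. $(M(t,A)(h))_{t\ge0}$ is a mean-zero square integrable martingale; 4. $E[M(t,A)(h_1)M(s,B)(h_2)]=0$ for disjoint $A,B\in\mathcal R$, all $s,t\ge 0$ and $h_1,h_2\in H$; 5. for $0\le s<t$ the family $\{M((s,t],A)(h):=M(t,A)(h)-M(s,A)(h):A\in\mathcal R,h\in H\}$ is (jointly) independent of $\mathcal F_s$; 6. $E|M((s,t],A)(h)|^2=\int_{(s,t]}\int_A q_{r,u}(h)^2\,\mu(du)\,\lambda(dr)$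 for $0\le s<t$, where $\mu$ is a $\sigma$-finite Borel measure on $U$ which is finite on $\mathcal R$ and for which $U$ is, up to a $\mu$-null set, a countable union of members of $\mathcal R$; $\lambda$ is a Borel measure on $[0,\infty)$, finite on bounded intervals; and the $q_{r,u}$ are continuous Hilbertian seminorms on $H$ whose bilinear forms $(r,u)\mapsto q_{r,u}(h_1,h_2)$ are measurable, and bounded on $[0,T]\times U$ for every $T>0$. Let $H_{q_{r,u}}$ be the completion of $H/\ker q_{r,u}$, $i_{q_{r,u}}:H\to H_{q_{r,u}}$ the canonical map, and $\mathcal L_2$ the space of Hilbert–Schmidt operators with its Hilbert–Schmidt norm. Fix $T>0$; write $\int_0^T$ for the integral over $(0,T]$ and $\mathcal P_T$ for the predictable $\sigma$-algebra on $[0,T]\times\Omega$. $\mathcal M^2_T(G)$ is the space of $G$-valued càdlàg square integrable martingales on $[0,T]$ modulo indistinguishability, with norm $\|X\|=(E\sup_{t\le T}\|X_t\|^2)^{1/2}$. $\Lambda^2(M,T;H,G)$ is the set of families $\Phi=(\Phi(r,\omega,u))$, $\Phi(r,\omega,u)\in\mathcal L_2(H_{q_{r,u}},G)$, such that $(r,\omega,u)\mapsto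 q_{r,u}(\Phi(r,\omega,u)^*g,i_{q_{r,u}}h)$ is $\mathcal P_T\otimes\mathcal B(U)$-measurable for all $g\in G,h\in H$, and $\|\Phi\|_{\Lambda^2}^2=E\int_0^T\!\int_U\|\Phi(r,u)\|^2_{\mathcal L_2(H_{q_{r,u}},G)}\,\mu(du)\,\lambda(dr)<\infty$. A simple integrand is a finite sum $\Phi(r,\omega,u)=\sum_{i,j}1_{(s_i,t_i]}(r)1_{F_i}(\omega)1_{A_j}(u)\,S_{ij}\circ i_{q_{r,u}}^*$ with $0\le s_i<t_i\le T$, $F_i\in\mathcal F_{s_i}$, $A_j\in\mathcal R$, $S_{ij}\in\mathcal L_2(H,G)$; its stochastic integral is $I_t(\Phi)=\sum_{i,j}1_{F_i}Y_t^{ij}$, where $Y^{ij}\in\mathcal M^2_T(G)$ satisfies, for each $r\in[0,T]$ and $g\in G$, $\langle Y^{ij}_r,g\rangle=M((s_i\wedge r,t_i\wedge r],A_j)(S_{ij}^*g)$ a.s. The stochastic integral $I:\Lambda^2(M,T;H,G)\to\mathcal M^2_T(G)$, $I_t(\Phi)=\int_0^t\int_U\Phi(r,u)\,M(dr,du)$,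 is the continuous extension of this map from the simple integrands. Let $(E,\mathcal E,\varrho)$ be a $\sigma$-finite measure space, and let $\Phi\in\Xi^{1,2}(M,T,E)$, i.e. $\Phi=(\Phi(r,\omega,u,e))$ with $\Phi(r,\omega,u,e)\in\mathcal L_2(H_{q_{r,u}},G)$, such that $(r,\omega,u,e)\mapsto q_{r,u}(\Phi(r,\omega,u,e)^*g,i_{q_{r,u}}h)$ is $\mathcal P_T\otimes\mathcal B(U)\otimes\mathcal E$-measurable for all $g\in G,h\in H$, and $\int_E\|\Phi(\cdot,\cdot,\cdot,e)\|_{\Lambda^2}\,\varrho(de)<\infty$. **Theorem (Stochastic Fubini).** Then: 1. For $\lambda|_{(0,T]}\otimes P\otimes\mu$-a.e. $(r,\omega,u)$ the map $e\mapsto\Phi(r,\omega,u,e)\in\mathcal L_2(H_{q_{r,u}},G)$ is Bochner integrable, and the family $\int_E\Phi(\cdot,\cdot,\cdot,e)\,\varrho(de)$ of its Bochner integrals (set equal to $0$ where the map is not integrable) belongs to $\Lambda^2(M,T;H,G)$. 2. For $\varrho$-a.e. $e$ the stochastic integral $I(\Phi(\cdot,\cdot,\cdot,e))$ is defined, and $e\mapsto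 I(\Phi(\cdot,\cdot,\cdot,e))\in\mathcal M^2_T(G)$ is Bochner integrable. There is a measurable version of this family, i.e. a map $J:E\times[0,T]\times\Omega\to G$ such that $(e,\omega)\mapsto J(e,t,\omega)$ is $\mathcal E\otimes\mathcal F$-measurable for each $t$ and, for $\varrho$-a.e. $e$, the process $J(e,\cdot,\cdot)$ is a càdlàg square integrable martingale representing $I(\Phi(\cdot,\cdot,\cdot,e))$. For every such $J$, written $J(e,t,\omega)=\int_0^t\int_U\Phi(r,u,e)\,M(dr,du)(\omega)$, $P$-a.s. for all $t\in[0,T]$ the map $e\mapsto J(e,t,\omega)$ is Bochner integrable and $$\Big(\int_E I(\Phi(\cdot,\cdot,\cdot,e))\,\varrho(de)\Big)_t=\int_E\Big(\int_0^t\!\int_U\Phi(r,u,e)\,M(dr,du)\Big)\varrho(de).$$ 3. The stochastic integral of $\int_E\Phi(\cdot,\cdot,\cdot,e)\,\varrho(de)$ is defined and, for every such version, $P$-a.s. for all $t\in[0,T]$, $$\int_0^t\!\int_U\Big(\int_E\Phi(\cdot,\cdot,\cdot,e)\,\varrho(de)\Big)M(dr,du)=\int_E\Big(\int_0^t\!\int_U\Phi(r,u,e)\,M(dr,du)\Big)\varrho(de).$$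 -/

import Mathlib

open MeasureTheory ProbabilityTheory Filter Topology
open scoped ENNReal NNReal

set_option linter.unusedSectionVars false

noncomputable section

/-! ### Hilbert-Schmidt operators -/

section HilbertSchmidt

variable {K G : Type*} [NormedAddCommGroup K] [InnerProductSpace ℝ K] [CompleteSpace K]
  [NormedAddCommGroup G] [InnerProductSpace ℝ G] [CompleteSpace G]

/-- The index set of a fixed complete orthonormal system of the Hilbert space `K`. -/
def hsIndex (K : Type*) [NormedAddCommGroup K] [InnerProductSpace ℝ K] [CompleteSpace K] : Set K :=
  (exists_hilbertBasis ℝ K).choose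

/-- A fixed complete orthonormal system of the Hilbert space `K`. -/
def hsBasis (K : Type*) [NormedAddCommGroup K] [InnerProductSpace ℝ K] [CompleteSpace K] :
    HilbertBasis (hsIndex K) ℝ K :=
  (exists_hilbertBasis ℝ K).choose_spec.choose

theorem enorm_sq_eq_tsum_hilbertBasis {ι : Type*} (b : HilbertBasis ι ℝ K) (x : K) :
    ‖x‖ₑ ^ 2 = ∑' i, ‖(inner ℝ x (b i) : ℝ)‖ₑ ^ 2 := by
  have h := b.hasSum_inner_mul_inner x x
  have h2 : HasSum (fun i => ‖(inner ℝ x (b i) : ℝ)‖ ^ 2) (‖x‖ ^ 2) := by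
    rw [real_inner_self_eq_norm_sq] at h
    have h4 : (fun i => ‖(inner ℝ x (b i) : ℝ)‖ ^ 2)
        = fun i => inner ℝ x (b i) * inner ℝ (b i) x := by
      funext i
      rw [real_inner_comm x (b i), ← pow_two, Real.norm_eq_abs, sq_abs]
    rw [h4]
    exact h
  have h3 := ENNReal.ofReal_tsum_of_nonneg (fun i => by positivity) h2.summable
  rw [h2.tsum_eq] at h3
  simpa only [ENNReal.ofReal_pow (norm_nonneg _), ofReal_norm] using h3

theorem tsum_enorm_sq_eq_adjoint {ι : Type*} (b : HilbertBasis ι ℝ K) (S : K →L[ℝ] G) :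
    ∑' i, ‖S (b i)‖ₑ ^ 2
      = ∑' j : hsIndex G, ‖ContinuousLinearMap.adjoint S (hsBasis G j)‖ₑ ^ 2 := by
  calc ∑' i, ‖S (b i)‖ₑ ^ 2
      = ∑' i, ∑' j : hsIndex G, ‖(inner ℝ (S (b i)) (hsBasis G j) : ℝ)‖ₑ ^ 2 :=
        tsum_congr fun i => enorm_sq_eq_tsum_hilbertBasis (hsBasis G) _
    _ = ∑' j : hsIndex G, ∑' i, ‖(inner ℝ (S (b i)) (hsBasis G j) : ℝ)‖ₑ ^ 2 :=
        ENNReal.tsum_comm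
    _ = _ := by
        refine tsum_congr fun j => ?_
        rw [enorm_sq_eq_tsum_hilbertBasis b]
        refine tsum_congr fun i => ?_
        rw [ContinuousLinearMap.adjoint_inner_left, real_inner_comm]

/-- `∑ ‖S bᵢ‖²` does not depend on the complete orthonormal system `b`. -/
theorem tsum_enorm_sq_hilbertBasis_eq {ι κ : Type*} (b : HilbertBasis ι ℝ K)
    (c : HilbertBasis κ ℝ K) (S : K →L[ℝ] G) :
    ∑' i, ‖S (b i)‖ₑ ^ 2 = ∑' j, ‖S (c j)‖ₑ ^ 2 := by
  rw [tsum_enorm_sq_eq_adjoint b, tsum_enorm_sq_eq_adjoint c]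

variable (K G) in
/-- The operators `S` with `∑ ‖S bᵢ‖² < ∞` for a complete orthonormal system `b`. -/
def hsSubmodule : Submodule ℝ (K →L[ℝ] G) where
  carrier := {S | Summable fun i => ‖S (hsBasis K i)‖ ^ 2}
  zero_mem' := by simp
  add_mem' := by
    intro R S hR hS
    refine Summable.of_nonneg_of_le (fun i => by positivity) (fun i => ?_)
      ((hR.add hS).mul_left 2)
    have h := norm_add_le (R (hsBasis K i)) (S (hsBasis K i))
    have h0 := norm_nonneg (R (hsBasis K i) + S (hsBasis K i))
    change ‖R (hsBasis K i) + S (hsBasis K i)‖ ^ 2 ≤ _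
    nlinarith [sq_nonneg (‖R (hsBasis K i)‖ - ‖S (hsBasis K i)‖)]
  smul_mem' := by
    intro a S hS
    have h : Summable fun i => ‖a‖ ^ 2 * ‖S (hsBasis K i)‖ ^ 2 :=
      Summable.mul_left (‖a‖ ^ 2) hS
    refine h.congr fun i => ?_
    change _ = ‖a • S (hsBasis K i)‖ ^ 2
    rw [norm_smul, mul_pow]

variable (K G) in
/-- The space of Hilbert-Schmidt operators `K → G`; it carries the Hilbert-Schmidt norm
(not the operator norm). -/
def HilbertSchmidt : Type _ := hsSubmodule K G

namespace HilbertSchmidt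

instance : AddCommGroup (HilbertSchmidt K G) := inferInstanceAs (AddCommGroup (hsSubmodule K G))

instance : Module ℝ (HilbertSchmidt K G) := inferInstanceAs (Module ℝ (hsSubmodule K G))

/-- The underlying continuous linear operator. -/
def toCLM : HilbertSchmidt K G →ₗ[ℝ] (K →L[ℝ] G) := (hsSubmodule K G).subtype

theorem toCLM_injective : Function.Injective (toCLM (K := K) (G := G)) :=
  Subtype.coe_injective

theorem summable_sq (S : HilbertSchmidt K G) :
    Summable fun i => ‖toCLM S (hsBasis K i)‖ ^ 2 := S.2

theorem summable_inner (R S : HilbertSchmidt K G) :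
    Summable fun i => (inner ℝ (toCLM R (hsBasis K i)) (toCLM S (hsBasis K i)) : ℝ) := by
  refine Summable.of_norm_bounded (R.summable_sq.add S.summable_sq) (fun i => ?_)
  refine (norm_inner_le_norm _ _).trans ?_
  nlinarith [sq_nonneg (‖toCLM R (hsBasis K i)‖ - ‖toCLM S (hsBasis K i)‖),
    sq_nonneg ‖toCLM R (hsBasis K i)‖, sq_nonneg ‖toCLM S (hsBasis K i)‖]

/-- The Hilbert-Schmidt inner product `⟨R, S⟩ = ∑ ⟨R bᵢ, S bᵢ⟩`. -/
@[reducible] def core : InnerProductSpace.Core ℝ (HilbertSchmidt K G) where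
  inner R S := ∑' i, inner ℝ (toCLM R (hsBasis K i)) (toCLM S (hsBasis K i))
  conj_inner_symm R S := by
    simp only [conj_trivial]
    exact tsum_congr fun i => real_inner_comm _ _
  re_inner_nonneg R := by
    simp only [RCLike.re_to_real]
    exact tsum_nonneg fun i => real_inner_self_nonneg
  add_left R S V := by
    simp only [map_add, add_apply, inner_add_left]
    exact (summable_inner R V).tsum_add (summable_inner S V)
  smul_left R S a := by
    simp only [map_smul, smul_apply, real_inner_smul_left, conj_trivial]
    exact tsum_mul_left
  definite R h := by
    have h1 : ∀ i, toCLM R (hsBasis K i) = 0 := by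
      intro i
      have := (hasSum_zero_iff_of_nonneg (fun i => real_inner_self_nonneg)).1
        (h ▸ (summable_inner R R).hasSum)
      exact inner_self_eq_zero.1 (congrFun this i)
    refine toCLM_injective ?_
    rw [map_zero]
    refine ContinuousLinearMap.ext_on (Submodule.dense_iff_topologicalClosure_eq_top.2
      (hsBasis K).dense_span) ?_
    rintro _ ⟨i, rfl⟩
    simpa using h1 i

instance : NormedAddCommGroup (HilbertSchmidt K G) := core.toNormedAddCommGroup

instance : InnerProductSpace ℝ (HilbertSchmidt K G) := InnerProductSpace.ofCore core.toCore

theorem enorm_sq_eq {ι : Type*} (b : HilbertBasis ι ℝ K) (S : HilbertSchmidt K G) :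
    ‖S‖ₑ ^ 2 = ∑' i, ‖toCLM S (b i)‖ₑ ^ 2 := by
  rw [tsum_enorm_sq_hilbertBasis_eq b (hsBasis K)]
  have h1 : ‖S‖ ^ 2 = ∑' i, ‖toCLM S (hsBasis K i)‖ ^ 2 := by
    rw [← real_inner_self_eq_norm_sq]
    exact tsum_congr fun i => real_inner_self_eq_norm_sq _
  have h3 := ENNReal.ofReal_tsum_of_nonneg (fun i => by positivity) S.summable_sq
  rw [← h1] at h3
  simpa only [ENNReal.ofReal_pow (norm_nonneg _), ofReal_norm] using h3

end HilbertSchmidt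

end HilbertSchmidt

/-! ### Continuous Hilbertian seminorms and their Hilbert spaces -/

section HilbertianSeminorm

/-- A continuous Hilbertian seminorm `q` on `H`, given by its positive, symmetric, bilinear form:
`q(h)² = form h h`. -/
structure HilbertianSeminorm (H : Type*) [NormedAddCommGroup H] [InnerProductSpace ℝ H] where
  form : H →ₗ[ℝ] H →ₗ[ℝ] ℝ
  symm : ∀ x y, form x y = form y x
  nonneg : ∀ x, 0 ≤ form x x
  continuous_sqrt : Continuous fun x => √(form x x)

namespace HilbertianSeminorm

variable {H : Type*} [NormedAddCommGroup H] [InnerProductSpace ℝ H]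

/-- The value `q(h)`. -/
def val (q : HilbertianSeminorm H) (h : H) : ℝ := √(q.form h h)

/-- The space `H`, endowed with the seminorm `q` instead of its norm. -/
def Pre (_q : HilbertianSeminorm H) : Type _ := H

variable (q : HilbertianSeminorm H)

instance : AddCommGroup q.Pre := inferInstanceAs (AddCommGroup H)

instance : Module ℝ q.Pre := inferInstanceAs (Module ℝ H)

/-- The identity map from `H` to `q.Pre`. -/
def toPre : H →ₗ[ℝ] q.Pre := LinearMap.id

/-- The identity map from `q.Pre` to `H`. -/
def ofPre : q.Pre →ₗ[ℝ] H := LinearMap.id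

/-- The form of `q` as a semi-inner product. -/
@[reducible] def core : PreInnerProductSpace.Core ℝ q.Pre where
  inner x y := q.form (q.ofPre x) (q.ofPre y)
  conj_inner_symm x y := by simpa using q.symm _ _
  re_inner_nonneg x := by simpa using q.nonneg _
  add_left x y z := by simp
  smul_left x y a := by simp

instance : SeminormedAddCommGroup q.Pre :=
  letI := q.core
  InnerProductSpace.Core.toSeminormedAddCommGroup (𝕜 := ℝ)

instance : InnerProductSpace ℝ q.Pre := InnerProductSpace.ofCore q.core

/-- The Hilbert space `H_q`: the Hausdorff completion of `(H, q)`, that is, the completion of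
`H / ker q`. -/
abbrev Space : Type _ := UniformSpace.Completion q.Pre

theorem norm_toPre (h : H) : ‖q.toPre h‖ = q.val h := rfl

/-- The canonical map `i_q : H → H_q`. -/
def incl : H →L[ℝ] q.Space where
  toLinearMap := (UniformSpace.Completion.toComplₗᵢ (𝕜 := ℝ) (E := q.Pre)).toLinearMap ∘ₗ q.toPre
  cont := by
    refine (UniformSpace.Completion.continuous_coe q.Pre).comp ?_
    refine continuous_of_continuousAt_zero q.toPre ?_
    rw [ContinuousAt, map_zero, tendsto_zero_iff_norm_tendsto_zero]
    have h : Tendsto (fun x => ‖q.toPre x‖) (𝓝 0) (𝓝 √(q.form 0 0)) := q.continuous_sqrt.tendsto 0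
    simpa using h

theorem norm_incl (h : H) : ‖q.incl h‖ = q.val h :=
  UniformSpace.Completion.norm_coe (q.toPre h)

end HilbertianSeminorm

end HilbertianSeminorm
/-! ### Square integrable càdlàg martingales on `[0, T]` -/

section SquareIntegrableMartingales

variable {Ω : Type*} {mΩ : MeasurableSpace Ω}

/-- The restriction of the filtration `(ℱ_t : t ≥ 0)` to the time interval `[0, T]`. -/
def filtrationIcc (ℱ : Filtration ℝ≥0 mΩ) (T : ℝ≥0) : Filtration (Set.Icc (0 : ℝ≥0) T) mΩ where
  seq t := ℱ t.1
  mono' _ _ h := ℱ.mono h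
  le' t := ℱ.le t.1

variable {G : Type*} [NormedAddCommGroup G]

/-- Right continuous with left limits. -/
def IsCadlag {T : ℝ≥0} (x : Set.Icc (0 : ℝ≥0) T → G) : Prop :=
  ∀ t, ContinuousWithinAt x (Set.Ici t) t ∧ ∃ l, Tendsto x (𝓝[<] t) (𝓝 l)

/-- `sup_{0 ≤ t ≤ T} ‖X_t(ω)‖`. -/
def supENorm {T : ℝ≥0} (X : Set.Icc (0 : ℝ≥0) T → Ω → G) (ω : Ω) : ℝ≥0∞ := ⨆ t, ‖X t ω‖ₑ

/-- `(E sup_{0 ≤ t ≤ T} ‖X_t‖²)^{1/2}`. -/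
def mENorm {T : ℝ≥0} (P : Measure Ω) (X : Set.Icc (0 : ℝ≥0) T → Ω → G) : ℝ≥0∞ :=
  (∫⁻ ω, supENorm X ω ^ (2 : ℝ) ∂P) ^ (1 / 2 : ℝ)

theorem IsCadlag.exists_countable_iSup {T : ℝ≥0} :
    ∃ D : Set (Set.Icc (0 : ℝ≥0) T), D.Countable ∧
      ∀ x : Set.Icc (0 : ℝ≥0) T → G, IsCadlag x → ⨆ t, ‖x t‖ₑ = ⨆ t ∈ D, ‖x t‖ₑ := by
  obtain ⟨D, hDc, hD⟩ := TopologicalSpace.exists_countable_dense (Set.Icc (0 : ℝ≥0) T)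
  let e : Set.Icc (0 : ℝ≥0) T := ⟨T, zero_le, le_rfl⟩
  refine ⟨insert e D, hDc.insert e, fun x hx => le_antisymm (iSup_le fun t => ?_)
    (iSup₂_le fun t _ => le_iSup (fun t => ‖x t‖ₑ) t)⟩
  rcases eq_or_lt_of_le (show t ≤ e from t.2.2) with h | h
  · subst h
    exact le_iSup₂ (f := fun t (_ : t ∈ insert e D) => ‖x t‖ₑ) e (Set.mem_insert e D)
  · have h1 : t ∈ closure (Set.Ioi t) := by
      rw [closure_Ioi' ⟨e, h⟩]
      exact Set.self_mem_Ici
    have h2 : t ∈ closure (Set.Ioi t ∩ D) :=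
      closure_minimal (hD.open_subset_closure_inter isOpen_Ioi) isClosed_closure h1
    have h3 : ContinuousWithinAt (fun s => ‖x s‖ₑ) (Set.Ioi t ∩ D) t :=
      ((hx t).1.mono (Set.inter_subset_left.trans Set.Ioi_subset_Ici_self)).enorm
    have h4 := h3.mem_closure h2 (t := Set.Iic (⨆ t ∈ insert e D, ‖x t‖ₑ)) fun s hs =>
      le_iSup₂ (f := fun t (_ : t ∈ insert e D) => ‖x t‖ₑ) s (Set.mem_insert_of_mem e hs.2)
    rwa [isClosed_Iic.closure_eq] at h4

theorem measurable_supENorm {T : ℝ≥0} {X : Set.Icc (0 : ℝ≥0) T → Ω → G}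
    (hm : ∀ t, StronglyMeasurable (X t)) (hc : ∀ ω, IsCadlag fun t => X t ω) :
    Measurable (supENorm X) := by
  obtain ⟨D, hDc, hD⟩ := IsCadlag.exists_countable_iSup (G := G) (T := T)
  have h : supENorm X = fun ω => ⨆ t ∈ D, ‖X t ω‖ₑ := funext fun ω => hD _ (hc ω)
  rw [h]
  exact Measurable.biSup D hDc fun t _ => (hm t).enorm

theorem supENorm_add_le {T : ℝ≥0} (X Y : Set.Icc (0 : ℝ≥0) T → Ω → G) (ω : Ω) :
    supENorm (X + Y) ω ≤ supENorm X ω + supENorm Y ω :=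
  iSup_le fun t => (enorm_add_le _ _).trans
    (add_le_add (le_iSup (fun t => ‖X t ω‖ₑ) t) (le_iSup (fun t => ‖Y t ω‖ₑ) t))

theorem mENorm_add_le {T : ℝ≥0} {P : Measure Ω} {X Y : Set.Icc (0 : ℝ≥0) T → Ω → G}
    (hX : Measurable (supENorm X)) (hY : Measurable (supENorm Y)) :
    mENorm P (X + Y) ≤ mENorm P X + mENorm P Y := by
  refine le_trans ?_ (ENNReal.lintegral_Lp_add_le hX.aemeasurable hY.aemeasurable one_le_two)
  unfold mENorm
  gcongr with ω
  exact supENorm_add_le X Y ω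

variable [InnerProductSpace ℝ G]

theorem mENorm_smul {T : ℝ≥0} (P : Measure Ω) (a : ℝ) (X : Set.Icc (0 : ℝ≥0) T → Ω → G) :
    mENorm P (a • X) = ‖a‖ₑ * mENorm P X := by
  have h : ∀ ω, supENorm (a • X) ω ^ (2 : ℝ) = ‖a‖ₑ ^ (2 : ℝ) * supENorm X ω ^ (2 : ℝ) := by
    intro ω
    rw [← ENNReal.mul_rpow_of_nonneg _ _ zero_le_two]
    simp only [supENorm, Pi.smul_apply, enorm_smul, ENNReal.mul_iSup]
  simp only [mENorm, h]
  rw [lintegral_const_mul' _ _ (by finiteness), ENNReal.mul_rpow_of_nonneg _ _ (by norm_num),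
    ← ENNReal.rpow_mul]
  norm_num

variable [CompleteSpace G]

/-- The `G`-valued càdlàg martingales `X` on `[0, T]` with `E sup_{0 ≤ t ≤ T} ‖X_t‖² < ∞`. -/
def martingaleSubmodule (ℱ : Filtration ℝ≥0 mΩ) (P : Measure Ω) (T : ℝ≥0)
    (G : Type*) [NormedAddCommGroup G] [InnerProductSpace ℝ G] [CompleteSpace G] :
    Submodule ℝ (Set.Icc (0 : ℝ≥0) T → Ω → G) where
  carrier := {X | Martingale X (filtrationIcc ℱ T) P ∧ (∀ ω, IsCadlag fun t => X t ω) ∧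
    mENorm P X < ∞}
  zero_mem' := by
    refine ⟨martingale_zero _ _ _, fun ω t => ⟨continuousWithinAt_const, 0, tendsto_const_nhds⟩, ?_⟩
    simp [mENorm, supENorm]
  add_mem' := by
    rintro X Y ⟨hX, hXc, hXn⟩ ⟨hY, hYc, hYn⟩
    refine ⟨hX.add hY, fun ω t => ⟨(hXc ω t).1.add (hYc ω t).1, ?_⟩, ?_⟩
    · obtain ⟨l, hl⟩ := (hXc ω t).2
      obtain ⟨k, hk⟩ := (hYc ω t).2
      exact ⟨l + k, hl.add hk⟩
    · refine (mENorm_add_le (measurable_supENorm (fun t => ?_) hXc)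
        (measurable_supENorm (fun t => ?_) hYc)).trans_lt (ENNReal.add_lt_top.2 ⟨hXn, hYn⟩)
      · exact (hX.stronglyAdapted t).mono ((filtrationIcc ℱ T).le t)
      · exact (hY.stronglyAdapted t).mono ((filtrationIcc ℱ T).le t)
  smul_mem' := by
    rintro a X ⟨hX, hXc, hXn⟩
    refine ⟨hX.smul a, fun ω t => ⟨(hXc ω t).1.const_smul a, ?_⟩, ?_⟩
    · obtain ⟨l, hl⟩ := (hXc ω t).2
      exact ⟨a • l, hl.const_smul a⟩
    · rw [mENorm_smul]
      exact ENNReal.mul_lt_top enorm_lt_top hXn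

/-- The space of `G`-valued càdlàg square integrable martingales on `[0, T]`, as processes. -/
def MartingaleProcess (ℱ : Filtration ℝ≥0 mΩ) (P : Measure Ω) (T : ℝ≥0)
    (G : Type*) [NormedAddCommGroup G] [InnerProductSpace ℝ G] [CompleteSpace G] : Type _ :=
  martingaleSubmodule ℱ P T G

namespace MartingaleProcess

variable {ℱ : Filtration ℝ≥0 mΩ} {P : Measure Ω} {T : ℝ≥0}

instance : AddCommGroup (MartingaleProcess ℱ P T G) :=
  inferInstanceAs (AddCommGroup (martingaleSubmodule ℱ P T G))

instance : Module ℝ (MartingaleProcess ℱ P T G) :=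
  inferInstanceAs (Module ℝ (martingaleSubmodule ℱ P T G))

/-- The underlying process. -/
def process : MartingaleProcess ℱ P T G →ₗ[ℝ] (Set.Icc (0 : ℝ≥0) T → Ω → G) :=
  (martingaleSubmodule ℱ P T G).subtype

theorem process_mem (X : MartingaleProcess ℱ P T G) : X.process ∈ martingaleSubmodule ℱ P T G :=
  X.2

theorem measurable_sup (X : MartingaleProcess ℱ P T G) : Measurable (supENorm X.process) :=
  measurable_supENorm
    (fun t => (X.process_mem.1.stronglyAdapted t).mono ((filtrationIcc ℱ T).le t))
    X.process_mem.2.1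

/-- The norm `(E sup_{0 ≤ t ≤ T} ‖X_t‖²)^{1/2}`. -/
instance : Norm (MartingaleProcess ℱ P T G) := ⟨fun X => (mENorm P X.process).toReal⟩

theorem seminormedCore : SeminormedSpace.Core ℝ (MartingaleProcess ℱ P T G) where
  norm_nonneg _ := ENNReal.toReal_nonneg
  norm_smul a X := by
    change (mENorm P (process (a • X))).toReal = ‖a‖ * (mENorm P X.process).toReal
    rw [map_smul, mENorm_smul, ENNReal.toReal_mul, toReal_enorm]
  norm_triangle X Y := by
    change (mENorm P (process (X + Y))).toReal
      ≤ (mENorm P X.process).toReal + (mENorm P Y.process).toReal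
    rw [← ENNReal.toReal_add X.process_mem.2.2.ne Y.process_mem.2.2.ne, map_add]
    exact ENNReal.toReal_mono (ENNReal.add_lt_top.2 ⟨X.process_mem.2.2, Y.process_mem.2.2⟩).ne
      (mENorm_add_le X.measurable_sup Y.measurable_sup)

instance : SeminormedAddCommGroup (MartingaleProcess ℱ P T G) :=
  SeminormedAddCommGroup.ofCore seminormedCore

instance : NormedSpace ℝ (MartingaleProcess ℱ P T G) where
  norm_smul_le a X := (seminormedCore.norm_smul a X).le

end MartingaleProcess

/-- The normed space `𝓜²_T(G)`: two processes at distance zero, i.e. two indistinguishable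
processes, are identified. -/
abbrev MartingaleSpace (ℱ : Filtration ℝ≥0 mΩ) (P : Measure Ω) (T : ℝ≥0)
    (G : Type*) [NormedAddCommGroup G] [InnerProductSpace ℝ G] [CompleteSpace G] : Type _ :=
  SeparationQuotient (MartingaleProcess ℱ P T G)

/-- A process representing an element of `𝓜²_T(G)`; it is unique up to indistinguishability. -/
def MartingaleSpace.path {ℱ : Filtration ℝ≥0 mΩ} {P : Measure Ω} {T : ℝ≥0}
    (X : MartingaleSpace ℱ P T G) : Set.Icc (0 : ℝ≥0) T → Ω → G :=
  (Quotient.out X).process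

end SquareIntegrableMartingales

/-! ### Cylindrical martingale-valued measures -/

section CylindricalMartingaleMeasure

/-- A cylindrical martingale-valued measure `M = (M(t, A) : t ≥ 0, A ∈ ring)` in `H`. The cylindrical
random variable `M(t, A)` is a linear map from `H` to the space `Ω →ₘ[P] ℝ` of classes of random
variables; for `A ∉ ring` its value is irrelevant. -/
structure CylMartMeasure {Ω : Type*} {mΩ : MeasurableSpace Ω} (ℱ : Filtration ℝ≥0 mΩ)
    (P : Measure Ω) (H : Type*) [NormedAddCommGroup H] [InnerProductSpace ℝ H]
    (U : Type*) [TopologicalSpace U] [MeasurableSpace U] where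
  /-- the ring `𝓡` of subsets of `U` -/
  ring : Set (Set U)
  isSetRing_ring : IsSetRing ring
  generateFrom_ring : MeasurableSpace.generateFrom ring = borel U
  /-- the cylindrical random variables `M(t, A)` -/
  toFun : ℝ≥0 → Set U → H →ₗ[ℝ] (Ω →ₘ[P] ℝ)
  map_zero_time : ∀ A ∈ ring, ∀ h, toFun 0 A h = 0
  map_empty : ∀ t h, toFun t ∅ h = 0
  map_union : ∀ t, ∀ A ∈ ring, ∀ B ∈ ring, Disjoint A B →
    ∀ h, toFun t (A ∪ B) h = toFun t A h + toFun t B h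
  martingale : ∀ A ∈ ring, ∀ h, Martingale (fun t ω => toFun t A h ω) ℱ P
  memLp_two : ∀ t, ∀ A ∈ ring, ∀ h, MemLp (toFun t A h) 2 P
  mean_zero : ∀ t, ∀ A ∈ ring, ∀ h, ∫ ω, toFun t A h ω ∂P = 0
  /-- continuity of `M(t, A) : H → L⁰` for convergence in probability -/
  continuous_prob : ∀ t, ∀ A ∈ ring, ∀ (x : ℕ → H) (h : H), Tendsto x atTop (𝓝 h) →
    TendstoInMeasure P (fun n ω => toFun t A (x n) ω) atTop (fun ω => toFun t A h ω)
  orthogonal : ∀ A ∈ ring, ∀ B ∈ ring, Disjoint A B → ∀ (t s : ℝ≥0) (h₁ h₂ : H),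
    ∫ ω, toFun t A h₁ ω * toFun s B h₂ ω ∂P = 0
  /-- the family of increments `(M((s, t], A)(h) : A ∈ 𝓡, h ∈ H)` is independent of `ℱ_s` -/
  indep_increments : ∀ s t : ℝ≥0, s < t →
    Indep (⨆ A ∈ ring, ⨆ h : H,
      MeasurableSpace.comap (fun ω => toFun t A h ω - toFun s A h ω) (borel ℝ)) (ℱ s) P
  /-- the measure `μ` on `U` -/
  mu : Measure U
  sigmaFinite_mu : SigmaFinite mu
  mu_lt_top : ∀ A ∈ ring, mu A < ∞
  /-- `U` is covered by countably many members of the ring, up to a null set -/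
  exists_cover : ∃ A : ℕ → Set U, (∀ n, A n ∈ ring) ∧ mu (⋃ n, A n)ᶜ = 0
  /-- the measure `λ` on `[0, ∞)` -/
  lam : Measure ℝ≥0
  lam_lt_top : ∀ t, lam (Set.Icc 0 t) < ∞
  /-- the continuous Hilbertian seminorms `q_{r,u}` -/
  q : ℝ≥0 → U → HilbertianSeminorm H
  measurable_q : ∀ h₁ h₂ : H, Measurable fun p : ℝ≥0 × U => (q p.1 p.2).form h₁ h₂
  bounded_q : ∀ h₁ h₂ : H, ∀ T : ℝ≥0, ∃ C : ℝ, ∀ r ≤ T, ∀ u, |(q r u).form h₁ h₂| ≤ C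
  covariance : ∀ A ∈ ring, ∀ s t : ℝ≥0, s < t → ∀ h : H,
    ∫ ω, |toFun t A h ω - toFun s A h ω| ^ 2 ∂P
      = ∫ r in Set.Ioc s t, ∫ u in A, (q r u).val h ^ 2 ∂mu ∂lam

namespace CylMartMeasure

variable {Ω : Type*} {mΩ : MeasurableSpace Ω} {ℱ : Filtration ℝ≥0 mΩ} {P : Measure Ω}
  {H : Type*} [NormedAddCommGroup H] [InnerProductSpace ℝ H] [CompleteSpace H]
  {U : Type*} [TopologicalSpace U] [MeasurableSpace U]
  (M : CylMartMeasure ℱ P H U) (T : ℝ≥0)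
  (G : Type*) [NormedAddCommGroup G] [InnerProductSpace ℝ G] [CompleteSpace G]
  {E : Type*} [MeasurableSpace E]

/-- The measure `λ` on `[0, T]`. As in the covariance formula, `∫₀ᵀ` is the integral over
`(0, T]`, so a possible atom of `λ` at `0` does not count. -/
def lamIcc : Measure (Set.Icc (0 : ℝ≥0) T) :=
  (M.lam.restrict (Set.Ioc 0 T)).comap Subtype.val

/-- The predictable σ-algebra `𝓟_T` on `[0, T] × Ω`. -/
@[reducible] def predictableIcc (ℱ : Filtration ℝ≥0 mΩ) (T : ℝ≥0) :
    MeasurableSpace (Set.Icc (0 : ℝ≥0) T × Ω) :=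
  ℱ.predictable.comap fun p => (p.1.1, p.2)

/-- Families `(Φ(r, ω, u))` of Hilbert-Schmidt operators `Φ(r, ω, u) : H_{q_{r,u}} → G`. -/
abbrev Integrand : Type _ :=
  ∀ (r : Set.Icc (0 : ℝ≥0) T) (_ : Ω) (u : U), HilbertSchmidt (M.q r u).Space G

variable {T G}

/-- The norm of `Λ²(M, T)`, with value `∞` if `Φ` has infinite norm. -/
def lambdaENorm (Φ : M.Integrand T G) : ℝ≥0∞ :=
  (∫⁻ ω, ∫⁻ r, ∫⁻ u, ‖Φ r ω u‖ₑ ^ 2 ∂M.mu ∂(M.lamIcc T) ∂P) ^ (1 / 2 : ℝ)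

/-- Membership in `Λ²(M, T; H, G)`: `q_{r,u}`-predictability and finite norm. -/
def IsLambda2 (Φ : M.Integrand T G) : Prop :=
  (∀ (h : H) (g : G),
    Measurable[(predictableIcc ℱ T).prod inferInstance]
      fun p : (Set.Icc (0 : ℝ≥0) T × Ω) × U =>
        (inner ℝ (ContinuousLinearMap.adjoint (Φ p.1.1 p.1.2 p.2).toCLM g)
          ((M.q p.1.1 p.2).incl h) : ℝ)) ∧
  M.lambdaENorm Φ < ∞

/-- The square integrable martingale `(Y_r(s, t, A, S))` obtained from
`h ↦ M((s ∧ r, t ∧ r], A)(h)` through radonification by the Hilbert-Schmidt operator `S`: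
`⟨Y_r, g⟩ = M((s ∧ r, t ∧ r], A)(S* g)` almost surely. -/
def IsRadonification (s t : ℝ≥0) (A : Set U) (S : HilbertSchmidt H G)
    (Y : MartingaleSpace ℱ P T G) : Prop :=
  ∀ (r : Set.Icc (0 : ℝ≥0) T) (g : G), ∀ᵐ ω ∂P,
    (inner ℝ (Y.path r ω) g : ℝ)
      = M.toFun (min t r) A (ContinuousLinearMap.adjoint S.toCLM g) ω
        - M.toFun (min s r) A (ContinuousLinearMap.adjoint S.toCLM g) ω

/-- `Φ` is a simple integrand,
`Φ(r, ω, u) = ∑_{i,j} 1_{(s_i, t_i]}(r) 1_{F_i}(ω) 1_{A_j}(u) S_{i,j} ∘ i*_{q_{r,u}}`,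
and `X` is its stochastic integral, `X_t = ∑_{i,j} 1_{F_i} Y_t(s_i, t_i, A_j, S_{i,j})`. -/
def IsSimpleIntegral (Φ : M.Integrand T G) (X : MartingaleSpace ℱ P T G) : Prop :=
  ∃ (n m : ℕ) (s t : Fin n → ℝ≥0) (F : Fin n → Set Ω) (A : Fin m → Set U)
    (S : Fin n → Fin m → HilbertSchmidt H G) (Y : Fin n → Fin m → MartingaleSpace ℱ P T G),
    (∀ i, s i < t i ∧ t i ≤ T ∧ MeasurableSet[ℱ (s i)] (F i)) ∧
    (∀ j, A j ∈ M.ring) ∧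
    (∀ r ω u, (Φ r ω u).toCLM = ∑ i, ∑ j,
      ((Set.Ioc (s i) (t i)).indicator 1 r.1 * (F i).indicator 1 ω * (A j).indicator 1 u : ℝ) •
        ((S i j).toCLM ∘L ContinuousLinearMap.adjoint (M.q r u).incl)) ∧
    (∀ i j, M.IsRadonification (s i) (t i) (A j) (S i j) (Y i j)) ∧
    ∀ᵐ ω ∂P, ∀ r, X.path r ω = ∑ i, ∑ j, ((F i).indicator 1 ω : ℝ) • (Y i j).path r ω

/-- `X` is the stochastic integral of `Φ ∈ Λ²(M, T; H, G)`: the graph of the stochastic integral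
mapping is the closure, in `Λ²(M, T) × 𝓜²_T(G)`, of its graph on the simple integrands, i.e. the
mapping is the continuous extension of the integral of simple integrands. -/
def IsStochasticIntegral (Φ : M.Integrand T G) (X : MartingaleSpace ℱ P T G) : Prop :=
  M.IsLambda2 Φ ∧ ∀ ε : ℝ≥0∞, 0 < ε → ∃ Ψ Y, M.IsSimpleIntegral Ψ Y ∧
    M.lambdaENorm (Φ - Ψ) < ε ∧ ‖X - Y‖ₑ < ε

open scoped Classical in
/-- The stochastic integral `I(Φ) ∈ 𝓜²_T(G)` of `Φ ∈ Λ²(M, T; H, G)`. -/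
def stochasticIntegral (Φ : M.Integrand T G) : MartingaleSpace ℱ P T G :=
  if h : ∃ X, M.IsStochasticIntegral Φ X then h.choose else 0

/-- Membership of `Φ = (Φ(r, ω, u, e))` in `Ξ^{1,2}(M, T, E)`. -/
def IsXi (ϱ : Measure E)
    (Φ : ∀ (r : Set.Icc (0 : ℝ≥0) T) (_ : Ω) (u : U), E → HilbertSchmidt (M.q r u).Space G) :
    Prop :=
  (∀ (h : H) (g : G),
    Measurable[((predictableIcc ℱ T).prod inferInstance).prod inferInstance]
      fun p : ((Set.Icc (0 : ℝ≥0) T × Ω) × U) × E =>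
        (inner ℝ (ContinuousLinearMap.adjoint (Φ p.1.1.1 p.1.1.2 p.1.2 p.2).toCLM g)
          ((M.q p.1.1.1 p.1.2).incl h) : ℝ)) ∧
  ∫⁻ e, M.lambdaENorm (fun r ω u => Φ r ω u e) ∂ϱ < ∞

end CylMartMeasure

/-- `J` is a measurable version of the family `(X e : e ∈ E)` of elements of `𝓜²_T(G)`: each
`(e, ω) ↦ J(e, t, ω)` is jointly measurable and, for almost every `e`, `J(e, ·, ·)` is a càdlàg
square integrable martingale in the class `X e`. -/
def IsMeasurableVersion {Ω : Type*} {mΩ : MeasurableSpace Ω} {ℱ : Filtration ℝ≥0 mΩ}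
    {P : Measure Ω} {T : ℝ≥0} {G : Type*} [NormedAddCommGroup G] [InnerProductSpace ℝ G]
    [CompleteSpace G] {E : Type*} [MeasurableSpace E] (ϱ : Measure E)
    (X : E → MartingaleSpace ℱ P T G) (J : E → Set.Icc (0 : ℝ≥0) T → Ω → G) : Prop :=
  (∀ t, StronglyMeasurable fun p : E × Ω => J p.1 t p.2) ∧
  ∀ᵐ e ∂ϱ, ∃ Z : MartingaleProcess ℱ P T G, Z.process = J e ∧ SeparationQuotient.mk Z = X e

end CylindricalMartingaleMeasure

end

/-! ### Hilbert-Schmidt operators and orthonormal sequences with zeros. -/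

noncomputable section

/-! The theorem is a density argument based on one linear estimate. For a simple integrand `Ψ` with
integral `X`, orthogonality over disjoint sets, independence of the past and the covariance formula
give the Itô isometry `E‖X_T‖² = ‖Ψ‖²` in `Λ²` (`lintegral_sum_elemIncr`,
`IsElementary.eLpNorm_path`). With Doob's inequality this yields `‖X‖ ≤ 2‖Ψ‖`, so the closure of the
graph of the simple integral is again the graph of a bounded map
(`IsStochasticIntegral.enorm_sub_le`).

Fubini is immediate for finite sums `∑ 1_{B_k}(e) ψ_k` with simple `ψ_k`: both sides are `∑ ϱ(B_k)
I(ψ_k)` (`IsSimpleXi.integrable_and_isElementary_integral`). Such sums are dense for the norm `∫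
‖Φ(e)‖ ϱ(de)` (`IsMeasurableXi.isXiApprox`). In that norm `Φ ↦ ∫ Φ dϱ` is a contraction into `Λ²` by
Minkowski's inequality (`IsMeasurableXi.lambdaENorm_intXi_le`), and `Φ ↦ ∫ I(Φ(e)) ϱ(de)` is bounded
by the factor 2. Hence the identity passes to the limit (`isStochasticIntegral_intXi`).

The difficulty in the density is that the operators live on spaces `H_q` that vary with `(r, u)`.
Gram-Schmidt, applied to the images of one dense sequence of `H`, produces orthonormal sequences
depending measurably on the point. Truncation then leaves rank one fields with scalar coefficients,
and cut-offs, simple functions and a π-λ argument reduce the coefficients to indicators of boxes.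

For a measurable version, approximants converging at rate `2⁻ⁿ` have, for almost every `e`, paths
that converge uniformly almost surely, and the limit is chosen jointly measurable. For an arbitrary
version the functionals `X ↦ ∫_A X_t dP` commute with the Bochner integral, so ordinary Fubini
identifies the two sides at each fixed time. Countably many dyadic times and right continuity give
all times at once (`IsMeasurableVersion.integral_path`).

Two facts underlie all this. The radonified integrals exist: real martingales with right continuous
`L²` paths get càdlàg modifications by counting oscillations on dyadic grids, and summing over a
basis of `G` converges because `S` is Hilbert-Schmidt. And `𝓜²_T(G)` is complete, so Bochner
integrals in it make sense. -/

theorem enorm_inner_le_mul {K : Type*} [NormedAddCommGroup K] [InnerProductSpace ℝ K] (x y : K) :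
    ‖(inner ℝ x y : ℝ)‖ₑ ≤ ‖x‖ₑ * ‖y‖ₑ := by
  rw [← ofReal_norm, ← ofReal_norm, ← ofReal_norm, ← ENNReal.ofReal_mul (norm_nonneg _)]
  exact ENNReal.ofReal_le_ofReal (norm_inner_le_norm x y)

namespace HilbertSchmidt

variable {K G : Type*} [NormedAddCommGroup K] [InnerProductSpace ℝ K] [CompleteSpace K]
  [NormedAddCommGroup G] [InnerProductSpace ℝ G] [CompleteSpace G]

/-- The Hilbert-Schmidt operator with a given underlying operator. -/
def ofCLM (S : K →L[ℝ] G) (hS : Summable fun i => ‖S (hsBasis K i)‖ ^ 2) : HilbertSchmidt K G :=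
  ⟨S, hS⟩

theorem enorm_sq_adjoint {ι : Type*} (b : HilbertBasis ι ℝ G) (S : HilbertSchmidt K G) :
    ‖S‖ₑ ^ 2 = ∑' j, ‖ContinuousLinearMap.adjoint S.toCLM (b j)‖ₑ ^ 2 := by
  rw [enorm_sq_eq (hsBasis K), tsum_enorm_sq_eq_adjoint, tsum_enorm_sq_hilbertBasis_eq]

/-- Parseval in `G` and Cauchy-Schwarz in each coordinate: the Hilbert-Schmidt norm dominates the
operator norm. -/
theorem enorm_apply_le (S : HilbertSchmidt K G) (x : K) : ‖S.toCLM x‖ₑ ≤ ‖S‖ₑ * ‖x‖ₑ := by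
  have h : ‖S.toCLM x‖ₑ ^ 2 ≤ (‖S‖ₑ * ‖x‖ₑ) ^ 2 := by
    rw [enorm_sq_eq_tsum_hilbertBasis (hsBasis G), mul_pow, enorm_sq_adjoint (hsBasis G),
      ← ENNReal.tsum_mul_right]
    refine ENNReal.tsum_le_tsum fun j => ?_
    rw [← mul_pow, ← ContinuousLinearMap.adjoint_inner_right]
    gcongr
    rw [mul_comm]
    exact enorm_inner_le_mul _ _
  exact (ENNReal.pow_le_pow_left_iff two_ne_zero).1 h

theorem norm_apply_le (S : HilbertSchmidt K G) (x : K) : ‖S.toCLM x‖ ≤ ‖S‖ * ‖x‖ := by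
  have h := ENNReal.toReal_mono (by finiteness) (S.enorm_apply_le x)
  simpa using h

/-- The embedding of the Hilbert-Schmidt operators into the bounded operators is continuous. -/
def toCLML : HilbertSchmidt K G →L[ℝ] (K →L[ℝ] G) :=
  LinearMap.mkContinuous toCLM 1 fun S => by
    rw [one_mul]
    exact ContinuousLinearMap.opNorm_le_bound _ (norm_nonneg _) S.norm_apply_le

theorem norm_sq_eq (S : HilbertSchmidt K G) : ‖S‖ ^ 2 = ∑' i, ‖toCLM S (hsBasis K i)‖ ^ 2 := by
  rw [← real_inner_self_eq_norm_sq]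
  exact tsum_congr fun i => real_inner_self_eq_norm_sq _

/-- A Cauchy sequence converges in operator norm, and only finite partial sums of the
Hilbert-Schmidt norm pass to that limit. Since their bounds are uniform in the finite set, they
control the full sum. Completeness is needed for Bochner integrals of the integrands. -/
instance : CompleteSpace (HilbertSchmidt K G) := by
  refine Metric.complete_of_cauchySeq_tendsto fun u hu => ?_
  obtain ⟨L, hL⟩ := cauchySeq_tendsto_of_complete 
    ((toCLML (K := K) (G := G)).uniformContinuous.comp_cauchySeq hu)
  have key : ∀ ε > 0, ∃ N, ∀ n ≥ N, ∀ s : Finset (hsIndex K),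
      ∑ i ∈ s, ‖((u n).toCLM - L) (hsBasis K i)‖ ^ 2 ≤ ε ^ 2 := by
    intro ε hε
    obtain ⟨N, hN⟩ := Metric.cauchySeq_iff.1 hu ε hε
    refine ⟨N, fun n hn s => ?_⟩
    have h1 : Tendsto (fun m => ∑ i ∈ s, ‖((u n).toCLM - (u m).toCLM) (hsBasis K i)‖ ^ 2) atTop
        (𝓝 (∑ i ∈ s, ‖((u n).toCLM - L) (hsBasis K i)‖ ^ 2)) := by
      refine tendsto_finsetSum _ fun i _ => ?_
      refine Tendsto.pow (Tendsto.norm ?_) 2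
      exact tendsto_const_nhds.sub
        (((ContinuousLinearMap.apply ℝ G (hsBasis K i)).continuous.tendsto L).comp hL)
    refine le_of_tendsto h1 (eventually_atTop.2 ⟨N, fun m hm => ?_⟩)
    have h2 := hN n hn m hm
    rw [dist_eq_norm] at h2
    calc _ ≤ ‖u n - u m‖ ^ 2 := by
          rw [norm_sq_eq]
          have := (u n - u m).summable_sq.sum_le_tsum s (fun i _ => by positivity)
          simpa only [map_sub] using this
      _ ≤ ε ^ 2 := by gcongr
  have hs : ∀ n, (∀ s : Finset (hsIndex K),
      ∑ i ∈ s, ‖((u n).toCLM - L) (hsBasis K i)‖ ^ 2 ≤ 1 ^ 2) → L ∈ hsSubmodule K G := by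
    intro n hn
    have h1 : (u n).toCLM - L ∈ hsSubmodule K G :=
      summable_of_sum_le (fun i => by positivity) hn
    have h2 := (hsSubmodule K G).sub_mem (u n).2 h1
    have h3 : (u n).1 - ((u n).toCLM - L) = L := sub_sub_cancel _ _
    rwa [h3] at h2
  obtain ⟨N, hN⟩ := key 1 one_pos
  have hLm := hs N (hN N le_rfl)
  refine ⟨ofCLM L hLm, Metric.tendsto_atTop.2 fun ε hε => ?_⟩
  obtain ⟨N, hN⟩ := key (ε / 2) (half_pos hε)
  refine ⟨N, fun n hn => ?_⟩
  rw [dist_eq_norm]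
  have h1 : ‖u n - ofCLM L hLm‖ ^ 2 ≤ (ε / 2) ^ 2 := by
    rw [norm_sq_eq]
    exact Real.tsum_le_of_sum_le (fun i => by positivity) fun s => hN n hn s
  have := (pow_le_pow_iff_left₀ (norm_nonneg _) (by positivity) two_ne_zero).1 h1
  linarith

/-- The rank one operator `x ↦ ⟨k, x⟩ g`. -/
def rankOne (k : K) (g : G) : HilbertSchmidt K G :=
  ofCLM ((innerSL ℝ k).smulRight g) (by
    have h : Summable fun i => (inner ℝ k (hsBasis K i) : ℝ) * inner ℝ (hsBasis K i) k :=
      ((hsBasis K).hasSum_inner_mul_inner k k).summable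
    refine (h.mul_right (‖g‖ ^ 2)).congr fun i => ?_
    simp only [ContinuousLinearMap.smulRight_apply, innerSL_apply_apply, norm_smul, mul_pow]
    rw [Real.norm_eq_abs, sq_abs, real_inner_comm k, pow_two (inner ℝ k _)])

@[simp] theorem rankOne_apply (k : K) (g : G) (x : K) :
    (rankOne k g).toCLM x = (inner ℝ k x : ℝ) • g := rfl

theorem rankOne_add_left (k l : K) (g : G) : rankOne (k + l) g = rankOne k g + rankOne l g := by
  refine toCLM_injective (ContinuousLinearMap.ext fun x => ?_)
  simp [inner_add_left, add_smul]

theorem rankOne_smul_left (a : ℝ) (k : K) (g : G) : rankOne (a • k) g = a • rankOne k g := by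
  refine toCLM_injective (ContinuousLinearMap.ext fun x => ?_)
  simp [real_inner_smul_left, mul_smul]

theorem enorm_rankOne (k : K) (g : G) : ‖rankOne k g‖ₑ = ‖k‖ₑ * ‖g‖ₑ := by
  have h : ‖rankOne k g‖ₑ ^ 2 = (‖k‖ₑ * ‖g‖ₑ) ^ 2 := by
    rw [enorm_sq_eq (hsBasis K), mul_pow, enorm_sq_eq_tsum_hilbertBasis (hsBasis K) k,
      ← ENNReal.tsum_mul_right]
    refine tsum_congr fun i => ?_
    rw [rankOne_apply, enorm_smul, mul_pow]
  exact le_antisymm ((ENNReal.pow_le_pow_left_iff two_ne_zero).1 h.le)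
    ((ENNReal.pow_le_pow_left_iff two_ne_zero).1 h.ge)

end HilbertSchmidt

/-- An orthonormal sequence with dense span, except that zero vectors are allowed. -/
structure IsParsevalSeq {K : Type*} [NormedAddCommGroup K] [InnerProductSpace ℝ K]
    (e : ℕ → K) : Prop where
  orthogonal : ∀ i j, i ≠ j → (inner ℝ (e i) (e j) : ℝ) = 0
  norm_eq : ∀ i, e i ≠ 0 → ‖e i‖ = 1
  dense : Dense (Submodule.span ℝ (Set.range e) : Set K)

namespace IsParsevalSeq

variable {K G : Type*} [NormedAddCommGroup K] [InnerProductSpace ℝ K] [CompleteSpace K]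
  [NormedAddCommGroup G] [InnerProductSpace ℝ G] [CompleteSpace G]

/-- Linearly dependent vectors become zero under Gram-Schmidt. Allowing zeros keeps the index set
`ℕ` the same for all spaces `H_q`, whose dimension may vary with the point. -/
theorem gramSchmidtNormed {d : ℕ → K} (hd : Dense (Submodule.span ℝ (Set.range d) : Set K)) :
    IsParsevalSeq (InnerProductSpace.gramSchmidtNormed ℝ d) where
  orthogonal i j hij := by
    simp [InnerProductSpace.gramSchmidtNormed, real_inner_smul_left, real_inner_smul_right,
      InnerProductSpace.gramSchmidt_orthogonal ℝ d hij]
  norm_eq i hi := InnerProductSpace.gramSchmidtNormed_unit_length' hi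
  dense := by
    rwa [InnerProductSpace.span_gramSchmidtNormed_range, InnerProductSpace.span_gramSchmidt]

variable {e : ℕ → K} (he : IsParsevalSeq e)
include he

theorem exists_hilbertBasis :
    ∃ b : HilbertBasis {i | e i ≠ 0} ℝ K, ∀ i, b i = e i := by
  have hv : Orthonormal ℝ fun i : {i | e i ≠ 0} => e i :=
    ⟨fun i => he.norm_eq i i.2, fun i j hij => he.orthogonal _ _ fun h => hij (Subtype.ext h)⟩
  have hsp : Submodule.span ℝ (Set.range fun i : {i | e i ≠ 0} => e i)
      = Submodule.span ℝ (Set.range e) := by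
    refine le_antisymm (Submodule.span_mono ?_) (Submodule.span_le.2 ?_)
    · rintro _ ⟨i, rfl⟩
      exact ⟨i, rfl⟩
    · rintro _ ⟨i, rfl⟩
      by_cases h : e i = 0
      · rw [h]
        exact Submodule.zero_mem _
      · exact Submodule.subset_span ⟨⟨i, h⟩, rfl⟩
  refine ⟨HilbertBasis.mk hv ?_, fun i => ?_⟩
  · rw [hsp, (Submodule.dense_iff_topologicalClosure_eq_top).1 he.dense]
  · rw [HilbertBasis.coe_mk]

theorem tsum_subtype_eq {f : ℕ → ℝ≥0∞} (hf : ∀ i, e i = 0 → f i = 0) :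
    ∑' i : {i | e i ≠ 0}, f i = ∑' i, f i :=
  tsum_subtype_eq_of_support_subset fun i hi h => hi (hf i h)

theorem enorm_sq_eq (x : K) : ‖x‖ₑ ^ 2 = ∑' i, ‖(inner ℝ (e i) x : ℝ)‖ₑ ^ 2 := by
  obtain ⟨b, hb⟩ := he.exists_hilbertBasis
  rw [enorm_sq_eq_tsum_hilbertBasis b, ← he.tsum_subtype_eq fun i hi => by simp [hi]]
  exact tsum_congr fun i => by rw [hb, real_inner_comm]

/-- The norm is expressed through countably many matrix coefficients; measurability of the norm and
convergence of truncations both come from this formula. -/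
theorem hilbertSchmidt_enorm_sq_eq {e' : ℕ → G} (he' : IsParsevalSeq e')
    (S : HilbertSchmidt K G) :
    ‖S‖ₑ ^ 2 = ∑' p : ℕ × ℕ, ‖(inner ℝ (e' p.2) (S.toCLM (e p.1)) : ℝ)‖ₑ ^ 2 := by
  obtain ⟨b, hb⟩ := he.exists_hilbertBasis
  rw [HilbertSchmidt.enorm_sq_eq b, ENNReal.tsum_prod
    (f := fun i j => ‖(inner ℝ (e' j) (S.toCLM (e i)) : ℝ)‖ₑ ^ 2),
    ← he.tsum_subtype_eq fun i hi => by simp [hi]]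
  exact tsum_congr fun i => by rw [hb, he'.enorm_sq_eq]

omit [CompleteSpace K] in
-- The factor is 1 unless `e i = 0`, and then the coefficient vanishes too; so the zero vectors
-- never disturb an expansion.
theorem inner_self_smul (x : ℝ) (i : ℕ) (hx : e i = 0 → x = 0) :
    x * (inner ℝ (e i) (e i) : ℝ) = x := by
  by_cases h : e i = 0
  · simp [hx h]
  · rw [real_inner_self_eq_norm_sq, he.norm_eq i h]
    simp

end IsParsevalSeq

/-! ### Finite rank compressions. -/

namespace HilbertSchmidt

variable {K G : Type*} [NormedAddCommGroup K] [InnerProductSpace ℝ K] [CompleteSpace K]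
  [NormedAddCommGroup G] [InnerProductSpace ℝ G] [CompleteSpace G]

/-- The compression of `S` to the first `N` vectors of two sequences. -/
def truncate (e : ℕ → K) (e' : ℕ → G) (N : ℕ) (S : HilbertSchmidt K G) : HilbertSchmidt K G :=
  ∑ p ∈ Finset.range N ×ˢ Finset.range N,
    (inner ℝ (e' p.2) (S.toCLM (e p.1)) : ℝ) • rankOne (e p.1) (e' p.2)

variable {e : ℕ → K} (he : IsParsevalSeq e) {e' : ℕ → G} (he' : IsParsevalSeq e')
include he he'

theorem inner_truncate (N : ℕ) (S : HilbertSchmidt K G) (p : ℕ × ℕ) :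
    (inner ℝ (e' p.2) ((truncate e e' N S).toCLM (e p.1)) : ℝ)
      = if p ∈ Finset.range N ×ˢ Finset.range N then inner ℝ (e' p.2) (S.toCLM (e p.1)) else 0 := by
  have h : (truncate e e' N S).toCLM (e p.1) = ∑ r ∈ Finset.range N ×ˢ Finset.range N,
      ((inner ℝ (e' r.2) (S.toCLM (e r.1)) : ℝ) * (inner ℝ (e r.1) (e p.1) : ℝ)) • e' r.2 := by
    simp [truncate, map_sum, mul_smul]
  have h0 : ∀ r : ℕ × ℕ, r ≠ p → (inner ℝ (e' r.2) (S.toCLM (e r.1)) : ℝ) *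
      (inner ℝ (e r.1) (e p.1) : ℝ) * (inner ℝ (e' p.2) (e' r.2) : ℝ) = 0 := by
    intro r hr
    by_cases h1 : r.1 = p.1
    · have h2 : p.2 ≠ r.2 := fun h => hr (Prod.ext h1 h.symm)
      rw [he'.orthogonal _ _ h2, mul_zero]
    · rw [he.orthogonal _ _ h1, mul_zero, zero_mul]
  rw [h, inner_sum]
  simp only [real_inner_smul_right]
  split_ifs with hp
  · rw [Finset.sum_eq_single_of_mem p hp fun r _ hr => h0 r hr, mul_right_comm,
      he'.inner_self_smul, he.inner_self_smul]
    · intro h; simp [h]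
    · intro h; simp [h]
  · exact Finset.sum_eq_zero fun r hr => h0 r fun h => hp (h ▸ hr)

theorem enorm_truncate_le (N : ℕ) (S : HilbertSchmidt K G) : ‖truncate e e' N S‖ₑ ≤ ‖S‖ₑ := by
  refine (ENNReal.pow_le_pow_left_iff two_ne_zero).1 ?_
  rw [he.hilbertSchmidt_enorm_sq_eq he', he.hilbertSchmidt_enorm_sq_eq he']
  refine ENNReal.tsum_le_tsum fun p => ?_
  rw [inner_truncate he he']
  split_ifs <;> simp

/-- The squared error is the sum of the squared matrix coefficients outside the square `[0, N)²`, a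
tail of a convergent series. -/
theorem tendsto_truncate (S : HilbertSchmidt K G) :
    Tendsto (fun N => truncate e e' N S) atTop (𝓝 S) := by
  have h1 : ∀ N, ‖truncate e e' N S - S‖ₑ ^ 2
      = ∑' p : {p // p ∉ Finset.range N ×ˢ Finset.range N},
        ‖(inner ℝ (e' p.1.2) (S.toCLM (e p.1.1)) : ℝ)‖ₑ ^ 2 := by
    intro N
    rw [he.hilbertSchmidt_enorm_sq_eq he']
    have := tsum_subtype {p | p ∉ Finset.range N ×ˢ Finset.range N}
      fun p : ℕ × ℕ => ‖(inner ℝ (e' p.2) (S.toCLM (e p.1)) : ℝ)‖ₑ ^ 2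
    refine Eq.trans ?_ this.symm
    refine tsum_congr fun p => ?_
    rw [map_sub, sub_apply, inner_sub_right, inner_truncate he he',
      Set.indicator_apply]
    by_cases hp : p ∈ Finset.range N ×ˢ Finset.range N
    · rw [if_pos hp, if_neg (by simpa using hp)]; simp
    · rw [if_neg hp, if_pos (by simpa using hp)]; simp
  have h2 : Tendsto (fun N => Finset.range N ×ˢ Finset.range N) atTop atTop :=
    tendsto_atTop_finset_of_monotone
      (fun a b hab => Finset.product_subset_product (Finset.range_mono hab) (Finset.range_mono hab))
      fun p => ⟨p.1 + p.2 + 1, by simp only [Finset.mem_product, Finset.mem_range]; omega⟩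
  have h3 := (ENNReal.tendsto_tsum_compl_atTop_zero (f := fun p : ℕ × ℕ =>
    ‖(inner ℝ (e' p.2) (S.toCLM (e p.1)) : ℝ)‖ₑ ^ 2) (by
      rw [← he.hilbertSchmidt_enorm_sq_eq he' S]; finiteness)).comp h2
  have h4 : Tendsto (fun N => ‖truncate e e' N S - S‖ₑ ^ 2) atTop (𝓝 0) := by
    simp only [h1]
    exact h3
  rw [tendsto_iff_norm_sub_tendsto_zero]
  have h5 : Tendsto (fun N => ‖truncate e e' N S - S‖ ^ 2) atTop (𝓝 0) := by
    have := (ENNReal.tendsto_toReal ENNReal.zero_ne_top).comp h4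
    simpa [Function.comp_def] using this
  have h6 := h5.sqrt
  simpa using h6

end HilbertSchmidt
end

/-! ### Measurable fields of operators over varying Hilbert spaces. -/

noncomputable section

section MeasurableFields

variable {H : Type*} [NormedAddCommGroup H] [InnerProductSpace ℝ H]
  {G : Type*} [NormedAddCommGroup G] [InnerProductSpace ℝ G] [CompleteSpace G]
  {X : Type*} [MeasurableSpace X] {q : X → HilbertianSeminorm H}

/-- `q` depends measurably on the parameter. -/
def IsMeasurableSeminorm (q : X → HilbertianSeminorm H) : Prop :=
  ∀ h₁ h₂ : H, Measurable fun x => (q x).form h₁ h₂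

theorem HilbertianSeminorm.inner_incl (q : HilbertianSeminorm H) (h₁ h₂ : H) :
    (inner ℝ (q.incl h₁) (q.incl h₂) : ℝ) = q.form h₁ h₂ :=
  UniformSpace.Completion.inner_coe (𝕜 := ℝ) (q.toPre h₁) (q.toPre h₂)

theorem HilbertianSeminorm.denseRange_incl (q : HilbertianSeminorm H) : DenseRange q.incl :=
  UniformSpace.Completion.denseRange_coe (α := q.Pre)

/-- A field of operators that is measurable in the weak sense. -/
def IsMeasurableOperatorField (Φ : ∀ x, HilbertSchmidt (q x).Space G) : Prop :=
  ∀ (h : H) (g : G), Measurable fun x =>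
    (inner ℝ (ContinuousLinearMap.adjoint (Φ x).toCLM g) ((q x).incl h) : ℝ)

/-- The vector fields generated by the constant fields and multiplication by measurable
functions. -/
inductive IsGeneratedField (q : X → HilbertianSeminorm H) : (∀ x, (q x).Space) → Prop
  | incl (h : H) : IsGeneratedField q fun x => (q x).incl h
  | add {v w : ∀ x, (q x).Space} : IsGeneratedField q v → IsGeneratedField q w →
      IsGeneratedField q fun x => v x + w x
  | smul {c : X → ℝ} {v : ∀ x, (q x).Space} : Measurable c → IsGeneratedField q v →
      IsGeneratedField q fun x => c x • v x

namespace IsGeneratedField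

theorem sub {v w : ∀ x, (q x).Space} (hv : IsGeneratedField q v) (hw : IsGeneratedField q w) :
    IsGeneratedField q fun x => v x - w x := by
  have h := hv.add (hw.smul (c := fun _ => -1) measurable_const)
  simpa [sub_eq_add_neg] using h

theorem sum {ι : Type*} (s : Finset ι) {v : ι → ∀ x, (q x).Space}
    (hv : ∀ i ∈ s, IsGeneratedField q (v i)) : IsGeneratedField q fun x => ∑ i ∈ s, v i x := by
  classical
  induction s using Finset.induction_on with
  | empty => simpa using IsGeneratedField.incl (q := q) 0
  | insert a s ha ih =>
    simp only [Finset.sum_insert ha]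
    exact (hv a (Finset.mem_insert_self a s)).add
      (ih fun i hi => hv i (Finset.mem_insert_of_mem hi))

theorem measurable_inner (hq : IsMeasurableSeminorm q) {v w : ∀ x, (q x).Space}
    (hv : IsGeneratedField q v) (hw : IsGeneratedField q w) :
    Measurable fun x => (inner ℝ (v x) (w x) : ℝ) := by
  induction hv with
  | incl h =>
    induction hw with
    | incl k => simpa only [HilbertianSeminorm.inner_incl] using hq h k
    | add _ _ h1 h2 => simpa only [inner_add_right] using h1.fun_add h2
    | smul hc _ h1 => simpa only [real_inner_smul_right] using hc.fun_mul h1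
  | add _ _ h1 h2 => simpa only [inner_add_left] using h1.fun_add h2
  | smul hc _ h1 => simpa only [real_inner_smul_left] using hc.fun_mul h1

theorem measurable_norm (hq : IsMeasurableSeminorm q) {v : ∀ x, (q x).Space}
    (hv : IsGeneratedField q v) : Measurable fun x => ‖v x‖ := by
  have h := (hv.measurable_inner hq hv).sqrt
  simpa only [real_inner_self_eq_norm_sq, Real.sqrt_sq (norm_nonneg _)] using h

theorem measurable_apply {Φ : ∀ x, HilbertSchmidt (q x).Space G}
    (hΦ : IsMeasurableOperatorField Φ) {v : ∀ x, (q x).Space} (hv : IsGeneratedField q v) (g : G) :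
    Measurable fun x => (inner ℝ g ((Φ x).toCLM (v x)) : ℝ) := by
  induction hv with
  | incl h => simpa only [ContinuousLinearMap.adjoint_inner_left] using hΦ h g
  | add _ _ h1 h2 => simpa only [map_add, inner_add_right] using h1.fun_add h2
  | smul hc _ h1 => simpa only [map_smul, real_inner_smul_right] using hc.fun_mul h1

/-- Strong induction: the coefficients are quotients of inner products of generated fields, hence
measurable. Where an earlier vector vanishes the quotient is zero by convention, and the term is
zero anyway. -/
theorem gramSchmidt (hq : IsMeasurableSeminorm q) (d : ℕ → H) (n : ℕ) :
    IsGeneratedField q fun x => InnerProductSpace.gramSchmidt ℝ (fun k => (q x).incl (d k)) n := by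
  induction n using Nat.strong_induction_on with
  | _ n ih =>
    have h : ∀ x, InnerProductSpace.gramSchmidt ℝ (fun k => (q x).incl (d k)) n
        = (q x).incl (d n) - ∑ i ∈ Finset.Iio n,
          ((inner ℝ (InnerProductSpace.gramSchmidt ℝ (fun k => (q x).incl (d k)) i)
              ((q x).incl (d n)) : ℝ) /
            ‖InnerProductSpace.gramSchmidt ℝ (fun k => (q x).incl (d k)) i‖ ^ 2) •
          InnerProductSpace.gramSchmidt ℝ (fun k => (q x).incl (d k)) i := by
      intro x
      refine eq_sub_of_add_eq ?_
      exact (InnerProductSpace.gramSchmidt_def'' ℝ (fun k => (q x).incl (d k)) n).symm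
    simp only [h]
    refine (IsGeneratedField.incl (d n)).sub (sum _ fun i hi => ?_)
    have hi := ih i (Finset.mem_Iio.1 hi)
    exact hi.smul (((hi.measurable_inner hq (.incl (d n))).div ((hi.measurable_norm hq).pow_const 2)))

end IsGeneratedField

variable [TopologicalSpace.SeparableSpace H]

theorem dense_span_denseSeq (G : Type*) [NormedAddCommGroup G] [InnerProductSpace ℝ G]
    [TopologicalSpace.SeparableSpace G] :
    Dense (Submodule.span ℝ (Set.range (TopologicalSpace.denseSeq G)) : Set G) :=
  (TopologicalSpace.denseRange_denseSeq G).mono Submodule.subset_span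

/-- An orthonormal sequence, up to zeros, in a separable Hilbert space. -/
def orthoSeq (G : Type*) [NormedAddCommGroup G] [InnerProductSpace ℝ G]
    [TopologicalSpace.SeparableSpace G] : ℕ → G :=
  InnerProductSpace.gramSchmidtNormed ℝ (TopologicalSpace.denseSeq G)

theorem isParsevalSeq_orthoSeq (G : Type*) [NormedAddCommGroup G] [InnerProductSpace ℝ G]
    [CompleteSpace G] [TopologicalSpace.SeparableSpace G] : IsParsevalSeq (orthoSeq G) :=
  .gramSchmidtNormed (dense_span_denseSeq G)

/-- An orthonormal sequence, up to zeros, in `H_q`, which depends measurably on `q`. -/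
def HilbertianSeminorm.orthoSeq (q : HilbertianSeminorm H) : ℕ → q.Space :=
  InnerProductSpace.gramSchmidtNormed ℝ fun k => q.incl (TopologicalSpace.denseSeq H k)

theorem HilbertianSeminorm.isParsevalSeq_orthoSeq (q : HilbertianSeminorm H) :
    IsParsevalSeq q.orthoSeq := by
  refine .gramSchmidtNormed (Dense.mono Submodule.subset_span ?_)
  exact q.denseRange_incl.comp (TopologicalSpace.denseRange_denseSeq H) q.incl.continuous

theorem IsGeneratedField.orthoSeq (hq : IsMeasurableSeminorm q) (n : ℕ) :
    IsGeneratedField q fun x => (q x).orthoSeq n :=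
  have h := IsGeneratedField.gramSchmidt hq (TopologicalSpace.denseSeq H) n
  h.smul (h.measurable_norm hq).inv

variable [TopologicalSpace.SeparableSpace G]

/-- The norm is the `ℓ²` norm of countably many matrix coefficients, taken along orthonormal
sequences that depend measurably on the point. -/
theorem IsMeasurableOperatorField.measurable_enorm (hq : IsMeasurableSeminorm q)
    {Φ : ∀ x, HilbertSchmidt (q x).Space G} (hΦ : IsMeasurableOperatorField Φ) :
    Measurable fun x => ‖Φ x‖ₑ := by
  have h : ∀ x, ‖Φ x‖ₑ = (∑' p : ℕ × ℕ, ‖(inner ℝ (_root_.orthoSeq G p.2)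
      ((Φ x).toCLM ((q x).orthoSeq p.1)) : ℝ)‖ₑ ^ 2) ^ (1 / 2 : ℝ) := by
    intro x
    rw [← (q x).isParsevalSeq_orthoSeq.hilbertSchmidt_enorm_sq_eq (isParsevalSeq_orthoSeq G),
      ← ENNReal.rpow_natCast, ← ENNReal.rpow_mul]
    norm_num
  simp only [h]
  refine (Measurable.tsum fun p => ?_).pow_const _
  exact ((IsGeneratedField.orthoSeq hq p.1).measurable_apply hΦ _).enorm.pow_const 2

theorem IsMeasurableOperatorField.add {Φ Ψ : ∀ x, HilbertSchmidt (q x).Space G}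
    (hΦ : IsMeasurableOperatorField Φ) (hΨ : IsMeasurableOperatorField Ψ) :
    IsMeasurableOperatorField fun x => Φ x + Ψ x := fun h g => by
  simpa only [map_add, add_apply, inner_add_left] using (hΦ h g).fun_add (hΨ h g)

theorem IsMeasurableOperatorField.smul {Φ : ∀ x, HilbertSchmidt (q x).Space G}
    (hΦ : IsMeasurableOperatorField Φ) {c : X → ℝ} (hc : Measurable c) :
    IsMeasurableOperatorField fun x => c x • Φ x := fun h g => by
  simpa only [map_smul, smul_apply, real_inner_smul_left, map_smulₛₗ, conj_trivial]
    using hc.fun_mul (hΦ h g)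

theorem IsMeasurableOperatorField.sub {Φ Ψ : ∀ x, HilbertSchmidt (q x).Space G}
    (hΦ : IsMeasurableOperatorField Φ) (hΨ : IsMeasurableOperatorField Ψ) :
    IsMeasurableOperatorField fun x => Φ x - Ψ x := fun h g => by
  simpa only [map_sub, sub_apply, inner_sub_left] using (hΦ h g).fun_sub (hΨ h g)

theorem IsMeasurableOperatorField.sum {ι : Type*} (s : Finset ι)
    {Φ : ι → ∀ x, HilbertSchmidt (q x).Space G}
    (hΦ : ∀ i ∈ s, IsMeasurableOperatorField (Φ i)) :
    IsMeasurableOperatorField fun x => ∑ i ∈ s, Φ i x := fun h g => by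
  simpa only [map_sum, sum_apply, sum_inner]
    using Finset.measurable_sum s fun i hi => hΦ i hi h g

theorem IsGeneratedField.rankOne (hq : IsMeasurableSeminorm q) {v : ∀ x, (q x).Space}
    (hv : IsGeneratedField q v) (g : G) :
    IsMeasurableOperatorField fun x => HilbertSchmidt.rankOne (v x) g := fun h g' => by
  simpa only [ContinuousLinearMap.adjoint_inner_left, HilbertSchmidt.rankOne_apply,
    real_inner_smul_right] using (hv.measurable_inner hq (.incl h)).mul_const (inner ℝ g' g)

theorem IsMeasurableOperatorField.comp {Y : Type*} [MeasurableSpace Y]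
    {Φ : ∀ x, HilbertSchmidt (q x).Space G} (hΦ : IsMeasurableOperatorField Φ) {f : Y → X}
    (hf : Measurable f) : IsMeasurableOperatorField (q := fun y => q (f y)) fun y => Φ (f y) :=
  fun h g => (hΦ h g).comp hf

/-- A weakly measurable family in a fixed space of Hilbert-Schmidt operators is strongly
measurable. -/
theorem stronglyMeasurable_hilbertSchmidt {q : HilbertianSeminorm H}
    {Φ : X → HilbertSchmidt q.Space G}
    (hΦ : IsMeasurableOperatorField (q := fun _ : X => q) Φ) : StronglyMeasurable Φ := by
  -- In a fixed space the truncations are finite sums of measurable scalars times constant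
  -- operators, so their limit is strongly measurable.
  refine stronglyMeasurable_of_tendsto atTop (f := fun N x =>
    HilbertSchmidt.truncate q.orthoSeq (orthoSeq G) N (Φ x)) (fun N => ?_) ?_
  · have h : (fun x => HilbertSchmidt.truncate q.orthoSeq (orthoSeq G) N (Φ x)) = fun x =>
        ∑ p ∈ Finset.range N ×ˢ Finset.range N,
          (inner ℝ (orthoSeq G p.2) ((Φ x).toCLM (q.orthoSeq p.1)) : ℝ) •
            HilbertSchmidt.rankOne (q.orthoSeq p.1) (orthoSeq G p.2) := rfl
    rw [h]
    refine Finset.stronglyMeasurable_fun_sum _ fun p _ => ?_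
    refine StronglyMeasurable.smul_const (Measurable.stronglyMeasurable ?_) _
    exact (IsGeneratedField.orthoSeq (q := fun _ : X => q) (fun _ _ => measurable_const)
      p.1).measurable_apply hΦ _
  · exact tendsto_pi_nhds.2 fun x =>
      HilbertSchmidt.tendsto_truncate q.isParsevalSeq_orthoSeq (isParsevalSeq_orthoSeq G) (Φ x)

end MeasurableFields
end

/-! ### Discrete martingales: maximal inequality and oscillation counts. -/

noncomputable section

section DiscreteMartingales

variable {Ω : Type*} {mΩ : MeasurableSpace Ω} {P : Measure Ω} [IsFiniteMeasure P]
  {G : Type*} [NormedAddCommGroup G] [InnerProductSpace ℝ G] [CompleteSpace G]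

theorem integrable_inner_of_memLp {X Y : Ω → G} (hX : MemLp X 2 P) (hY : MemLp Y 2 P) :
    Integrable (fun ω => (inner ℝ (X ω) (Y ω) : ℝ)) P := by
  refine Integrable.mono' (g := fun ω => ‖X ω‖ * ‖Y ω‖) ?_
    (hX.1.inner hY.1) (ae_of_all _ fun ω => norm_inner_le_norm _ _)
  exact hX.norm.integrable_mul hY.norm

/-- `Z` is known at time `s` and can be pulled out of the conditional expectation, under which the
increment vanishes. -/
theorem MeasureTheory.Martingale.integral_inner_sub_eq_zero {ι : Type*} [Preorder ι]
    {𝒢 : Filtration ι mΩ} {X : ι → Ω → G} (hX : Martingale X 𝒢 P) (h2 : ∀ i, MemLp (X i) 2 P)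
    {s t : ι} (hst : s ≤ t) {Z : Ω → G} (hZ : StronglyMeasurable[𝒢 s] Z) (hZ2 : MemLp Z 2 P) :
    ∫ ω, (inner ℝ (X t ω - X s ω) (Z ω) : ℝ) ∂P = 0 := by
  have h1 : P[fun ω => X t ω - X s ω | 𝒢 s] =ᵐ[P] 0 := by
    have h := condExp_sub (hX.integrable t) (hX.integrable s) (𝒢 s)
    filter_upwards [h, hX.2 s t hst, hX.2 s s le_rfl] with ω h h3 h4
    change P[X t - X s | 𝒢 s] ω = 0
    rw [h, Pi.sub_apply, h3, h4, sub_self]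
  have h3 := condExp_bilin_of_stronglyMeasurable_right (μ := P) (innerSL ℝ) hZ
    (f := fun ω => X t ω - X s ω) (integrable_inner_of_memLp ((h2 t).sub (h2 s)) hZ2)
    ((hX.integrable t).sub (hX.integrable s))
  rw [← integral_condExp (𝒢.le s)]
  refine (integral_congr_ae (h3.trans ?_)).trans (integral_zero _ _)
  filter_upwards [h1] with ω hω
  simp [hω]

/-- The running maximum of a sequence. -/
def runMax (y : ℕ → ℝ) : ℕ → ℝ
  | 0 => y 0
  | n + 1 => max (runMax y n) (y (n + 1))

theorem le_runMax (y : ℕ → ℝ) {k n : ℕ} (h : k ≤ n) : y k ≤ runMax y n := by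
  induction n with
  | zero => rw [Nat.le_zero.1 h]; exact le_rfl
  | succ n ih =>
    rcases Nat.le_succ_iff.1 h with h | rfl
    · exact (ih h).trans (le_max_left _ _)
    · exact le_max_right _ _

/-- The running maximum rises only at steps where the new value attains it. Summation by parts thus
turns `∑ y dM` into `∑ M dM`, which is at least half of the telescoping sum of squares. Doob's
inequality follows from this deterministic estimate. -/
theorem runMax_sq_le (y : ℕ → ℝ) (n : ℕ) :
    runMax y n ^ 2 / 2 + ∑ k ∈ Finset.range n, runMax y k * (y (k + 1) - y k)
      ≤ runMax y n * y n := by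
  induction n with
  | zero => simp only [runMax, Finset.range_zero, Finset.sum_empty]; nlinarith [sq_nonneg (y 0)]
  | succ n ih =>
    rw [Finset.sum_range_succ]
    have h : runMax y (n + 1) = max (runMax y n) (y (n + 1)) := rfl
    rcases le_total (runMax y n) (y (n + 1)) with h1 | h1
    · rw [h, max_eq_right h1]
      nlinarith [sq_nonneg (runMax y n - y (n + 1))]
    · rw [h, max_eq_left h1]
      nlinarith

variable {𝒢 : Filtration ℕ mΩ} {x : ℕ → Ω → G}

theorem stronglyMeasurable_runMax_norm (hx : StronglyAdapted 𝒢 x) (n : ℕ) :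
    StronglyMeasurable[𝒢 n] fun ω => runMax (fun k => ‖x k ω‖) n := by
  induction n with
  | zero => exact (hx 0).norm
  | succ n ih =>
    exact continuous_max.comp_stronglyMeasurable
      ((ih.mono (𝒢.mono n.le_succ)).prodMk (hx (n + 1)).norm)

theorem memLp_runMax_norm (h2 : ∀ i, MemLp (x i) 2 P) (n : ℕ) :
    MemLp (fun ω => runMax (fun k => ‖x k ω‖) n) 2 P := by
  induction n with
  | zero => exact (h2 0).norm
  | succ n ih => exact ih.sup (h2 (n + 1)).norm

/-- Doob's maximal inequality in `L²` for a martingale in discrete time. -/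
theorem integral_runMax_sq_le (hx : Martingale x 𝒢 P) (h2 : ∀ i, MemLp (x i) 2 P) (n : ℕ) :
    ∫ ω, runMax (fun k => ‖x k ω‖) n ^ 2 ∂P ≤ 4 * ∫ ω, ‖x n ω‖ ^ 2 ∂P := by
  set S : ℕ → Ω → ℝ := fun n ω => runMax (fun k => ‖x k ω‖) n with hS
  have hS0 : ∀ k ω, 0 ≤ S k ω := fun k ω =>
    (norm_nonneg (x 0 ω)).trans (le_runMax (fun k => ‖x k ω‖) (Nat.zero_le k))
  have hS2 : ∀ k, MemLp (S k) 2 P := memLp_runMax_norm h2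
  have hSm : ∀ k, StronglyMeasurable[𝒢 k] (S k) := stronglyMeasurable_runMax_norm hx.stronglyAdapted
  -- Pairing increments with `S x / ‖x‖` bounds them by `S` times the increment of the norm, which
  -- stands in for the submartingale property of `‖x‖`. At `x = 0` the inverse is zero, and so is
  -- `Z`.
  let Z : ℕ → Ω → G := fun k ω => (S k ω * ‖x k ω‖⁻¹) • x k ω
  have hZn : ∀ k ω, ‖Z k ω‖ ≤ ‖S k ω‖ := by
    intro k ω
    rw [norm_smul, norm_mul, mul_assoc]
    refine mul_le_of_le_one_right (norm_nonneg _) ?_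
    rw [norm_inv, norm_norm]
    exact inv_mul_le_one_of_le₀ le_rfl (norm_nonneg _)
  have hZm : ∀ k, StronglyMeasurable[𝒢 k] (Z k) := fun k =>
    ((hSm k).mul (hx.stronglyAdapted k).norm.inv₀).smul (hx.stronglyAdapted k)
  have hZ2 : ∀ k, MemLp (Z k) 2 P := fun k =>
    (hS2 k).of_le ((hZm k).mono (𝒢.le k)).aestronglyMeasurable (ae_of_all _ (hZn k))
  have hp : ∀ k ω, (inner ℝ (x (k + 1) ω - x k ω) (Z k ω) : ℝ)
      ≤ S k ω * (‖x (k + 1) ω‖ - ‖x k ω‖) := by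
    intro k ω
    simp only [Z, real_inner_smul_right, inner_sub_left, real_inner_self_eq_norm_sq]
    rw [mul_assoc, mul_assoc, ← mul_sub]
    refine mul_le_mul_of_nonneg_left ?_ (hS0 k ω)
    by_cases h0 : ‖x k ω‖ = 0
    · rw [h0]; simp
    · have h1 := real_inner_le_norm (x (k + 1) ω) (x k ω)
      have h3 : 0 < ‖x k ω‖ := lt_of_le_of_ne (norm_nonneg _) (Ne.symm h0)
      have h4 : ‖x k ω‖⁻¹ * (inner ℝ (x (k + 1) ω) (x k ω) : ℝ) ≤ ‖x (k + 1) ω‖ := by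
        rw [inv_mul_le_iff₀ h3]
        linarith
      have h5 : ‖x k ω‖⁻¹ * ‖x k ω‖ ^ 2 = ‖x k ω‖ := by field_simp
      linarith
  -- The constant 4 comes from absorbing `S‖x_n‖ ≤ S²/4 + ‖x_n‖²` into the term `S²/2` on the left.
  have hpath : ∀ ω, S n ω ^ 2 ≤ 4 * ‖x n ω‖ ^ 2
      - 4 * ∑ k ∈ Finset.range n, (inner ℝ (x (k + 1) ω - x k ω) (Z k ω) : ℝ) := by
    intro ω
    have h1 := runMax_sq_le (fun k => ‖x k ω‖) n
    have h3 := Finset.sum_le_sum fun k (_ : k ∈ Finset.range n) => hp k ω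
    simp only [hS] at h3 ⊢
    nlinarith [sq_nonneg (runMax (fun k => ‖x k ω‖) n - 2 * ‖x n ω‖)]
  have hi : ∀ k, Integrable (fun ω => (inner ℝ (x (k + 1) ω - x k ω) (Z k ω) : ℝ)) P := fun k =>
    integrable_inner_of_memLp ((h2 (k + 1)).sub (h2 k)) (hZ2 k)
  have hi1 : Integrable (fun ω => 4 * ‖x n ω‖ ^ 2) P :=
    ((memLp_two_iff_integrable_sq_norm (h2 n).1).1 (h2 n)).const_mul 4
  have hi2 : Integrable (fun ω => 4 * ∑ k ∈ Finset.range n,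
      (inner ℝ (x (k + 1) ω - x k ω) (Z k ω) : ℝ)) P :=
    (integrable_finsetSum _ fun k _ => hi k).const_mul 4
  calc ∫ ω, S n ω ^ 2 ∂P ≤ ∫ ω, (4 * ‖x n ω‖ ^ 2
      - 4 * ∑ k ∈ Finset.range n, (inner ℝ (x (k + 1) ω - x k ω) (Z k ω) : ℝ)) ∂P :=
        integral_mono ((memLp_two_iff_integrable_sq (hS2 n).1).1 (hS2 n)) (hi1.sub hi2) hpath
    _ = 4 * ∫ ω, ‖x n ω‖ ^ 2 ∂P := by
        rw [integral_sub hi1 hi2, integral_const_mul, integral_const_mul,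
          integral_finsetSum _ fun k _ => hi k]
        simp only [hx.integral_inner_sub_eq_zero h2 (Nat.le_succ _) (hZm _) (hZ2 _)]
        simp

/-- The number of `ε`-oscillations of a sequence up to a given time, together with the current
reference point. -/
def greedyOsc (ε : ℝ) (y : ℕ → G) : ℕ → G × ℕ
  | 0 => (y 0, 0)
  | n + 1 => open Classical in
    if ε < ‖y (n + 1) - (greedyOsc ε y n).1‖ then (y (n + 1), (greedyOsc ε y n).2 + 1)
    else greedyOsc ε y n

omit [InnerProductSpace ℝ G] [CompleteSpace G] in
theorem greedyOsc_succ (ε : ℝ) (y : ℕ → G) (n : ℕ) :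
    greedyOsc ε y (n + 1) = open Classical in
      if ε < ‖y (n + 1) - (greedyOsc ε y n).1‖ then (y (n + 1), (greedyOsc ε y n).2 + 1)
      else greedyOsc ε y n := rfl

omit [InnerProductSpace ℝ G] [CompleteSpace G] in
theorem greedyOsc_count_mono (ε : ℝ) (y : ℕ → G) : Monotone fun n => (greedyOsc ε y n).2 := by
  refine monotone_nat_of_le_succ fun n => ?_
  rw [greedyOsc_succ]
  split_ifs <;> simp

omit [InnerProductSpace ℝ G] [CompleteSpace G] in
theorem norm_sub_greedyOsc_le {ε : ℝ} (hε : 0 ≤ ε) (y : ℕ → G) (n : ℕ) :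
    ‖y n - (greedyOsc ε y n).1‖ ≤ ε := by
  cases n with
  | zero => simpa [greedyOsc] using hε
  | succ n =>
    rw [greedyOsc_succ]
    split_ifs with h
    · simpa using hε
    · exact not_lt.1 h

omit [InnerProductSpace ℝ G] [CompleteSpace G] in
-- Were the count unchanged between `k` and `l`, the reference point would be the same at both
-- times; both values lie within `ε` of it, hence within `2ε` of each other.
theorem greedyOsc_count_lt {ε : ℝ} (hε : 0 ≤ ε) (y : ℕ → G) {k l : ℕ} (hkl : k ≤ l)
    (h : 2 * ε < ‖y k - y l‖) : (greedyOsc ε y k).2 < (greedyOsc ε y l).2 := by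
  refine lt_of_le_of_ne (greedyOsc_count_mono ε y hkl) fun heq => ?_
  have key : ∀ j, k ≤ j → j ≤ l → (greedyOsc ε y j).1 = (greedyOsc ε y k).1 := by
    intro j hkj
    induction j, hkj using Nat.le_induction with
    | base => intro _; rfl
    | succ j hkj ih =>
      intro hjl
      rw [← ih (by omega), greedyOsc_succ]
      have h1 : (greedyOsc ε y (j + 1)).2 ≤ (greedyOsc ε y l).2 :=
        greedyOsc_count_mono ε y hjl
      have h2 : (greedyOsc ε y k).2 ≤ (greedyOsc ε y j).2 := greedyOsc_count_mono ε y hkj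
      rw [greedyOsc_succ] at h1
      split_ifs at h1 ⊢ with h3
      · simp only at h1; omega
      · rfl
  have h1 := norm_sub_greedyOsc_le hε y k
  have h2 := norm_sub_greedyOsc_le hε y l
  rw [key l hkl le_rfl] at h2
  have h3 := norm_sub_le_norm_sub_add_norm_sub (y k) (greedyOsc ε y k).1 (y l)
  rw [norm_sub_rev (greedyOsc ε y k).1 (y l)] at h3
  linarith

theorem greedyOsc_measurable (ε : ℝ) (hx : StronglyAdapted 𝒢 x) (n : ℕ) :
    StronglyMeasurable[𝒢 n] (fun ω => (greedyOsc ε (fun k => x k ω) n).1) ∧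
      Measurable[𝒢 n] (fun ω => (greedyOsc ε (fun k => x k ω) n).2) := by
  classical
  induction n with
  | zero => exact ⟨hx 0, measurable_const⟩
  | succ n ih =>
    have h1 := ih.1.mono (𝒢.mono n.le_succ)
    have h2 := ih.2.mono (𝒢.mono n.le_succ) le_rfl
    have hs : MeasurableSet[𝒢 (n + 1)]
        {ω | ε < ‖x (n + 1) ω - (greedyOsc ε (fun k => x k ω) n).1‖} :=
      stronglyMeasurable_const.measurableSet_lt ((hx (n + 1)).sub h1).norm
    constructor
    · have h := @StronglyMeasurable.ite _ _ _ _ _ _ _ (fun _ => Classical.propDecidable _) hs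
        (hx (n + 1)) h1
      convert h using 2 with ω
      rw [greedyOsc_succ]
      by_cases h : ε < ‖x (n + 1) ω - (greedyOsc ε (fun k => x k ω) n).1‖ <;> simp [h]
    · have h := @Measurable.ite _ _ _ _ _ _ _ (fun _ => Classical.propDecidable _) hs
        (h2.add_const 1) h2
      convert h using 2 with ω
      rw [greedyOsc_succ]
      by_cases h : ε < ‖x (n + 1) ω - (greedyOsc ε (fun k => x k ω) n).1‖ <;> simp [h]

theorem greedyOsc_memLp (ε : ℝ) (hx : StronglyAdapted 𝒢 x) (h2 : ∀ i, MemLp (x i) 2 P) (n : ℕ) :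
    MemLp (fun ω => (greedyOsc ε (fun k => x k ω) n).1) 2 P := by
  have hb : ∀ ω, ‖(greedyOsc ε (fun k => x k ω) n).1‖ ≤ runMax (fun k => ‖x k ω‖) n := by
    intro ω
    induction n with
    | zero => exact le_rfl
    | succ n ih =>
      rw [greedyOsc_succ]
      split_ifs
      · exact le_max_right _ _
      · exact ih.trans (le_max_left _ _)
  exact (memLp_runMax_norm h2 n).of_le
    ((greedyOsc_measurable ε hx n).1.mono (𝒢.le n)).aestronglyMeasurable
    (ae_of_all _ fun ω => (hb ω).trans (le_abs_self _))

/-- This bound replaces the upcrossing inequality and works for Hilbert space values. Follow `‖x -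
R‖²` for the reference point `R`: each reset drops at least `ε²`, and between resets it changes like
`‖x‖²` up to the transform `∑ ⟨x_{k+1} - x_k, R_k⟩`, whose mean is zero because `R_k` is known at
time `k`. -/
theorem lintegral_greedyOsc_count_le {ε : ℝ} (hε : 0 ≤ ε) (hx : Martingale x 𝒢 P)
    (h2 : ∀ i, MemLp (x i) 2 P) (n : ℕ) :
    ENNReal.ofReal (ε ^ 2) * ∫⁻ ω, ((greedyOsc ε (fun k => x k ω) n).2 : ℝ≥0∞) ∂P
      ≤ ∫⁻ ω, ‖x n ω‖ₑ ^ 2 ∂P := by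
  have hm := greedyOsc_measurable ε hx.stronglyAdapted
  have hR2 := greedyOsc_memLp ε hx.stronglyAdapted h2
  have hpath : ∀ ω n, ε ^ 2 * (greedyOsc ε (fun k => x k ω) n).2
      + ‖x n ω - (greedyOsc ε (fun k => x k ω) n).1‖ ^ 2
      ≤ ‖x n ω‖ ^ 2 - 2 * ∑ k ∈ Finset.range n,
        (inner ℝ (x (k + 1) ω - x k ω) (greedyOsc ε (fun k => x k ω) k).1 : ℝ) := by
    intro ω n
    induction n with
    | zero => simp [greedyOsc]
    | succ n ih =>
      rw [Finset.sum_range_succ]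
      set R := (greedyOsc ε (fun k => x k ω) n).1 with hR
      have hexp : ‖x (n + 1) ω - R‖ ^ 2 - ‖x n ω - R‖ ^ 2 = ‖x (n + 1) ω‖ ^ 2 - ‖x n ω‖ ^ 2
          - 2 * (inner ℝ (x (n + 1) ω - x n ω) R : ℝ) := by
        rw [norm_sub_sq_real, norm_sub_sq_real, inner_sub_left]; ring
      rw [greedyOsc_succ]
      split_ifs with h
      · have : ε ^ 2 ≤ ‖x (n + 1) ω - R‖ ^ 2 := by
          have := h.le
          gcongr
        simp only [sub_self, norm_zero]
        push_cast
        nlinarith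
      · rw [← hR]
        nlinarith
  have hi : ∀ k, Integrable (fun ω => (inner ℝ (x (k + 1) ω - x k ω)
      (greedyOsc ε (fun k => x k ω) k).1 : ℝ)) P := fun k =>
    integrable_inner_of_memLp ((h2 (k + 1)).sub (h2 k)) (hR2 k)
  have hi1 : Integrable (fun ω => ‖x n ω‖ ^ 2) P :=
    (memLp_two_iff_integrable_sq_norm (h2 n).1).1 (h2 n)
  have hi2 := (integrable_finsetSum (Finset.range n) fun k _ => hi k).const_mul 2
  have hle : ∀ ω, ε ^ 2 * ((greedyOsc ε (fun k => x k ω) n).2 : ℝ) ≤ ‖x n ω‖ ^ 2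
      - 2 * ∑ k ∈ Finset.range n,
        (inner ℝ (x (k + 1) ω - x k ω) (greedyOsc ε (fun k => x k ω) k).1 : ℝ) := fun ω =>
    (le_add_of_nonneg_right (by positivity)).trans (hpath ω n)
  have hNm : Measurable fun ω => ((greedyOsc ε (fun k => x k ω) n).2 : ℝ) :=
    (measurable_from_top (f := fun k : ℕ => (k : ℝ))).comp ((hm n).2.mono (𝒢.le n) le_rfl)
  have hNm' : Measurable fun ω => ((greedyOsc ε (fun k => x k ω) n).2 : ℝ≥0∞) :=
    (measurable_from_top (f := fun k : ℕ => (k : ℝ≥0∞))).comp ((hm n).2.mono (𝒢.le n) le_rfl)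
  have hNi : Integrable (fun ω => ε ^ 2 * ((greedyOsc ε (fun k => x k ω) n).2 : ℝ)) P := by
    refine (hi1.sub hi2).mono' (hNm.const_mul _).aestronglyMeasurable (ae_of_all _ fun ω => ?_)
    rw [Real.norm_of_nonneg (by positivity)]
    exact hle ω
  have h1 : ∫ ω, ε ^ 2 * ((greedyOsc ε (fun k => x k ω) n).2 : ℝ) ∂P ≤ ∫ ω, ‖x n ω‖ ^ 2 ∂P := by
    refine (integral_mono hNi (hi1.sub hi2) hle).trans_eq ?_
    simp only [Pi.sub_apply]
    rw [integral_sub hi1 hi2, integral_const_mul, integral_finsetSum _ fun k _ => hi k]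
    simp only [hx.integral_inner_sub_eq_zero h2 (Nat.le_succ _) (hm _).1 (hR2 _)]
    simp
  have h3 := ENNReal.ofReal_le_ofReal h1
  rw [ofReal_integral_eq_lintegral_ofReal hNi (ae_of_all _ fun ω => by positivity),
    ofReal_integral_eq_lintegral_ofReal hi1 (ae_of_all _ fun ω => by positivity)] at h3
  rw [← lintegral_const_mul _ hNm']
  refine le_trans (le_of_eq ?_) (h3.trans (le_of_eq ?_))
  · refine lintegral_congr fun ω => ?_
    rw [ENNReal.ofReal_mul (by positivity), ENNReal.ofReal_natCast]
  · refine lintegral_congr fun ω => ?_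
    rw [ENNReal.ofReal_pow (norm_nonneg _), ofReal_norm]

end DiscreteMartingales
end

/-! ### Dyadic grids of `[0, T]`. -/

noncomputable section

section Dyadic

/-- The right end point of `[0, T]`. -/
def lastTime (T : ℝ≥0) : Set.Icc (0 : ℝ≥0) T := ⟨T, zero_le, le_rfl⟩

theorem le_lastTime {T : ℝ≥0} (t : Set.Icc (0 : ℝ≥0) T) : t ≤ lastTime T := t.2.2

/-- The points `k T / 2ⁿ` of `[0, T]`. -/
def dyadic (T : ℝ≥0) (n k : ℕ) : Set.Icc (0 : ℝ≥0) T :=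
  ⟨min (k * T / 2 ^ n) T, zero_le, min_le_right _ _⟩

/-- The set of dyadic points of `[0, T]`. -/
def dyadicSet (T : ℝ≥0) : Set (Set.Icc (0 : ℝ≥0) T) := {t | ∃ n k, k ≤ 2 ^ n ∧ dyadic T n k = t}

/-- The index of the last point of the `n`-th dyadic grid before `s`. -/
def dyadicIndex {T : ℝ≥0} (n : ℕ) (s : Set.Icc (0 : ℝ≥0) T) : ℕ := ⌊(s : ℝ≥0) * 2 ^ n / T⌋₊

variable {T : ℝ≥0}

theorem dyadic_mono (T : ℝ≥0) (n : ℕ) : Monotone (dyadic T n) := by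
  intro k l hkl
  refine Subtype.mk_le_mk.2 (min_le_min_right _ ?_)
  gcongr

theorem dyadic_two_pow (T : ℝ≥0) (n : ℕ) : dyadic T n (2 ^ n) = lastTime T := by
  refine Subtype.ext ?_
  simp [dyadic, lastTime]

theorem dyadicSet_countable (T : ℝ≥0) : (dyadicSet T).Countable := by
  have h : dyadicSet T ⊆ Set.range fun p : ℕ × ℕ => dyadic T p.1 p.2 := by
    rintro _ ⟨n, k, -, rfl⟩
    exact ⟨(n, k), rfl⟩
  exact (Set.countable_range _).mono h

theorem lastTime_mem_dyadicSet (T : ℝ≥0) : lastTime T ∈ dyadicSet T :=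
  ⟨0, 2 ^ 0, le_rfl, dyadic_two_pow T 0⟩

theorem dyadic_succ (T : ℝ≥0) (n k : ℕ) : dyadic T (n + 1) (2 * k) = dyadic T n k := by
  refine Subtype.ext ?_
  simp only [dyadic, pow_succ]
  congr 1
  push_cast
  rw [mul_assoc, mul_comm 2, mul_div_mul_right _ _ two_ne_zero]

theorem dyadicIndex_mono (n : ℕ) : Monotone (dyadicIndex (T := T) n) := by
  intro s t hst
  refine Nat.floor_mono ?_
  have : (s : ℝ≥0) ≤ t := hst
  gcongr

theorem dyadicIndex_lastTime (hT : 0 < T) (n : ℕ) : dyadicIndex n (lastTime T) = 2 ^ n := by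
  have h : ((lastTime T : Set.Icc (0 : ℝ≥0) T) : ℝ≥0) * 2 ^ n / T = ((2 ^ n : ℕ) : ℝ≥0) := by
    simp only [lastTime]
    push_cast
    field_simp
  rw [dyadicIndex, h, Nat.floor_natCast]

theorem eventually_dyadic_dyadicIndex (hT : 0 < T) {s : Set.Icc (0 : ℝ≥0) T}
    (hs : s ∈ dyadicSet T) : ∀ᶠ n in atTop, dyadic T n (dyadicIndex n s) = s := by
  obtain ⟨n, k, hk, rfl⟩ := hs
  filter_upwards [eventually_ge_atTop n] with m hm
  obtain ⟨j, rfl⟩ := Nat.exists_eq_add_of_le hm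
  have hk' : (k : ℝ≥0) * T / 2 ^ n ≤ T := by
    rw [div_le_iff₀ (by positivity), mul_comm T]
    have : (k : ℝ≥0) ≤ 2 ^ n := by exact_mod_cast hk
    gcongr
  have h1 : ((dyadic T n k : Set.Icc (0 : ℝ≥0) T) : ℝ≥0) = k * T / 2 ^ n := min_eq_left hk'
  have h2 : ((dyadic T n k : Set.Icc (0 : ℝ≥0) T) : ℝ≥0) * 2 ^ (n + j) / T
      = ((k * 2 ^ j : ℕ) : ℝ≥0) := by
    rw [h1, pow_add]
    push_cast
    field_simp
  rw [dyadicIndex, h2, Nat.floor_natCast]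
  refine Subtype.ext ?_
  simp only [dyadic]
  congr 1
  rw [pow_add]
  push_cast
  field_simp

theorem exists_dyadic_between (hT : 0 < T) {a b : Set.Icc (0 : ℝ≥0) T} (hab : a < b) :
    ∃ d ∈ dyadicSet T, a < d ∧ d < b := by
  have hab' : (a : ℝ≥0) < b := hab
  have hd : 0 < ((b : ℝ≥0) - a) / T := div_pos (tsub_pos_of_lt hab') hT
  obtain ⟨n, hn⟩ := exists_pow_lt_of_lt_one hd (show (1 / 2 : ℝ≥0) < 1 from NNReal.half_lt_self one_ne_zero)
  have hn' : T / 2 ^ n < (b : ℝ≥0) - a := by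
    rw [lt_div_iff₀ hT, one_div, inv_pow] at hn
    rwa [div_eq_inv_mul]
  -- The point after the last grid point before `a` lies beyond `a` by less than one mesh width, and
  -- the mesh is smaller than `b - a`.
  set k := ⌊(a : ℝ≥0) * 2 ^ n / T⌋₊ with hk
  have h1 : (a : ℝ≥0) < ((k + 1 : ℕ) : ℝ≥0) * T / 2 ^ n := by
    have := Nat.lt_floor_add_one ((a : ℝ≥0) * 2 ^ n / T)
    rw [lt_div_iff₀ (by positivity)]
    rw [div_lt_iff₀ hT] at this
    push_cast
    exact this
  have h2 : ((k + 1 : ℕ) : ℝ≥0) * T / 2 ^ n < b := by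
    have := Nat.floor_le (show 0 ≤ (a : ℝ≥0) * 2 ^ n / T from zero_le)
    rw [← hk, le_div_iff₀ hT] at this
    have h3 : ((k + 1 : ℕ) : ℝ≥0) * T / 2 ^ n = k * T / 2 ^ n + T / 2 ^ n := by
      push_cast
      ring
    rw [h3]
    have h4 : (k : ℝ≥0) * T / 2 ^ n ≤ a := by
      rw [div_le_iff₀ (by positivity)]
      exact this
    calc _ < (a : ℝ≥0) + (b - a) := add_lt_add_of_le_of_lt h4 hn'
      _ = b := add_tsub_cancel_of_le hab'.le
  have h3 : ((dyadic T n (k + 1) : Set.Icc (0 : ℝ≥0) T) : ℝ≥0) = ((k + 1 : ℕ) : ℝ≥0) * T / 2 ^ n :=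
    min_eq_left (h2.le.trans b.2.2)
  have h4 : dyadic T n (k + 1) < b := by
    change ((dyadic T n (k + 1) : Set.Icc (0 : ℝ≥0) T) : ℝ≥0) < b
    rwa [h3]
  refine ⟨dyadic T n (k + 1), ⟨n, k + 1, ?_, rfl⟩, ?_, h4⟩
  · by_contra hlt
    have h5 := dyadic_mono T n (not_le.1 hlt).le
    rw [dyadic_two_pow] at h5
    exact absurd (h5.trans_lt h4) (not_lt.2 (le_lastTime b))
  · change (a : ℝ≥0) < (dyadic T n (k + 1) : Set.Icc (0 : ℝ≥0) T)
    rwa [h3]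

end Dyadic

/-! ### Càdlàg functions obtained from values on the dyadic points. -/

section Cadlag

variable {T : ℝ≥0} {G : Type*} [NormedAddCommGroup G]

/-- Each `t < T` is a limit of dyadic points from the right, so right continuity suffices. The point
`T`, with nothing to its right, is itself dyadic. The countable supremum makes such suprema
measurable. -/
theorem IsCadlag.iSup_enorm_eq (hT : 0 < T) {x : Set.Icc (0 : ℝ≥0) T → G} (hx : IsCadlag x) :
    ⨆ t, ‖x t‖ₑ = ⨆ t ∈ dyadicSet T, ‖x t‖ₑ := by
  refine le_antisymm (iSup_le fun t => ?_) (iSup₂_le fun t _ => le_iSup (fun t => ‖x t‖ₑ) t)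
  rcases eq_or_lt_of_le (le_lastTime t) with h | h
  · rw [h]
    exact le_iSup₂ (f := fun t (_ : t ∈ dyadicSet T) => ‖x t‖ₑ) _ (lastTime_mem_dyadicSet T)
  · have h2 : t ∈ closure (Set.Ioi t ∩ dyadicSet T) := by
      rw [mem_closure_iff_nhdsWithin_neBot, nhdsWithin_inter']
      rw [((nhdsGT_basis_of_exists_gt ⟨_, h⟩).inf_principal _).neBot_iff]
      intro u hu
      obtain ⟨d, hd, h1, h2⟩ := exists_dyadic_between hT hu
      exact ⟨d, ⟨h1, h2⟩, hd⟩
    have h3 : ContinuousWithinAt (fun s => ‖x s‖ₑ) (Set.Ioi t ∩ dyadicSet T) t :=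
      ((hx t).1.mono (Set.inter_subset_left.trans Set.Ioi_subset_Ici_self)).enorm
    have h4 := h3.mem_closure h2 (t := Set.Iic (⨆ t ∈ dyadicSet T, ‖x t‖ₑ)) fun s hs =>
      le_iSup₂ (f := fun t (_ : t ∈ dyadicSet T) => ‖x t‖ₑ) s hs.2
    rwa [isClosed_Iic.closure_eq] at h4

/-- The filter of the dyadic points to the right of `t`. -/
def dyadicRight (t : Set.Icc (0 : ℝ≥0) T) : Filter (Set.Icc (0 : ℝ≥0) T) :=
  𝓝[>] t ⊓ 𝓟 (dyadicSet T)

/-- The filter of the dyadic points to the left of `t`. -/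
def dyadicLeft (t : Set.Icc (0 : ℝ≥0) T) : Filter (Set.Icc (0 : ℝ≥0) T) :=
  𝓝[<] t ⊓ 𝓟 (dyadicSet T)

theorem dyadicRight_basis {t : Set.Icc (0 : ℝ≥0) T} (ht : t < lastTime T) :
    (dyadicRight t).HasBasis (t < ·) fun u => Set.Ioo t u ∩ dyadicSet T :=
  (nhdsGT_basis_of_exists_gt ⟨_, ht⟩).inf_principal _

theorem dyadicLeft_basis {s t : Set.Icc (0 : ℝ≥0) T} (ht : s < t) :
    (dyadicLeft t).HasBasis (· < t) fun u => Set.Ioo u t ∩ dyadicSet T :=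
  (nhdsLT_basis_of_exists_lt ⟨_, ht⟩).inf_principal _

theorem dyadicRight_neBot (hT : 0 < T) {t : Set.Icc (0 : ℝ≥0) T} (ht : t < lastTime T) :
    (dyadicRight t).NeBot := by
  refine (dyadicRight_basis ht).neBot_iff.2 fun {u} hu => ?_
  obtain ⟨d, hd, h1, h2⟩ := exists_dyadic_between hT hu
  exact ⟨d, ⟨h1, h2⟩, hd⟩

theorem dyadicLeft_neBot (hT : 0 < T) {s t : Set.Icc (0 : ℝ≥0) T} (ht : s < t) :
    (dyadicLeft t).NeBot := by
  refine (dyadicLeft_basis ht).neBot_iff.2 fun {u} hu => ?_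
  obtain ⟨d, hd, h1, h2⟩ := exists_dyadic_between hT hu
  exact ⟨d, ⟨h1, h2⟩, hd⟩

/-- Closed balls are preserved by limits: if `x` stays in a closed ball at the dyadic points of an
open interval, then so does `z` at all its points. Convergence of `x` along dyadic points therefore
carries over to `z`. -/
theorem isCadlag_of_dyadic_limits (hT : 0 < T) {x z : Set.Icc (0 : ℝ≥0) T → G}
    (hz : ∀ t < lastTime T, Tendsto x (dyadicRight t) (𝓝 (z t)))
    (hl : ∀ s t : Set.Icc (0 : ℝ≥0) T, s < t → ∃ l, Tendsto x (dyadicLeft t) (𝓝 l)) :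
    IsCadlag z := by
  have key : ∀ (c : G) (ε : ℝ) (a b : Set.Icc (0 : ℝ≥0) T),
      (∀ s ∈ Set.Ioo a b ∩ dyadicSet T, x s ∈ Metric.closedBall c ε) →
      ∀ t ∈ Set.Ioo a b, z t ∈ Metric.closedBall c ε := by
    intro c ε a b h t ht
    have htl := ht.2.trans_le (le_lastTime b)
    have := dyadicRight_neBot hT htl
    refine Metric.isClosed_closedBall.mem_of_tendsto (hz t htl) ?_
    filter_upwards [(dyadicRight_basis htl).mem_of_mem ht.2] with s hs
    exact h s ⟨⟨ht.1.trans hs.1.1, hs.1.2⟩, hs.2⟩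
  intro t
  constructor
  · rcases eq_or_lt_of_le (le_lastTime t) with h | h
    · have : Set.Ici t = {t} := by
        ext s
        simp only [Set.mem_Ici, Set.mem_singleton_iff]
        exact ⟨fun hs => le_antisymm ((le_lastTime s).trans h.ge) hs, fun hs => hs.ge⟩
      rw [this]
      exact continuousWithinAt_singleton
    · rw [← continuousWithinAt_Ioi_iff_Ici]
      refine Metric.nhds_basis_closedBall.tendsto_right_iff.2 fun ε hε => ?_
      obtain ⟨u, hu, hux⟩ := (dyadicRight_basis h).eventually_iff.1
        (Metric.nhds_basis_closedBall.tendsto_right_iff.1 (hz t h) ε hε)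
      filter_upwards [Ioo_mem_nhdsGT hu] with s hs
      exact key _ ε t u (fun s hs => hux hs) s hs
  · by_cases h : ∃ s, s < t
    · obtain ⟨s, hs⟩ := h
      obtain ⟨l, hl⟩ := hl s t hs
      refine ⟨l, Metric.nhds_basis_closedBall.tendsto_right_iff.2 fun ε hε => ?_⟩
      obtain ⟨u, hu, hux⟩ := (dyadicLeft_basis hs).eventually_iff.1
        (Metric.nhds_basis_closedBall.tendsto_right_iff.1 hl ε hε)
      filter_upwards [Ioo_mem_nhdsLT hu] with s hs
      exact key _ ε u t (fun s hs => hux hs) s hs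
    · refine ⟨0, ?_⟩
      have : Set.Iio t = ∅ := Set.eq_empty_of_forall_notMem fun s hs => h ⟨s, hs⟩
      rw [this, nhdsWithin_empty]
      exact tendsto_bot

/-- The number of `ε`-oscillations on the `n`-th dyadic grid up to time `s`. -/
def oscCount (ε : ℝ) (x : Set.Icc (0 : ℝ≥0) T → G) (n : ℕ) (s : Set.Icc (0 : ℝ≥0) T) : ℕ :=
  (greedyOsc ε (fun k => x (dyadic T n k)) (dyadicIndex n s)).2

theorem oscCount_mono (ε : ℝ) (x : Set.Icc (0 : ℝ≥0) T → G) (n : ℕ) : Monotone (oscCount ε x n) :=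
  (greedyOsc_count_mono ε _).comp (dyadicIndex_mono n)

theorem eventually_oscCount_lt (hT : 0 < T) {ε : ℝ} (hε : 0 ≤ ε) (x : Set.Icc (0 : ℝ≥0) T → G)
    {a b : Set.Icc (0 : ℝ≥0) T} (ha : a ∈ dyadicSet T) (hb : b ∈ dyadicSet T) (hab : a < b)
    (h : 2 * ε < ‖x a - x b‖) : ∀ᶠ n in atTop, oscCount ε x n a + 1 ≤ oscCount ε x n b := by
  filter_upwards [eventually_dyadic_dyadicIndex hT ha, eventually_dyadic_dyadicIndex hT hb]
    with n hna hnb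
  exact greedyOsc_count_lt hε _ (dyadicIndex_mono n hab.le) (by simpa only [hna, hnb] using h)

theorem exists_tendsto_of_forall_dist_lt [CompleteSpace G] {ι : Type*} {F : Filter ι} [F.NeBot]
    {x : ι → G} (h : ∀ ε > 0, ∃ s ∈ F, ∀ a ∈ s, ∀ b ∈ s, ‖x a - x b‖ < ε) :
    ∃ l, Tendsto x F (𝓝 l) := by
  refine cauchy_map_iff_exists_tendsto.1 (Metric.cauchy_iff.2 ⟨inferInstance, fun ε hε => ?_⟩)
  obtain ⟨s, hs, h⟩ := h ε hε
  refine ⟨x '' s, image_mem_map hs, ?_⟩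
  rintro _ ⟨a, ha, rfl⟩ _ ⟨b, hb, rfl⟩
  rw [dist_eq_norm]
  exact h a ha b hb

/-- If a one-sided dyadic limit failed to exist, then by completeness there would be arbitrarily
many successive pairs of dyadic points with values more than `2/(j+1)` apart. Each pair adds an
oscillation on all fine grids, against the bound `C` that holds on infinitely many grids. -/
theorem exists_cadlag_of_oscCount [CompleteSpace G] (hT : 0 < T) (x : Set.Icc (0 : ℝ≥0) T → G)
    (hx : ∀ j : ℕ, ∃ C : ℕ, ∃ᶠ n in atTop, oscCount (1 / (j + 1)) x n (lastTime T) ≤ C) :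
    ∃ z : Set.Icc (0 : ℝ≥0) T → G, IsCadlag z ∧ z (lastTime T) = x (lastTime T) ∧
      ∀ t < lastTime T, Tendsto x (dyadicRight t) (𝓝 (z t)) := by
  have hj : ∀ ε : ℝ, 0 < ε → ∃ j : ℕ, 2 * (1 / ((j : ℝ) + 1)) < ε := by
    intro ε hε
    obtain ⟨j, hj⟩ := exists_nat_one_div_lt (half_pos hε)
    exact ⟨j, by linarith⟩
  have hr : ∀ t < lastTime T, ∃ l, Tendsto x (dyadicRight t) (𝓝 l) := by
    intro t ht
    have := dyadicRight_neBot hT ht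
    refine exists_tendsto_of_forall_dist_lt fun ε hε => ?_
    by_contra! hcon
    obtain ⟨j, hj⟩ := hj ε hε
    -- The pairs move down towards `t`: a new pair `a < b` is taken in `(t, w)`, then `w` is
    -- replaced by `a`, so at least `K` oscillations occur between `w` and `T`.
    have key : ∀ K : ℕ, ∃ w, t < w ∧ ∀ᶠ n in atTop,
        oscCount (1 / (j + 1)) x n w + K ≤ oscCount (1 / (j + 1)) x n (lastTime T) := by
      intro K
      induction K with
      | zero => exact ⟨lastTime T, ht, Eventually.of_forall fun n => le_rfl⟩
      | succ K ih =>
        obtain ⟨w, hw, hwK⟩ := ih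
        obtain ⟨a, ha, b, hb, hab⟩ := hcon _ ((dyadicRight_basis ht).mem_of_mem hw)
        wlog hlt : a < b generalizing a b with hwlog
        · refine hwlog b hb a ha (by rwa [norm_sub_rev]) (lt_of_le_of_ne (not_lt.1 hlt) ?_)
          rintro rfl
          rw [sub_self, norm_zero] at hab
          linarith
        refine ⟨a, ha.1.1, ?_⟩
        filter_upwards [hwK, eventually_oscCount_lt hT (by positivity) x ha.2 hb.2 hlt
          (hj.trans_le hab)] with n h1 h2
        have h3 := oscCount_mono (1 / (j + 1)) x n hb.1.2.le
        omega
    obtain ⟨C, hC⟩ := hx j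
    obtain ⟨w, -, hw⟩ := key (C + 1)
    obtain ⟨n, h1, h2⟩ := (hC.and_eventually hw).exists
    omega
  have hl : ∀ s t : Set.Icc (0 : ℝ≥0) T, s < t → ∃ l, Tendsto x (dyadicLeft t) (𝓝 l) := by
    intro s t ht
    have := dyadicLeft_neBot hT ht
    refine exists_tendsto_of_forall_dist_lt fun ε hε => ?_
    by_contra! hcon
    obtain ⟨j, hj⟩ := hj ε hε
    -- Here the pairs move up towards `t`, and the oscillations are counted before `w`.
    have key : ∀ K : ℕ, ∃ w, w < t ∧ ∀ᶠ n in atTop, K ≤ oscCount (1 / (j + 1)) x n w := by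
      intro K
      induction K with
      | zero => exact ⟨s, ht, Eventually.of_forall fun n => Nat.zero_le _⟩
      | succ K ih =>
        obtain ⟨w, hw, hwK⟩ := ih
        obtain ⟨a, ha, b, hb, hab⟩ := hcon _ ((dyadicLeft_basis ht).mem_of_mem hw)
        wlog hlt : a < b generalizing a b with hwlog
        · refine hwlog b hb a ha (by rwa [norm_sub_rev]) (lt_of_le_of_ne (not_lt.1 hlt) ?_)
          rintro rfl
          rw [sub_self, norm_zero] at hab
          linarith
        refine ⟨b, hb.1.2, ?_⟩
        filter_upwards [hwK, eventually_oscCount_lt hT (by positivity) x ha.2 hb.2 hlt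
          (hj.trans_le hab)] with n h1 h2
        have h3 := oscCount_mono (1 / (j + 1)) x n ha.1.1.le
        omega
    obtain ⟨C, hC⟩ := hx j
    obtain ⟨w, hwt, hw⟩ := key (C + 1)
    obtain ⟨n, h1, h2⟩ := (hC.and_eventually hw).exists
    have h3 := oscCount_mono (1 / (j + 1)) x n (le_lastTime w)
    omega
  choose! z hz using hr
  -- At `T` there is no limit from the right, and the original value is kept.
  refine ⟨Function.update z (lastTime T) (x (lastTime T)), ?_, by simp, ?_⟩
  · refine isCadlag_of_dyadic_limits hT (x := x) (fun t ht => ?_) hl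
    rw [Function.update_of_ne ht.ne]
    exact hz t ht
  · intro t ht
    rw [Function.update_of_ne ht.ne]
    exact hz t ht

end Cadlag
end

/-! ### Continuous time: maximal inequality and càdlàg modifications. -/

noncomputable section

section Regularization

variable {Ω : Type*} {mΩ : MeasurableSpace Ω} {P : Measure Ω} [IsFiniteMeasure P]
  {ℱ : Filtration ℝ≥0 mΩ} {T : ℝ≥0}
  {G : Type*} [NormedAddCommGroup G] [InnerProductSpace ℝ G] [CompleteSpace G]

/-- The filtration along the `n`-th dyadic grid. -/
def dyadicFiltration (ℱ : Filtration ℝ≥0 mΩ) (T : ℝ≥0) (n : ℕ) : Filtration ℕ mΩ where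
  seq k := ℱ (dyadic T n k).1
  mono' _ _ h := ℱ.mono (dyadic_mono T n h)
  le' _ := ℱ.le _

theorem MeasureTheory.Martingale.dyadic {X : Set.Icc (0 : ℝ≥0) T → Ω → G}
    (hX : Martingale X (filtrationIcc ℱ T) P) (n : ℕ) :
    Martingale (fun k => X (dyadic T n k)) (dyadicFiltration ℱ T n) P :=
  ⟨fun k => hX.1 (_root_.dyadic T n k), fun _ _ hkl => hX.2 _ _ (dyadic_mono T n hkl)⟩

theorem eLpNorm_two_eq {α : Type*} {m : MeasurableSpace α} (μ : Measure α)
    {F : Type*} [NormedAddCommGroup F] (f : α → F) :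
    eLpNorm f 2 μ = (∫⁻ a, ‖f a‖ₑ ^ 2 ∂μ) ^ (1 / 2 : ℝ) := by
  rw [eLpNorm_eq_lintegral_rpow_enorm_toReal two_ne_zero ENNReal.ofNat_ne_top]
  simp

theorem eLpNorm_two_sq {α : Type*} {m : MeasurableSpace α} (μ : Measure α)
    {F : Type*} [NormedAddCommGroup F] (f : α → F) :
    eLpNorm f 2 μ ^ 2 = ∫⁻ a, ‖f a‖ₑ ^ 2 ∂μ := by
  rw [eLpNorm_two_eq, ← ENNReal.rpow_natCast, ← ENNReal.rpow_mul]
  norm_num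

theorem lintegral_enorm_sq_lt_top {α : Type*} {m : MeasurableSpace α} {μ : Measure α}
    {F : Type*} [NormedAddCommGroup F] {f : α → F} (hf : MemLp f 2 μ) :
    ∫⁻ a, ‖f a‖ₑ ^ 2 ∂μ < ∞ := by
  rw [← eLpNorm_two_sq]
  exact ENNReal.pow_lt_top hf.2

omit [InnerProductSpace ℝ G] [CompleteSpace G] in
theorem exists_runMax_eq (y : ℕ → ℝ) (n : ℕ) : ∃ k ≤ n, runMax y n = y k := by
  induction n with
  | zero => exact ⟨0, le_rfl, rfl⟩
  | succ n ih =>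
    obtain ⟨k, hk, h⟩ := ih
    rcases le_total (runMax y n) (y (n + 1)) with h1 | h1
    · exact ⟨n + 1, le_rfl, max_eq_right h1⟩
    · exact ⟨k, hk.trans n.le_succ, (max_eq_left h1).trans h⟩

omit [InnerProductSpace ℝ G] [CompleteSpace G] in
theorem IsCadlag.iSup_enorm_eq_runMax (hT : 0 < T) {x : Set.Icc (0 : ℝ≥0) T → G}
    (hx : IsCadlag x) :
    ⨆ t, ‖x t‖ₑ = ⨆ n : ℕ, ENNReal.ofReal (runMax (fun k => ‖x (dyadic T n k)‖) (2 ^ n)) := by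
  rw [hx.iSup_enorm_eq hT]
  refine le_antisymm (iSup₂_le ?_) (iSup_le fun n => ?_)
  · rintro _ ⟨n, k, hk, rfl⟩
    refine le_trans ?_ (le_iSup _ n)
    rw [← ofReal_norm]
    exact ENNReal.ofReal_le_ofReal (le_runMax (fun k => ‖x (dyadic T n k)‖) hk)
  · obtain ⟨k, hk, h⟩ := exists_runMax_eq (fun k => ‖x (dyadic T n k)‖) (2 ^ n)
    rw [h, ofReal_norm]
    exact le_iSup₂ (f := fun t (_ : t ∈ dyadicSet T) => ‖x t‖ₑ) (dyadic T n k) ⟨n, k, hk, rfl⟩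

/-- Doob's maximal inequality in `L²` for càdlàg martingales. -/
theorem mENorm_le_two_mul (hT : 0 < T) {X : Set.Icc (0 : ℝ≥0) T → Ω → G}
    (hX : Martingale X (filtrationIcc ℱ T) P) (h2 : ∀ t, MemLp (X t) 2 P)
    (hc : ∀ ω, IsCadlag fun t => X t ω) :
    mENorm P X ≤ 2 * eLpNorm (X (lastTime T)) 2 P := by
  set m : ℕ → Ω → ℝ := fun n ω => runMax (fun k => ‖X (dyadic T n k) ω‖) (2 ^ n) with hm
  have hm0 : ∀ n ω, 0 ≤ m n ω := fun n ω =>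
    (norm_nonneg (X (dyadic T n 0) ω)).trans
      (le_runMax (fun k => ‖X (dyadic T n k) ω‖) (Nat.zero_le _))
  have hm2 : ∀ n, MemLp (m n) 2 P := fun n => memLp_runMax_norm (fun k => h2 (dyadic T n k)) _
  have hmm : ∀ n, Measurable (m n) := fun n =>
    ((stronglyMeasurable_runMax_norm (hX.dyadic n).stronglyAdapted (2 ^ n)).mono
      ((dyadicFiltration ℱ T n).le _)).measurable
  -- The grids are nested, so the grid maxima increase and monotone convergence applies.
  have hmono : ∀ ω, Monotone fun n => m n ω := by
    intro ω
    refine monotone_nat_of_le_succ fun n => ?_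
    obtain ⟨k, hk, h⟩ := exists_runMax_eq (fun k => ‖X (dyadic T n k) ω‖) (2 ^ n)
    simp only [hm]
    rw [h, ← dyadic_succ]
    exact le_runMax (fun k => ‖X (dyadic T (n + 1) k) ω‖) (by rw [pow_succ]; omega)
  have hsup : ∀ ω, supENorm X ω ^ (2 : ℝ) = ⨆ n, ENNReal.ofReal (m n ω ^ 2) := by
    intro ω
    have h1 : supENorm X ω = ⨆ n, ENNReal.ofReal (m n ω) := (hc ω).iSup_enorm_eq_runMax hT
    rw [h1]
    have h3 := (ENNReal.orderIsoRpow 2 zero_lt_two).map_iSup fun n => ENNReal.ofReal (m n ω)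
    simp only [ENNReal.orderIsoRpow_apply] at h3
    rw [h3]
    refine iSup_congr fun n => ?_
    rw [ENNReal.ofReal_rpow_of_nonneg (hm0 n ω) zero_le_two]
    norm_num
  have hle : ∫⁻ ω, supENorm X ω ^ (2 : ℝ) ∂P ≤ (2 * eLpNorm (X (lastTime T)) 2 P) ^ (2 : ℝ) := by
    simp only [hsup]
    rw [lintegral_iSup (fun n => ((hmm n).pow_const 2).ennreal_ofReal)
      (fun a b hab ω => ENNReal.ofReal_le_ofReal (pow_le_pow_left₀ (hm0 a ω) (hmono ω hab) 2))]
    -- Every grid ends at `T`, so the discrete inequality has the same right-hand side for all `n`.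
    refine iSup_le fun n => ?_
    have h3 := integral_runMax_sq_le (hX.dyadic n) (fun k => h2 (dyadic T n k)) (2 ^ n)
    rw [dyadic_two_pow] at h3
    have hi : Integrable (fun ω => ‖X (lastTime T) ω‖ ^ 2) P :=
      (memLp_two_iff_integrable_sq_norm (h2 _).1).1 (h2 _)
    have h4 := ENNReal.ofReal_le_ofReal h3
    rw [ofReal_integral_eq_lintegral_ofReal
        ((memLp_two_iff_integrable_sq (hm2 n).1).1 (hm2 n)) (ae_of_all _ fun ω => sq_nonneg _),
      ENNReal.ofReal_mul (by norm_num),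
      ofReal_integral_eq_lintegral_ofReal hi (ae_of_all _ fun ω => by positivity)] at h4
    refine h4.trans (le_of_eq ?_)
    rw [ENNReal.mul_rpow_of_nonneg _ _ zero_le_two, ENNReal.rpow_ofNat, ENNReal.rpow_ofNat,
      eLpNorm_two_sq]
    congr 1
    · norm_num
    · exact lintegral_congr fun ω => by rw [ENNReal.ofReal_pow (norm_nonneg _), ofReal_norm]
  calc mENorm P X ≤ ((2 * eLpNorm (X (lastTime T)) 2 P) ^ (2 : ℝ)) ^ (1 / 2 : ℝ) := by
        unfold mENorm
        gcongr
    _ = _ := by rw [← ENNReal.rpow_mul]; norm_num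

/-- Preimages under `f` and `g` differ by a subset of a null set, and `m` contains all null sets.
This is how completeness of the filtration yields adaptedness of modifications. -/
theorem stronglyMeasurable_of_ae_eq [TopologicalSpace.SeparableSpace G] {m : MeasurableSpace Ω}
    (hnull : ∀ N : Set Ω, P N = 0 → MeasurableSet[m] N) {f g : Ω → G}
    (hg : StronglyMeasurable[m] g) (hfg : f =ᵐ[P] g) : StronglyMeasurable[m] f := by
  let : MeasurableSpace G := borel G
  have : BorelSpace G := ⟨rfl⟩
  have : SecondCountableTopology G := UniformSpace.secondCountable_of_separable G
  have hm : Measurable[m] f := by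
    intro B hB
    have h1 : f ⁻¹' B = (g ⁻¹' B ∩ {ω | f ω = g ω}) ∪ (f ⁻¹' B ∩ {ω | f ω ≠ g ω}) := by
      ext ω
      simp only [Set.mem_union, Set.mem_inter_iff, Set.mem_preimage, Set.mem_ofPred_eq]
      by_cases h : f ω = g ω <;> simp [h]
    have hN : P {ω | f ω ≠ g ω} = 0 := hfg
    rw [h1]
    refine ((hg.measurable hB).inter ?_).union
      (hnull _ (measure_mono_null Set.inter_subset_right hN))
    have h2 := (hnull _ hN).compl
    rwa [Set.compl_ofPred, show {ω | ¬f ω ≠ g ω} = {ω | f ω = g ω} from by simp] at h2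
  exact hm.stronglyMeasurable

/-- The expected counts are at most `ε⁻² E‖X_T‖²` on every grid, so by Fatou their lower limit is
almost surely finite. A finite lower limit gives a bound on infinitely many grids only, hence the
frequent quantifier. -/
theorem ae_frequently_oscCount_le (hT : 0 < T) {X : Set.Icc (0 : ℝ≥0) T → Ω → G}
    (hX : Martingale X (filtrationIcc ℱ T) P) (h2 : ∀ t, MemLp (X t) 2 P) {ε : ℝ} (hε : 0 < ε) :
    ∀ᵐ ω ∂P, ∃ C : ℕ, ∃ᶠ n in atTop, oscCount ε (fun t => X t ω) n (lastTime T) ≤ C := by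
  set N : ℕ → Ω → ℝ≥0∞ := fun n ω => (oscCount ε (fun t => X t ω) n (lastTime T) : ℝ≥0∞) with hN
  have hNm : ∀ n, Measurable (N n) := fun n =>
    (measurable_from_top (f := fun k : ℕ => (k : ℝ≥0∞))).comp
      ((greedyOsc_measurable ε (hX.dyadic n).stronglyAdapted _).2.mono
        ((dyadicFiltration ℱ T n).le _) le_rfl)
  have hb : ∀ n, ∫⁻ ω, N n ω ∂P
      ≤ (ENNReal.ofReal (ε ^ 2))⁻¹ * ∫⁻ ω, ‖X (lastTime T) ω‖ₑ ^ 2 ∂P := by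
    intro n
    have h := lintegral_greedyOsc_count_le hε.le (hX.dyadic n) (fun k => h2 (dyadic T n k)) (2 ^ n)
    rw [dyadic_two_pow] at h
    have h0 : ENNReal.ofReal (ε ^ 2) ≠ 0 := by
      rw [Ne, ENNReal.ofReal_eq_zero, not_le]
      positivity
    simp only [hN, oscCount, dyadicIndex_lastTime hT]
    rw [mul_comm, ← div_eq_mul_inv, ENNReal.le_div_iff_mul_le (Or.inl h0)
      (Or.inl ENNReal.ofReal_ne_top), mul_comm]
    exact h
  have h1 : ∫⁻ ω, liminf (fun n => N n ω) atTop ∂P < ∞ := by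
    refine (lintegral_liminf_le hNm).trans_lt (lt_of_le_of_lt (liminf_le_of_le (by isBoundedDefault)
      fun b hb' => ?_) (b := (ENNReal.ofReal (ε ^ 2))⁻¹ * ∫⁻ ω, ‖X (lastTime T) ω‖ₑ ^ 2 ∂P) ?_)
    · obtain ⟨n, hn⟩ := hb'.exists
      exact hn.trans (hb n)
    · refine ENNReal.mul_lt_top ?_ (lintegral_enorm_sq_lt_top (h2 _))
      rw [ENNReal.inv_lt_top, ENNReal.ofReal_pos]
      positivity
  filter_upwards [ae_lt_top (Measurable.liminf hNm) h1.ne] with ω hω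
  obtain ⟨C, hC⟩ := ENNReal.exists_nat_gt hω.ne
  refine ⟨C, (frequently_lt_of_liminf_lt (by isBoundedDefault) hC).mono fun n hn => ?_⟩
  exact (Nat.cast_lt.1 hn).le

/-- Off a null set the right limits along dyadic points form a càdlàg path. Right continuity in `L²`
identifies them with `X t`, since along a sequence of dyadic points a subsequence of `X` converges
almost surely to `X t`. -/
theorem MartingaleProcess.exists_modification [TopologicalSpace.SeparableSpace G] (hT : 0 < T)
    (hnull : ∀ N : Set Ω, P N = 0 → MeasurableSet[ℱ 0] N) {X : Set.Icc (0 : ℝ≥0) T → Ω → G}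
    (hX : Martingale X (filtrationIcc ℱ T) P) (h2 : ∀ t, MemLp (X t) 2 P)
    (hrc : ∀ t, Tendsto (fun s => eLpNorm (X s - X t) 2 P) (𝓝[>] t) (𝓝 0)) :
    ∃ Z : MartingaleProcess ℱ P T G, ∀ t, Z.process t =ᵐ[P] X t := by
  have hgood : ∀ᵐ ω ∂P, ∀ j : ℕ, ∃ C : ℕ, ∃ᶠ n in atTop,
      oscCount (1 / (j + 1)) (fun t => X t ω) n (lastTime T) ≤ C :=
    ae_all_iff.2 fun j => ae_frequently_oscCount_le hT hX h2 (by positivity)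
  have hex : ∀ ω, ∃ z : Set.Icc (0 : ℝ≥0) T → G, IsCadlag z ∧
      ((∀ j : ℕ, ∃ C : ℕ, ∃ᶠ n in atTop,
        oscCount (1 / (j + 1)) (fun t => X t ω) n (lastTime T) ≤ C) →
      z (lastTime T) = X (lastTime T) ω ∧
        ∀ t < lastTime T, Tendsto (fun t => X t ω) (dyadicRight t) (𝓝 (z t))) := by
    intro ω
    by_cases h : ∀ j : ℕ, ∃ C : ℕ, ∃ᶠ n in atTop,
      oscCount (1 / (j + 1)) (fun t => X t ω) n (lastTime T) ≤ C
    · obtain ⟨z, hz, h1⟩ := exists_cadlag_of_oscCount hT _ h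
      exact ⟨z, hz, fun _ => h1⟩
    -- On the exceptional null set the path is set to zero, so that every path is càdlàg.
    · exact ⟨0, fun t => ⟨continuousWithinAt_const, 0, tendsto_const_nhds⟩, fun h' => absurd h' h⟩
  choose z hzc hz using hex
  set Z : Set.Icc (0 : ℝ≥0) T → Ω → G := fun t ω => z ω t with hZ
  have hZX : ∀ t, Z t =ᵐ[P] X t := by
    intro t
    rcases eq_or_lt_of_le (le_lastTime t) with rfl | ht
    · filter_upwards [hgood] with ω hω
      exact (hz ω hω).1
    · have := dyadicRight_neBot hT ht
      have : (dyadicRight t).IsCountablyGenerated := by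
        unfold dyadicRight
        infer_instance
      obtain ⟨s, hs⟩ := exists_seq_tendsto (dyadicRight t)
      have h1 : TendstoInMeasure P (fun n => X (s n)) atTop (X t) :=
        tendstoInMeasure_of_tendsto_eLpNorm two_ne_zero (fun n => (h2 _).1) (h2 _).1
          ((hrc t).comp (hs.mono_right inf_le_left))
      obtain ⟨ns, hns, h3⟩ := h1.exists_seq_tendsto_ae
      filter_upwards [hgood, h3] with ω hω h4
      exact tendsto_nhds_unique
        ((((hz ω hω).2 t ht).comp hs).comp hns.tendsto_atTop) h4
  have hZM : Martingale Z (filtrationIcc ℱ T) P := by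
    refine ⟨fun t => ?_, fun s t hst => ?_⟩
    · exact stronglyMeasurable_of_ae_eq (fun N hN => ℱ.mono zero_le _ (hnull N hN))
        (hX.1 t) (hZX t)
    · exact (condExp_congr_ae (hZX t)).trans ((hX.2 s t hst).trans (hZX s).symm)
  have hZ2 : ∀ t, MemLp (Z t) 2 P := fun t => (memLp_congr_ae (hZX t)).2 (h2 t)
  refine ⟨⟨Z, hZM, hzc, ?_⟩, hZX⟩
  exact (mENorm_le_two_mul hT hZM hZ2 hzc).trans_lt
    (ENNReal.mul_lt_top (by finiteness) (hZ2 _).2)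

end Regularization
end

/-! ### The space `𝓜²_T(G)` and its completeness. -/

noncomputable section

section MartingaleSpaces

variable {Ω : Type*} {mΩ : MeasurableSpace Ω} {P : Measure Ω} [IsProbabilityMeasure P]
  {ℱ : Filtration ℝ≥0 mΩ} {T : ℝ≥0}
  {G : Type*} [NormedAddCommGroup G] [InnerProductSpace ℝ G] [CompleteSpace G]

theorem lintegral_le_rpow_half {f : Ω → ℝ≥0∞} (hf : AEMeasurable f P) :
    ∫⁻ ω, f ω ∂P ≤ (∫⁻ ω, f ω ^ (2 : ℝ) ∂P) ^ (1 / 2 : ℝ) := by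
  have h := ENNReal.lintegral_mul_le_Lp_mul_Lq P (Real.HolderConjugate.two_two) hf
    (aemeasurable_const (b := (1 : ℝ≥0∞)))
  simpa using h

namespace MartingaleProcess

theorem enorm_eq (X : MartingaleProcess ℱ P T G) : ‖X‖ₑ = mENorm P X.process := by
  rw [← ofReal_norm]
  exact ENNReal.ofReal_toReal X.process_mem.2.2.ne

theorem stronglyMeasurable (X : MartingaleProcess ℱ P T G) (t : Set.Icc (0 : ℝ≥0) T) :
    StronglyMeasurable (X.process t) :=
  (X.process_mem.1.stronglyAdapted t).mono ((filtrationIcc ℱ T).le t)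

theorem eLpNorm_le_enorm (X : MartingaleProcess ℱ P T G) (t : Set.Icc (0 : ℝ≥0) T) :
    eLpNorm (X.process t) 2 P ≤ ‖X‖ₑ := by
  rw [enorm_eq, eLpNorm_two_eq, mENorm]
  gcongr with ω
  rw [← ENNReal.rpow_two]
  gcongr
  exact le_iSup (fun t => ‖X.process t ω‖ₑ) t

theorem memLp (X : MartingaleProcess ℱ P T G) (t : Set.Icc (0 : ℝ≥0) T) :
    MemLp (X.process t) 2 P :=
  ⟨(X.stronglyMeasurable t).aestronglyMeasurable, (X.eLpNorm_le_enorm t).trans_lt enorm_lt_top⟩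

theorem enorm_le (hT : 0 < T) (X : MartingaleProcess ℱ P T G) :
    ‖X‖ₑ ≤ 2 * eLpNorm (X.process (lastTime T)) 2 P := by
  rw [enorm_eq]
  exact mENorm_le_two_mul hT X.process_mem.1 X.memLp X.process_mem.2.1

theorem lintegral_supENorm_le (X : MartingaleProcess ℱ P T G) :
    ∫⁻ ω, supENorm X.process ω ∂P ≤ ‖X‖ₑ := by
  rw [enorm_eq]
  exact lintegral_le_rpow_half X.measurable_sup.aemeasurable

theorem mk_eq_mk_iff {X Y : MartingaleProcess ℱ P T G} :
    SeparationQuotient.mk X = SeparationQuotient.mk Y ↔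
      ∀ᵐ ω ∂P, ∀ t, X.process t ω = Y.process t ω := by
  have h0 : ‖X - Y‖ₑ = 0 ↔ ∀ᵐ ω ∂P, ∀ t, X.process t ω = Y.process t ω := by
    rw [enorm_eq, mENorm, ENNReal.rpow_eq_zero_iff_of_pos (by norm_num),
      lintegral_eq_zero_iff ((X - Y).measurable_sup.pow_const _)]
    refine eventually_congr (ae_of_all _ fun ω => ?_)
    simp only [Pi.zero_apply]
    rw [ENNReal.rpow_eq_zero_iff_of_pos (by norm_num), supENorm, ENNReal.iSup_eq_zero]
    refine forall_congr' fun t => ?_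
    rw [enorm_eq_zero, map_sub, Pi.sub_apply, Pi.sub_apply, sub_eq_zero]
  rw [SeparationQuotient.mk_eq_mk, Metric.inseparable_iff, dist_eq_norm, ← h0, ← ofReal_norm,
    ENNReal.ofReal_eq_zero]
  exact ⟨fun h => h.le, fun h => le_antisymm h (norm_nonneg _)⟩

end MartingaleProcess

namespace MartingaleSpace

/-- A càdlàg martingale that represents `X`. -/
def rep (X : MartingaleSpace ℱ P T G) : MartingaleProcess ℱ P T G := Quotient.out X

@[simp] theorem mk_rep (X : MartingaleSpace ℱ P T G) : SeparationQuotient.mk X.rep = X :=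
  Quotient.out_eq X

theorem process_rep (X : MartingaleSpace ℱ P T G) : X.rep.process = X.path := rfl

theorem path_mk (Z : MartingaleProcess ℱ P T G) :
    ∀ᵐ ω ∂P, ∀ t, path (SeparationQuotient.mk Z) t ω = Z.process t ω :=
  MartingaleProcess.mk_eq_mk_iff.1 (mk_rep (SeparationQuotient.mk Z))

theorem enorm_rep (X : MartingaleSpace ℱ P T G) : ‖X.rep‖ₑ = ‖X‖ₑ := by
  conv_rhs => rw [← mk_rep X]
  rw [← ofReal_norm, ← ofReal_norm, SeparationQuotient.norm_mk]

theorem path_add (X Y : MartingaleSpace ℱ P T G) :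
    ∀ᵐ ω ∂P, ∀ t, (X + Y).path t ω = X.path t ω + Y.path t ω := by
  have h := path_mk (X.rep + Y.rep)
  rw [SeparationQuotient.mk_add, mk_rep, mk_rep] at h
  simpa only [map_add, process_rep, Pi.add_apply] using h

theorem path_sub (X Y : MartingaleSpace ℱ P T G) :
    ∀ᵐ ω ∂P, ∀ t, (X - Y).path t ω = X.path t ω - Y.path t ω := by
  have h := path_mk (X.rep - Y.rep)
  rw [SeparationQuotient.mk_sub, mk_rep, mk_rep] at h
  simpa only [map_sub, process_rep, Pi.sub_apply] using h

theorem path_smul (a : ℝ) (X : MartingaleSpace ℱ P T G) :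
    ∀ᵐ ω ∂P, ∀ t, (a • X).path t ω = a • X.path t ω := by
  have h := path_mk (a • X.rep)
  rw [SeparationQuotient.mk_smul, mk_rep] at h
  simpa only [map_smul, process_rep, Pi.smul_apply] using h

theorem path_zero : ∀ᵐ ω ∂P, ∀ t, (0 : MartingaleSpace ℱ P T G).path t ω = 0 := by
  have h := path_mk (0 : MartingaleProcess ℱ P T G)
  rw [SeparationQuotient.mk_zero] at h
  simpa only [map_zero, Pi.zero_apply] using h

theorem memLp_path (X : MartingaleSpace ℱ P T G) (t : Set.Icc (0 : ℝ≥0) T) :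
    MemLp (X.path t) 2 P := X.rep.memLp t

theorem eLpNorm_path_le (X : MartingaleSpace ℱ P T G) (t : Set.Icc (0 : ℝ≥0) T) :
    eLpNorm (X.path t) 2 P ≤ ‖X‖ₑ := by
  rw [← enorm_rep]
  exact X.rep.eLpNorm_le_enorm t

theorem enorm_le (hT : 0 < T) (X : MartingaleSpace ℱ P T G) :
    ‖X‖ₑ ≤ 2 * eLpNorm (X.path (lastTime T)) 2 P := by
  rw [← enorm_rep]
  exact X.rep.enorm_le hT

theorem enorm_setIntegral_path_le (A : Set Ω) (t : Set.Icc (0 : ℝ≥0) T)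
    (X : MartingaleSpace ℱ P T G) : ‖∫ ω in A, X.path t ω ∂P‖ₑ ≤ ‖X‖ₑ := by
  calc _ ≤ ∫⁻ ω in A, ‖X.path t ω‖ₑ ∂P := enorm_integral_le_lintegral_enorm _
    _ ≤ ∫⁻ ω, ‖X.path t ω‖ₑ ∂P := setLIntegral_le_lintegral _ _
    _ = eLpNorm (X.path t) 1 P := eLpNorm_one_eq_lintegral_enorm.symm
    _ ≤ eLpNorm (X.path t) 2 P :=
        eLpNorm_le_eLpNorm_of_exponent_le one_le_two (X.memLp_path t).1
    _ ≤ _ := X.eLpNorm_path_le t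

/-- The functional `X ↦ ∫_A X_t dP`. -/
def setIntegralCLM (A : Set Ω) (t : Set.Icc (0 : ℝ≥0) T) : MartingaleSpace ℱ P T G →L[ℝ] G :=
  LinearMap.mkContinuous
    { toFun := fun X => ∫ ω in A, X.path t ω ∂P
      map_add' := fun X Y => by
        rw [← integral_add ((X.memLp_path t).integrable one_le_two).restrict
          ((Y.memLp_path t).integrable one_le_two).restrict]
        refine integral_congr_ae (ae_restrict_of_ae ?_)
        filter_upwards [path_add X Y] with ω hω using hω t
      map_smul' := fun a X => by
        rw [RingHom.id_apply, ← integral_smul]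
        refine integral_congr_ae (ae_restrict_of_ae ?_)
        filter_upwards [path_smul a X] with ω hω using hω t } 1 fun X => by
    rw [one_mul]
    have h := ENNReal.toReal_mono enorm_ne_top (enorm_setIntegral_path_le A t X)
    simpa using h

end MartingaleSpace

omit [InnerProductSpace ℝ G] in
-- Left limits come from the Cauchy criterion, since the limits of the `x n` need not be tracked. At
-- the left end point the filter is trivial.
theorem IsCadlag.of_tendstoUniformly {x : ℕ → Set.Icc (0 : ℝ≥0) T → G}
    {w : Set.Icc (0 : ℝ≥0) T → G} (hx : ∀ n, IsCadlag (x n)) (h : TendstoUniformly x w atTop) :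
    IsCadlag w := by
  intro t
  refine ⟨continuousWithinAt_of_locally_uniform_approx_of_continuousWithinAt Set.self_mem_Ici
    fun u hu => ?_, ?_⟩
  · obtain ⟨n, hn⟩ := (h u hu).exists
    exact ⟨Set.univ, univ_mem, x n, (hx n t).1, fun s _ => hn s⟩
  by_cases hb : (𝓝[<] t).NeBot
  · refine exists_tendsto_of_forall_dist_lt fun ε hε => ?_
    obtain ⟨n, hn⟩ := (Metric.tendstoUniformly_iff.1 h (ε / 3) (by positivity)).exists
    obtain ⟨l, hl⟩ := (hx n t).2
    refine ⟨{s | dist (x n s) l < ε / 6}, Metric.tendsto_nhds.1 hl _ (by positivity),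
      fun a ha b hb => ?_⟩
    simp only [Set.mem_ofPred_eq] at ha hb
    rw [← dist_eq_norm]
    have h1 := dist_triangle4 (w a) (x n a) (x n b) (w b)
    have h2 := dist_triangle_right (x n a) (x n b) l
    have h3 := hn a
    have h4 := hn b
    rw [dist_comm (x n b)] at h1
    linarith
  · rw [not_neBot.1 hb]
    exact ⟨0, tendsto_bot⟩

/-- The martingale property consists of equalities of integrals over sets of the past, and these are
continuous for `L¹`, hence for `L²`, convergence. -/
theorem martingale_of_tendsto_eLpNorm {ι κ : Type*} [Preorder ι] {𝒢 : Filtration ι mΩ}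
    {l : Filter κ} [l.NeBot] {X : κ → ι → Ω → G} {W : ι → Ω → G}
    (hX : ∀ n, Martingale (X n) 𝒢 P) (hW : StronglyAdapted 𝒢 W) (hW2 : ∀ t, MemLp (W t) 2 P)
    (h : ∀ t, Tendsto (fun n => eLpNorm (X n t - W t) 2 P) l (𝓝 0)) : Martingale W 𝒢 P := by
  have hWi : ∀ t, Integrable (W t) P := fun t => (hW2 t).integrable one_le_two
  have hlim : ∀ t A, Tendsto (fun n => ∫ ω in A, X n t ω ∂P) l (𝓝 (∫ ω in A, W t ω ∂P)) := by
    intro t A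
    refine tendsto_setIntegral_of_L1' _ (hWi t).1
      (Eventually.of_forall fun n => (hX n).integrable t) ?_ A
    refine tendsto_of_tendsto_of_tendsto_of_le_of_le tendsto_const_nhds (h t)
      (fun n => zero_le) fun n => eLpNorm_le_eLpNorm_of_exponent_le one_le_two ?_
    exact (((hX n).integrable t).sub (hWi t)).1
  refine ⟨hW, fun s t hst => ?_⟩
  refine (ae_eq_condExp_of_forall_setIntegral_eq (𝒢.le s) (hWi t)
    (fun A _ _ => (hWi s).integrableOn) (fun A hA _ => ?_) (hW s).aestronglyMeasurable).symm
  refine tendsto_nhds_unique (hlim s A) ?_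
  refine (hlim t A).congr fun n => ?_
  rw [← setIntegral_condExp (𝒢.le s) ((hX n).integrable t) hA]
  exact setIntegral_congr_ae (𝒢.le s _ hA) ((hX n).2 s t hst |>.mono fun ω hω _ => hω)

theorem MartingaleProcess.enorm_sub_le_tsum (Z : ℕ → MartingaleProcess ℱ P T G) {n m : ℕ}
    (hnm : n ≤ m) : ‖Z n - Z m‖ₑ ≤ ∑' k, ‖Z (k + n + 1) - Z (k + n)‖ₑ := by
  obtain ⟨j, rfl⟩ := Nat.exists_eq_add_of_le hnm
  refine le_trans ?_ (ENNReal.sum_le_tsum (Finset.range j))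
  induction j with
  | zero => rw [add_zero, sub_self, ← ofReal_norm, norm_zero, ENNReal.ofReal_zero]; exact zero_le
  | succ j ih =>
    rw [Finset.sum_range_succ]
    calc ‖Z n - Z (n + (j + 1))‖ₑ = ‖(Z n - Z (n + j)) - (Z (j + n + 1) - Z (j + n))‖ₑ := by
          rw [add_comm j n, ← add_assoc]; congr 1; abel
      _ ≤ _ := (enorm_sub_le).trans (add_le_add_left (ih (Nat.le_add_right _ _)) _)

/-- Summable norms make the increments summable in the supremum norm almost surely, so paths
converge uniformly on a set `D` of full measure, which lies in `ℱ 0`. The limit `W` is prescribed in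
advance so that, with a parameter, a jointly measurable choice can be inserted. -/
theorem MartingaleProcess.exists_limit [TopologicalSpace.SeparableSpace G] (hT : 0 < T)
    (hnull : ∀ N : Set Ω, P N = 0 → MeasurableSet[ℱ 0] N) (Z : ℕ → MartingaleProcess ℱ P T G)
    (hZ : ∑' n, ‖Z (n + 1) - Z n‖ₑ ≠ ∞) {W : Set.Icc (0 : ℝ≥0) T → Ω → G}
    (hW : ∀ ω, ∑' n, supENorm (Z (n + 1) - Z n).process ω ≠ ∞ →
      ∀ t, Tendsto (fun n => (Z n).process t ω) atTop (𝓝 (W t ω)))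
    (hW0 : ∀ ω, ∑' n, supENorm (Z (n + 1) - Z n).process ω = ∞ → ∀ t, W t ω = 0) :
    ∃ Y : MartingaleProcess ℱ P T G, Y.process = W ∧
      Tendsto (fun n => ‖Z n - Y‖ₑ) atTop (𝓝 0) := by
  set D : Set Ω := {ω | ∑' n, supENorm (Z (n + 1) - Z n).process ω ≠ ∞} with hD
  have hDae : ∀ᵐ ω ∂P, ω ∈ D := by
    have h1 : ∫⁻ ω, ∑' n, supENorm (Z (n + 1) - Z n).process ω ∂P < ∞ := by
      rw [lintegral_tsum fun n => (Z (n + 1) - Z n).measurable_sup.aemeasurable]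
      exact (ENNReal.tsum_le_tsum fun n => (Z (n + 1) - Z n).lintegral_supENorm_le).trans_lt
        hZ.lt_top
    filter_upwards [ae_lt_top (Measurable.tsum fun n => (Z (n + 1) - Z n).measurable_sup) h1.ne]
      with ω hω using hω.ne
  have hDm : MeasurableSet[ℱ 0] D := by
    have := (hnull Dᶜ hDae).compl
    rwa [compl_compl] at this
  have hWc : ∀ ω, IsCadlag fun t => W t ω := by
    intro ω
    by_cases hω : ω ∈ D
    · refine IsCadlag.of_tendstoUniformly (x := fun n t => (Z n).process t ω)
        (fun n => (Z n).process_mem.2.1 ω) ?_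
      refine EMetric.tendstoUniformly_iff.2 fun ε hε => ?_
      have h1 := ENNReal.tendsto_sum_nat_add _ hω
      filter_upwards [h1.eventually_lt_const hε] with n hn t
      rw [edist_comm]
      refine lt_of_le_of_lt ?_ hn
      refine (edist_le_tsum_of_edist_le_of_tendsto
        (fun n => supENorm (Z (n + 1) - Z n).process ω) (fun k => ?_) (hW ω hω t) n).trans_eq ?_
      · rw [edist_comm, edist_eq_enorm_sub, map_sub]
        exact le_iSup (fun t => ‖((Z (k + 1)).process - (Z k).process) t ω‖ₑ) t
      · exact tsum_congr fun k => by rw [add_comm n k]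
    · have h0 : (fun t => W t ω) = 0 := funext fun t => hW0 ω (not_not.1 hω) t
      rw [h0]
      exact fun t => ⟨continuousWithinAt_const, 0, tendsto_const_nhds⟩
  have hWa : StronglyAdapted (filtrationIcc ℱ T) W := by
    intro t
    refine stronglyMeasurable_of_tendsto (m := filtrationIcc ℱ T t) atTop
      (f := fun n => D.indicator ((Z n).process t)) (fun n => ?_) ?_
    · exact ((Z n).process_mem.1.1 t).indicator (ℱ.mono zero_le _ hDm)
    · refine tendsto_pi_nhds.2 fun ω => ?_
      by_cases hω : ω ∈ D
      · simpa only [Set.indicator_of_mem hω] using hW ω hω t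
      · simpa only [Set.indicator_of_notMem hω, hW0 ω (not_not.1 hω) t] using tendsto_const_nhds
  have hWm : ∀ t, StronglyMeasurable (W t) := fun t => (hWa t).mono ((filtrationIcc ℱ T).le t)
  have htail : Tendsto (fun n => ∑' k, ‖Z (k + n + 1) - Z (k + n)‖ₑ) atTop (𝓝 0) :=
    ENNReal.tendsto_sum_nat_add (fun n => ‖Z (n + 1) - Z n‖ₑ) hZ
  have hle : ∀ n t, eLpNorm ((Z n).process t - W t) 2 P
      ≤ ∑' k, ‖Z (k + n + 1) - Z (k + n)‖ₑ := by
    intro n t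
    -- Fatou turns the pathwise limit into an `L²` bound by the tail of the series; Doob's
    -- inequality at `T` later upgrades it to the norm of `𝓜²_T(G)`.
    refine (Lp.eLpNorm_lim_le_liminf_eLpNorm (f := fun m => (Z n).process t - (Z m).process t)
      (fun m => ((Z n).stronglyMeasurable t).aestronglyMeasurable.sub
        ((Z m).stronglyMeasurable t).aestronglyMeasurable) _ ?_).trans ?_
    · filter_upwards [hDae] with ω hω
      exact tendsto_const_nhds.sub (hW ω hω t)
    · refine liminf_le_of_le (by isBoundedDefault) fun b hb => ?_
      obtain ⟨m, h1, h2⟩ := (hb.and (eventually_ge_atTop n)).exists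
      refine h1.trans (le_trans ?_ (enorm_sub_le_tsum Z h2))
      have h3 := (Z n - Z m).eLpNorm_le_enorm t
      rwa [map_sub, Pi.sub_apply] at h3
  have hlim : ∀ t, Tendsto (fun n => eLpNorm ((Z n).process t - W t) 2 P) atTop (𝓝 0) := fun t =>
    tendsto_of_tendsto_of_tendsto_of_le_of_le tendsto_const_nhds htail (fun n => zero_le)
      fun n => hle n t
  have hW2 : ∀ t, MemLp (W t) 2 P := by
    intro t
    obtain ⟨n, hn⟩ := ((hlim t).eventually_lt_const ENNReal.zero_lt_top).exists
    have h1 : MemLp ((Z n).process t - W t) 2 P :=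
      ⟨((Z n).stronglyMeasurable t).aestronglyMeasurable.sub (hWm t).aestronglyMeasurable, hn⟩
    have h2 := ((Z n).memLp t).sub h1
    rwa [sub_sub_cancel] at h2
  have hWM : Martingale W (filtrationIcc ℱ T) P :=
    martingale_of_tendsto_eLpNorm (fun n => (Z n).process_mem.1) hWa hW2 hlim
  let Y : MartingaleProcess ℱ P T G := ⟨W, hWM, hWc,
    (mENorm_le_two_mul hT hWM hW2 hWc).trans_lt (ENNReal.mul_lt_top (by finiteness) (hW2 _).2)⟩
  have hY : Y.process = W := rfl
  refine ⟨Y, hY, ?_⟩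
  have h2 := ENNReal.Tendsto.const_mul (hlim (lastTime T)) (a := 2) (Or.inr ENNReal.ofNat_ne_top)
  rw [mul_zero] at h2
  refine tendsto_of_tendsto_of_tendsto_of_le_of_le tendsto_const_nhds h2 (fun n => zero_le)
    fun n => ?_
  have h3 := (Z n - Y).enorm_le hT
  rwa [map_sub, Pi.sub_apply, hY] at h3

theorem MartingaleSpace.completeSpace [TopologicalSpace.SeparableSpace G] (hT : 0 < T)
    (hnull : ∀ N : Set Ω, P N = 0 → MeasurableSet[ℱ 0] N) :
    CompleteSpace (MartingaleSpace ℱ P T G) := by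
  have h : CompleteSpace (MartingaleProcess ℱ P T G) := by
    refine Metric.complete_of_convergent_controlled_sequences (fun n => (1 / 2) ^ n)
      (fun n => by positivity) fun Z hZ => ?_
    have hle : ∀ n, ‖Z (n + 1) - Z n‖ₑ ≤ 2⁻¹ ^ n := by
      intro n
      have h1 := (hZ n (n + 1) n n.le_succ le_rfl).le
      rw [dist_eq_norm] at h1
      rw [← ofReal_norm]
      refine (ENNReal.ofReal_le_ofReal h1).trans_eq ?_
      rw [ENNReal.ofReal_pow (by norm_num), one_div, ENNReal.ofReal_inv_of_pos (by norm_num)]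
      norm_num
    have hsum : ∑' n, ‖Z (n + 1) - Z n‖ₑ ≠ ∞ := by
      refine ((ENNReal.tsum_le_tsum hle).trans_lt ?_).ne
      rw [ENNReal.tsum_geometric]
      norm_num
    have hex : ∀ ω, ∃ w : Set.Icc (0 : ℝ≥0) T → G,
        (∑' n, supENorm (Z (n + 1) - Z n).process ω ≠ ∞ →
          ∀ t, Tendsto (fun n => (Z n).process t ω) atTop (𝓝 (w t))) ∧
        (∑' n, supENorm (Z (n + 1) - Z n).process ω = ∞ → ∀ t, w t = 0) := by
      intro ω
      by_cases hω : ∑' n, supENorm (Z (n + 1) - Z n).process ω = ∞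
      · exact ⟨0, fun h => absurd hω h, fun _ _ => rfl⟩
      · have h1 : ∀ t, ∃ l, Tendsto (fun n => (Z n).process t ω) atTop (𝓝 l) := by
          intro t
          refine cauchySeq_tendsto_of_complete (cauchySeq_of_edist_le_of_tsum_ne_top
            (fun n => supENorm (Z (n + 1) - Z n).process ω) (fun k => ?_) hω)
          rw [edist_comm, edist_eq_enorm_sub, map_sub]
          exact le_iSup (fun t => ‖((Z (k + 1)).process - (Z k).process) t ω‖ₑ) t
        choose w hw using h1
        exact ⟨w, fun _ => hw, fun h => absurd h hω⟩
    choose w hw1 hw2 using hex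
    obtain ⟨Y, -, hY⟩ := MartingaleProcess.exists_limit hT hnull Z hsum (W := fun t ω => w ω t)
      hw1 hw2
    refine ⟨Y, tendsto_iff_norm_sub_tendsto_zero.2 ?_⟩
    have := (ENNReal.tendsto_toReal ENNReal.zero_ne_top).comp hY
    simpa [Function.comp_def] using this
  infer_instance

end MartingaleSpaces
end

/-! ### The predictable product space and the norm of `Λ²`. -/

noncomputable section

section PredictableSpace

/-- The space `[0, T] × Ω × U`, with the product of the predictable σ-algebra and the σ-algebra
of `U`. -/
def PredSpace {Ω : Type*} {mΩ : MeasurableSpace Ω} (_ℱ : Filtration ℝ≥0 mΩ) (T : ℝ≥0)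
    (U : Type*) : Type _ := (Set.Icc (0 : ℝ≥0) T × Ω) × U

variable {Ω : Type*} {mΩ : MeasurableSpace Ω} {ℱ : Filtration ℝ≥0 mΩ} {P : Measure Ω}
  [IsProbabilityMeasure P]
  {H : Type*} [NormedAddCommGroup H] [InnerProductSpace ℝ H] [CompleteSpace H]
  {U : Type*} [TopologicalSpace U] [MeasurableSpace U] {T : ℝ≥0}

instance : MeasurableSpace (PredSpace ℱ T U) :=
  (CylMartMeasure.predictableIcc ℱ T).prod inferInstance

theorem measurableSet_predictableIcc_Ioc {s t : ℝ≥0} {F : Set Ω} (hF : MeasurableSet[ℱ s] F) :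
    MeasurableSet[CylMartMeasure.predictableIcc ℱ T]
      {p : Set.Icc (0 : ℝ≥0) T × Ω | p.1.1 ∈ Set.Ioc s t ∧ p.2 ∈ F} :=
  ⟨Set.Ioc s t ×ˢ F, measurableSet_predictable_Ioc_prod s t hF, rfl⟩

theorem predictableIcc_le : CylMartMeasure.predictableIcc ℱ T ≤
    (inferInstance : MeasurableSpace (Set.Icc (0 : ℝ≥0) T × Ω)) := by
  rw [← measurable_iff_comap_le]
  refine Measurable.mono (ma := inferInstance) ?_ le_rfl (measurableSpace_le_predictable_of_measurableSet
    (m' := (inferInstance : MeasurableSpace (ℝ≥0 × Ω))) (fun A hA => ?_) fun i A hA => ?_)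
  · exact (measurable_subtype_coe.comp measurable_fst).prodMk measurable_snd
  · exact (measurableSet_singleton _).prod (ℱ.le _ _ hA)
  · exact measurableSet_Ioi.prod (ℱ.le _ _ hA)

/-- The identity map from `[0, T] × Ω × U` with the product σ-algebra. -/
def toPred (ℱ : Filtration ℝ≥0 mΩ) (p : (Set.Icc (0 : ℝ≥0) T × Ω) × U) : PredSpace ℱ T U := p

theorem measurable_toPred : Measurable (toPred (T := T) (U := U) ℱ) := by
  intro s hs
  exact sup_le_sup (MeasurableSpace.comap_mono predictableIcc_le) le_rfl s hs

theorem measurable_predSpace_time :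
    Measurable fun p : PredSpace ℱ T U => ((p.1.1 : Set.Icc (0 : ℝ≥0) T) : ℝ≥0) := by
  have h1 : Measurable[CylMartMeasure.predictableIcc ℱ T]
      fun p : Set.Icc (0 : ℝ≥0) T × Ω => (p.1 : ℝ≥0) := by
    let : MeasurableSpace (Set.Icc (0 : ℝ≥0) T × Ω) := CylMartMeasure.predictableIcc ℱ T
    refine measurable_of_Ioi fun a => ?_
    exact ⟨Set.Ioi a ×ˢ Set.univ, measurableSet_predictable_Ioi_prod MeasurableSet.univ, by
      ext; simp⟩
  exact h1.comp (@measurable_fst _ _ (CylMartMeasure.predictableIcc ℱ T) _)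

theorem measurable_predSpace_snd : Measurable fun p : PredSpace ℱ T U => p.2 :=
  @measurable_snd _ _ (CylMartMeasure.predictableIcc ℱ T) _

theorem measurableSet_predSpace_rect {s t : ℝ≥0} {F : Set Ω} (hF : MeasurableSet[ℱ s] F)
    {A : Set U} (hA : MeasurableSet A) : MeasurableSet
      {p : PredSpace ℱ T U | (p.1.1.1 ∈ Set.Ioc s t ∧ p.1.2 ∈ F) ∧ p.2 ∈ A} :=
  (@measurable_fst _ _ (CylMartMeasure.predictableIcc ℱ T) _ _
    (measurableSet_predictableIcc_Ioc hF)).inter (measurable_predSpace_snd hA)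

namespace CylMartMeasure

variable (M : CylMartMeasure ℱ P H U)

instance : SigmaFinite M.mu := M.sigmaFinite_mu

theorem lam_Ioc_lt_top (s t : ℝ≥0) : M.lam (Set.Ioc s t) < ∞ :=
  (measure_mono (Set.Ioc_subset_Icc_self.trans (Set.Icc_subset_Icc_left zero_le))).trans_lt
    (M.lam_lt_top t)

instance : IsFiniteMeasure (M.lamIcc T) := by
  refine ⟨?_⟩
  rw [lamIcc, (MeasurableEmbedding.subtype_coe measurableSet_Icc).comap_apply]
  refine (measure_mono (Set.subset_univ _)).trans_lt ?_
  rw [Measure.restrict_apply_univ]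
  exact M.lam_Ioc_lt_top 0 T

variable (T) in
/-- The product measure on `[0, T] × Ω × U`. -/
def prodMeasure : Measure ((Set.Icc (0 : ℝ≥0) T × Ω) × U) := ((M.lamIcc T).prod P).prod M.mu

instance : SigmaFinite (M.prodMeasure T) := by unfold prodMeasure; infer_instance

variable (T) in
/-- The restriction of the product measure to the predictable sets. -/
def predMeasure : Measure (PredSpace ℱ T U) := (M.prodMeasure T).map (toPred ℱ)

instance : SFinite (M.predMeasure T) := by unfold predMeasure; infer_instance

variable (T) in
/-- The seminorms `q_{r,u}` as a family on `[0, T] × Ω × U`. -/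
def predSeminorm (p : PredSpace ℱ T U) : HilbertianSeminorm H := M.q p.1.1 p.2

theorem isMeasurableSeminorm_predSeminorm : IsMeasurableSeminorm (M.predSeminorm T) := fun h₁ h₂ =>
  (M.measurable_q h₁ h₂).comp (measurable_predSpace_time.prodMk measurable_predSpace_snd)

variable {G : Type*} [NormedAddCommGroup G] [InnerProductSpace ℝ G] [CompleteSpace G]

/-- An integrand, as a field of operators. -/
def toField (Φ : M.Integrand T G) (p : PredSpace ℱ T U) :
    HilbertSchmidt (M.predSeminorm T p).Space G := Φ p.1.1 p.1.2 p.2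

/-- Tonelli, after pulling back to the full product σ-algebra; it links the iterated integral in
`lambdaENorm` to an `L²` norm for one measure. -/
theorem lintegral_predMeasure {f : PredSpace ℱ T U → ℝ≥0∞} (hf : Measurable f) :
    ∫⁻ p, f p ∂(M.predMeasure T) = ∫⁻ ω, ∫⁻ r, ∫⁻ u, f ((r, ω), u) ∂M.mu ∂(M.lamIcc T) ∂P := by
  have hf' : Measurable fun z => f (toPred ℱ z) := hf.comp measurable_toPred
  rw [predMeasure, lintegral_map hf measurable_toPred, prodMeasure]
  exact (lintegral_prod _ hf'.aemeasurable).trans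
    (lintegral_prod_symm _ hf'.lintegral_prod_right'.aemeasurable)

variable [TopologicalSpace.SeparableSpace H] [TopologicalSpace.SeparableSpace G]

theorem measurable_enorm_toField {Φ : M.Integrand T G}
    (hΦ : IsMeasurableOperatorField (M.toField Φ)) : Measurable fun p => ‖M.toField Φ p‖ₑ :=
  hΦ.measurable_enorm M.isMeasurableSeminorm_predSeminorm

theorem measurable_norm_toField {Φ : M.Integrand T G}
    (hΦ : IsMeasurableOperatorField (M.toField Φ)) : Measurable fun p => ‖M.toField Φ p‖ := by
  simpa using (M.measurable_enorm_toField hΦ).ennreal_toReal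

theorem lambdaENorm_eq {Φ : M.Integrand T G} (hΦ : IsMeasurableOperatorField (M.toField Φ)) :
    M.lambdaENorm Φ = eLpNorm (fun p => ‖M.toField Φ p‖) 2 (M.predMeasure T) := by
  rw [eLpNorm_two_eq, lambdaENorm]
  simp only [enorm_norm]
  rw [M.lintegral_predMeasure ((M.measurable_enorm_toField hΦ).pow_const 2)]
  rfl

theorem lambdaENorm_triangle {Φ Ψ Θ : M.Integrand T G}
    (hΦ : IsMeasurableOperatorField (M.toField Φ)) (hΨ : IsMeasurableOperatorField (M.toField Ψ))
    (hΘ : IsMeasurableOperatorField (M.toField Θ)) :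
    M.lambdaENorm (Φ - Θ) ≤ M.lambdaENorm (Φ - Ψ) + M.lambdaENorm (Ψ - Θ) := by
  have h1 : IsMeasurableOperatorField (M.toField (Φ - Θ)) := hΦ.sub hΘ
  have h2 : IsMeasurableOperatorField (M.toField (Φ - Ψ)) := hΦ.sub hΨ
  have h3 : IsMeasurableOperatorField (M.toField (Ψ - Θ)) := hΨ.sub hΘ
  rw [M.lambdaENorm_eq h1, M.lambdaENorm_eq h2, M.lambdaENorm_eq h3]
  refine le_trans (eLpNorm_mono_real fun p => ?_)
    (eLpNorm_add_le (M.measurable_norm_toField h2).aestronglyMeasurable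
      (M.measurable_norm_toField h3).aestronglyMeasurable one_le_two)
  rw [norm_norm]
  exact norm_sub_le_norm_sub_add_norm_sub (M.toField Φ p) (M.toField Ψ p) (M.toField Θ p)

omit [CompleteSpace G] [TopologicalSpace.SeparableSpace G] [InnerProductSpace ℝ G]
  [NormedAddCommGroup G] [TopologicalSpace.SeparableSpace H] in
/-- The seminorms `q_{r,u}`, `r ≤ T`, are uniformly bounded. -/
theorem exists_val_le (T : ℝ≥0) : ∃ C : ℝ, 0 ≤ C ∧ ∀ r ≤ T, ∀ u h, (M.q r u).val h ≤ C * ‖h‖ := by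
  let p : Set.Iic T × U → Seminorm ℝ H := fun x =>
    (normSeminorm ℝ (M.q x.1 x.2).Space).comp (M.q x.1 x.2).incl.toLinearMap
  have hp : ∀ x h, p x h = (M.q x.1 x.2).val h := fun x h => (M.q x.1 x.2).norm_incl h
  have hbdd : BddAbove (Set.range p) := by
    rw [Seminorm.bddAbove_range_iff]
    intro h
    obtain ⟨C, hC⟩ := M.bounded_q h h T
    refine ⟨√C, ?_⟩
    rintro _ ⟨x, rfl⟩
    simp only [hp]
    exact Real.sqrt_le_sqrt ((le_abs_self _).trans (hC x.1 x.1.2 x.2))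
  -- Banach-Steinhaus: `H` is complete, so a pointwise bounded family of continuous seminorms has a
  -- continuous supremum. The hypothesis gives bounds for each `h` only.
  have hcont : Continuous (⨆ x, p x : Seminorm ℝ H) := by
    rw [Seminorm.coe_iSup_eq hbdd]
    refine Seminorm.continuous_iSup p (fun x => ?_) hbdd
    exact continuous_norm.comp (M.q x.1 x.2).incl.continuous
  obtain ⟨C, hC0, hC⟩ := Seminorm.bound_of_continuous_normedSpace _ hcont
  refine ⟨C, hC0.le, fun r hr u h => ?_⟩
  rw [← hp (⟨r, hr⟩, u)]
  refine le_trans ?_ (hC h)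
  exact (le_ciSup hbdd (⟨r, hr⟩, u) : p (⟨r, hr⟩, u) ≤ ⨆ x, p x) h

end CylMartMeasure

end PredictableSpace
end

/-! ### Covariance of the increments and the isometry for elementary integrals. -/

noncomputable section

namespace CylMartMeasure

variable {Ω : Type*} {mΩ : MeasurableSpace Ω} {ℱ : Filtration ℝ≥0 mΩ} {P : Measure Ω}
  [IsProbabilityMeasure P]
  {H : Type*} [NormedAddCommGroup H] [InnerProductSpace ℝ H] [CompleteSpace H]
  {U : Type*} [TopologicalSpace U] [MeasurableSpace U]
  (M : CylMartMeasure ℱ P H U)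

instance : SigmaFinite M.lam :=
  ⟨⟨{ set := fun n => Set.Icc 0 (n : ℝ≥0)
      set_mem := fun _ => trivial
      finite := fun n => M.lam_lt_top n
      spanning := Set.eq_univ_of_forall fun r => Set.mem_iUnion.2
        ((exists_nat_ge r).imp fun _ hn => ⟨zero_le, hn⟩) }⟩⟩

/-- The increment `M((s, t], A)(h)`. -/
def incr (s t : ℝ≥0) (A : Set U) (h : H) (ω : Ω) : ℝ := M.toFun t A h ω - M.toFun s A h ω

/-- `∫_{(a,b]} ∫_B q_{r,u}(h, k) μ(du) λ(dr)`. -/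
def formIntegral (a b : ℝ≥0) (B : Set U) (h k : H) : ℝ :=
  ∫ p in Set.Ioc a b ×ˢ B, (M.q p.1 p.2).form h k ∂(M.lam.prod M.mu)

variable {M} {A B : Set U}

theorem memLp_incr (hA : A ∈ M.ring) (s t : ℝ≥0) (h : H) : MemLp (M.incr s t A h) 2 P :=
  (M.memLp_two t A hA h).sub (M.memLp_two s A hA h)

theorem incr_add_incr (s m t : ℝ≥0) (A : Set U) (h : H) (ω : Ω) :
    M.incr s m A h ω + M.incr m t A h ω = M.incr s t A h ω := by
  simp only [incr]; ring

theorem incr_add (s t : ℝ≥0) (A : Set U) (h k : H) :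
    M.incr s t A (h + k) =ᵐ[P] fun ω => M.incr s t A h ω + M.incr s t A k ω := by
  filter_upwards [AEEqFun.coeFn_add (M.toFun t A h) (M.toFun t A k),
    AEEqFun.coeFn_add (M.toFun s A h) (M.toFun s A k)] with ω h1 h2
  simp only [incr, map_add, h1, h2, Pi.add_apply]
  ring

theorem incr_union (s t : ℝ≥0) (hA : A ∈ M.ring) (hB : B ∈ M.ring) (hAB : Disjoint A B) (h : H) :
    M.incr s t (A ∪ B) h =ᵐ[P] fun ω => M.incr s t A h ω + M.incr s t B h ω := by
  filter_upwards [AEEqFun.coeFn_add (M.toFun t A h) (M.toFun t B h),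
    AEEqFun.coeFn_add (M.toFun s A h) (M.toFun s B h)] with ω h1 h2
  simp only [incr, M.map_union _ A hA B hB hAB, h1, h2, Pi.add_apply]
  ring

theorem stronglyMeasurable_incr (hA : A ∈ M.ring) {s t : ℝ≥0} (hst : s ≤ t) (h : H) :
    StronglyMeasurable[ℱ t] (M.incr s t A h) :=
  ((M.martingale A hA h).1 t).sub (((M.martingale A hA h).1 s).mono (ℱ.mono hst))

/-- Increments are orthogonal to the past. -/
theorem integral_mul_incr_eq_zero (hA : A ∈ M.ring) {s t : ℝ≥0} (hst : s ≤ t) (h : H) {Z : Ω → ℝ}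
    (hZ : StronglyMeasurable[ℱ s] Z) (hZ2 : MemLp Z 2 P) :
    ∫ ω, Z ω * M.incr s t A h ω ∂P = 0 := by
  have := (M.martingale A hA h).integral_inner_sub_eq_zero (fun t => M.memLp_two t A hA h) hst hZ hZ2
  simpa [incr] using this

theorem integral_incr_mul_incr_of_disjoint (hA : A ∈ M.ring) (hB : B ∈ M.ring)
    (hAB : Disjoint A B) (s t : ℝ≥0) (h k : H) :
    ∫ ω, M.incr s t A h ω * M.incr s t B k ω ∂P = 0 := by
  have hi : ∀ a b, Integrable (fun ω => M.toFun a A h ω * M.toFun b B k ω) P := fun a b =>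
    (M.memLp_two a A hA h).integrable_mul (M.memLp_two b B hB k)
  have h1 : ∀ ω, M.incr s t A h ω * M.incr s t B k ω
      = (M.toFun t A h ω * M.toFun t B k ω - M.toFun t A h ω * M.toFun s B k ω)
        - (M.toFun s A h ω * M.toFun t B k ω - M.toFun s A h ω * M.toFun s B k ω) := by
    intro ω; simp only [incr]; ring
  simp only [h1]
  have hd : ∀ a, Integrable (fun ω => M.toFun a A h ω * M.toFun t B k ω
      - M.toFun a A h ω * M.toFun s B k ω) P := fun a => Integrable.sub (hi a t) (hi a s)
  rw [integral_sub (hd t) (hd s), integral_sub (hi t t) (hi t s),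
    integral_sub (hi s t) (hi s s)]
  simp only [M.orthogonal A hA B hB hAB]
  simp

variable [BorelSpace U]

theorem measurableSet_of_mem_ring (hA : A ∈ M.ring) : MeasurableSet A := by
  rw [BorelSpace.measurable_eq (α := U), ← M.generateFrom_ring]
  exact MeasurableSpace.measurableSet_generateFrom hA

theorem integrableOn_form (hA : A ∈ M.ring) (a b : ℝ≥0) (h k : H) :
    IntegrableOn (fun p : ℝ≥0 × U => (M.q p.1 p.2).form h k) (Set.Ioc a b ×ˢ A)
      (M.lam.prod M.mu) := by
  obtain ⟨C, hC⟩ := M.bounded_q h k b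
  refine Measure.integrableOn_of_bounded (M := C) ?_
    (M.measurable_q h k).aestronglyMeasurable ?_
  · rw [Measure.prod_prod]
    exact (ENNReal.mul_lt_top (M.lam_Ioc_lt_top a b) (M.mu_lt_top A hA)).ne
  · filter_upwards [self_mem_ae_restrict (measurableSet_Ioc.prod (measurableSet_of_mem_ring hA))]
      with p hp
    exact hC _ hp.1.2 _

theorem formIntegral_add (hA : A ∈ M.ring) (a b : ℝ≥0) (h k : H) :
    M.formIntegral a b A (h + k) (h + k) = M.formIntegral a b A h h
      + 2 * M.formIntegral a b A h k + M.formIntegral a b A k k := by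
  have h1 : ∀ p : ℝ≥0 × U, (M.q p.1 p.2).form (h + k) (h + k) = (M.q p.1 p.2).form h h
      + 2 * (M.q p.1 p.2).form h k + (M.q p.1 p.2).form k k := by
    intro p
    have h2 : (M.q p.1 p.2).form (h + k) = (M.q p.1 p.2).form h + (M.q p.1 p.2).form k := map_add _ _ _
    rw [h2]
    simp only [LinearMap.add_apply, map_add, (M.q p.1 p.2).symm k h]
    ring
  simp only [formIntegral, h1]
  rw [integral_add, integral_add, integral_const_mul]
  · exact integrableOn_form hA a b h h
  · exact (integrableOn_form hA a b h k).const_mul 2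
  · exact (integrableOn_form hA a b h h).fun_add ((integrableOn_form hA a b h k).const_mul 2)
  · exact integrableOn_form hA a b k k

theorem integral_incr_sq (hA : A ∈ M.ring) {a b : ℝ≥0} (hab : a < b) (h : H) :
    ∫ ω, M.incr a b A h ω ^ 2 ∂P = M.formIntegral a b A h h := by
  have h1 := M.covariance A hA a b hab h
  simp only [sq_abs] at h1
  rw [formIntegral, setIntegral_prod _ (integrableOn_form hA a b h h)]
  simp only [incr]
  rw [h1]
  simp only [HilbertianSeminorm.val, Real.sq_sqrt (HilbertianSeminorm.nonneg _ h)]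

/-- Polarization: the quadratic covariance formula is applied to `h`, `k` and `h + k`. -/
theorem integral_incr_mul_incr_self (hA : A ∈ M.ring) {a b : ℝ≥0} (hab : a < b) (h k : H) :
    ∫ ω, M.incr a b A h ω * M.incr a b A k ω ∂P = M.formIntegral a b A h k := by
  have hi : ∀ h k, Integrable (fun ω => M.incr a b A h ω * M.incr a b A k ω) P := fun h k =>
    (memLp_incr hA a b h).integrable_mul (memLp_incr hA a b k)
  have h1 : ∫ ω, M.incr a b A (h + k) ω ^ 2 ∂P = ∫ ω, (M.incr a b A h ω * M.incr a b A h ω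
      + 2 * (M.incr a b A h ω * M.incr a b A k ω) + M.incr a b A k ω * M.incr a b A k ω) ∂P := by
    refine integral_congr_ae ?_
    filter_upwards [incr_add a b A h k] with ω hω
    rw [hω]; ring
  rw [integral_add ((hi h h).fun_add ((hi h k).const_mul 2)) (hi k k),
    integral_add (hi h h) ((hi h k).const_mul 2), integral_const_mul,
    integral_incr_sq hA hab, formIntegral_add hA] at h1
  have h2 := integral_incr_sq hA hab h
  have h3 := integral_incr_sq hA hab k
  simp only [pow_two] at h2 h3
  linarith

/-- Split `A` and `B` along `A ∩ B`; all pairs of disjoint pieces are orthogonal. -/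
theorem integral_incr_mul_incr (hA : A ∈ M.ring) (hB : B ∈ M.ring) {a b : ℝ≥0} (hab : a < b)
    (h k : H) :
    ∫ ω, M.incr a b A h ω * M.incr a b B k ω ∂P = M.formIntegral a b (A ∩ B) h k := by
  have hI : A ∩ B ∈ M.ring := M.isSetRing_ring.inter_mem hA hB
  have hdA : A \ B ∈ M.ring := M.isSetRing_ring.sdiff_mem hA hB
  have hdB : B \ A ∈ M.ring := M.isSetRing_ring.sdiff_mem hB hA
  have h1 := incr_union (M := M) a b hI hdA Set.disjoint_sdiff_inter.symm h
  have h2 := incr_union (M := M) a b hI hdB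
    (by rw [Set.inter_comm]; exact Set.disjoint_sdiff_inter.symm) k
  rw [Set.inter_union_sdiff] at h1
  rw [Set.inter_comm, Set.inter_union_sdiff, Set.inter_comm] at h2
  have hi : ∀ {C D}, C ∈ M.ring → D ∈ M.ring →
      Integrable (fun ω => M.incr a b C h ω * M.incr a b D k ω) P := fun hC hD =>
    (memLp_incr hC a b h).integrable_mul (memLp_incr hD a b k)
  have h3 : ∫ ω, M.incr a b A h ω * M.incr a b B k ω ∂P
      = ∫ ω, ((M.incr a b (A ∩ B) h ω * M.incr a b (A ∩ B) k ω
        + M.incr a b (A ∩ B) h ω * M.incr a b (B \ A) k ω)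
        + M.incr a b (A \ B) h ω * M.incr a b B k ω) ∂P := by
    refine integral_congr_ae ?_
    filter_upwards [h1, h2] with ω e1 e2
    rw [e1, e2]; ring
  rw [h3, integral_add ((hi hI hI).fun_add (hi hI hdB)) (hi hdA hB),
    integral_add (hi hI hI) (hi hI hdB), integral_incr_mul_incr_self hI hab,
    integral_incr_mul_incr_of_disjoint hI hdB (Set.disjoint_sdiff_right.mono_left
      Set.inter_subset_left), integral_incr_mul_incr_of_disjoint hdA hB Set.disjoint_sdiff_left]
  simp

/-- The product of the two increments is independent of `ℱ_a`, so its conditional expectation is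
constant. -/
theorem setIntegral_incr_mul_incr (hA : A ∈ M.ring) (hB : B ∈ M.ring) {a b : ℝ≥0} (hab : a < b)
    (h k : H) {C : Set Ω} (hC : MeasurableSet[ℱ a] C) :
    ∫ ω in C, M.incr a b A h ω * M.incr a b B k ω ∂P
      = P.real C * M.formIntegral a b (A ∩ B) h k := by
  have hmeas : ∀ A h, Measurable fun ω => M.toFun b A h ω - M.toFun a A h ω := fun A h =>
    (M.toFun b A h).measurable.sub (M.toFun a A h).measurable
  -- The joint σ-algebra of all increments: independence of each single increment from `ℱ_a` would
  -- not reach products of two of them.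
  set 𝒢 : MeasurableSpace Ω := ⨆ A ∈ M.ring, ⨆ h : H, MeasurableSpace.comap
    (fun ω => M.toFun b A h ω - M.toFun a A h ω) (borel ℝ) with h𝒢
  have hle : 𝒢 ≤ mΩ := by
    refine iSup₂_le fun A _ => iSup_le fun h => ?_
    rw [← BorelSpace.measurable_eq (α := ℝ), ← measurable_iff_comap_le]
    exact hmeas A h
  have hm : ∀ A ∈ M.ring, ∀ h, StronglyMeasurable[𝒢] (M.incr a b A h) := by
    intro A hA h
    have h1 : Measurable[𝒢] (M.incr a b A h) := by
      rw [measurable_iff_comap_le, BorelSpace.measurable_eq (α := ℝ)]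
      exact le_iSup₂_of_le A hA (le_iSup_of_le h le_rfl)
    exact h1.stronglyMeasurable
  have hi : Integrable (M.incr a b A h * M.incr a b B k) P :=
    (memLp_incr hA a b h).integrable_mul (memLp_incr hB a b k)
  have h1 := condExp_indep_eq hle (ℱ.le a) ((hm A hA h).mul (hm B hB k))
    (M.indep_increments a b hab)
  change ∫ ω in C, (M.incr a b A h * M.incr a b B k) ω ∂P = _
  rw [← setIntegral_condExp (ℱ.le a) hi hC, setIntegral_congr_ae (ℱ.le a _ hC)
    (h1.mono fun ω hω _ => hω), setIntegral_const, smul_eq_mul]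
  congr 1
  exact integral_incr_mul_incr hA hB hab h k

/-- The elementary integral `1_F M((s, t], A)(h)`. -/
def elemIncr (M : CylMartMeasure ℱ P H U) (s t : ℝ≥0) (F : Set Ω) (A : Set U) (h : H) : Ω → ℝ :=
  F.indicator (M.incr s t A h)

theorem memLp_elemIncr (hA : A ∈ M.ring) {s : ℝ≥0} (t : ℝ≥0) {F : Set Ω}
    (hF : MeasurableSet[ℱ s] F) (h : H) : MemLp (M.elemIncr s t F A h) 2 P :=
  (memLp_incr hA s t h).indicator (ℱ.le _ _ hF)

theorem integral_mul_elemIncr_eq_zero (hA : A ∈ M.ring) {s t : ℝ≥0} (hst : s ≤ t) (h : H)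
    {F : Set Ω} (hF : MeasurableSet[ℱ s] F) {Z : Ω → ℝ}
    (hZ : StronglyMeasurable[ℱ s] Z) (hZ2 : MemLp Z 2 P) :
    ∫ ω, Z ω * M.elemIncr s t F A h ω ∂P = 0 := by
  have h1 := integral_mul_incr_eq_zero hA hst h (hZ.indicator hF) (hZ2.indicator (ℱ.le _ _ hF))
  rw [← h1]
  refine integral_congr_ae (ae_of_all _ fun ω => ?_)
  by_cases hω : ω ∈ F <;> simp [elemIncr, hω]

theorem integral_elemIncr_mul_of_le (hA : A ∈ M.ring) (hB : B ∈ M.ring) {s t s' t' : ℝ≥0}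
    (hst : s ≤ t) (hts : t ≤ s') (hst' : s' ≤ t') {F F' : Set Ω} (hF : MeasurableSet[ℱ s] F)
    (hF' : MeasurableSet[ℱ s'] F') (h k : H) :
    ∫ ω, M.elemIncr s t F A h ω * M.elemIncr s' t' F' B k ω ∂P = 0 :=
  integral_mul_elemIncr_eq_zero hB hst' k hF'
    (((stronglyMeasurable_incr hA hst h).indicator (ℱ.mono hst _ hF)).mono (ℱ.mono hts))
    (memLp_elemIncr hA t hF h)

theorem integral_elemIncr_mul_same (hA : A ∈ M.ring) (hB : B ∈ M.ring) {a b : ℝ≥0} (hab : a < b)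
    {F F' : Set Ω} (hF : MeasurableSet[ℱ a] F) (hF' : MeasurableSet[ℱ a] F') (h k : H) :
    ∫ ω, M.elemIncr a b F A h ω * M.elemIncr a b F' B k ω ∂P
      = P.real (F ∩ F') * M.formIntegral a b (A ∩ B) h k := by
  rw [← setIntegral_incr_mul_incr hA hB hab h k (hF.inter hF'),
    ← integral_indicator (ℱ.le _ _ (hF.inter hF'))]
  refine integral_congr_ae (ae_of_all _ fun ω => ?_)
  by_cases h1 : ω ∈ F <;> by_cases h2 : ω ∈ F' <;> simp [elemIncr, h1, h2]

theorem elemIncr_split (s m t : ℝ≥0) (F : Set Ω) (A : Set U) (h : H) (ω : Ω) :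
    M.elemIncr s t F A h ω = M.elemIncr s m F A h ω + M.elemIncr m t F A h ω := by
  by_cases hω : ω ∈ F <;> simp [elemIncr, hω, incr_add_incr]

theorem formIntegral_symm (a b : ℝ≥0) (B : Set U) (h k : H) :
    M.formIntegral a b B h k = M.formIntegral a b B k h := by
  simp only [formIntegral, HilbertianSeminorm.symm _ h k]

/-- The isometry for elementary integrals, in bilinear form. -/
theorem integral_elemIncr_mul (hA : A ∈ M.ring) (hB : B ∈ M.ring) {s t s' t' : ℝ≥0}
    (hst : s < t) (hst' : s' < t') {F F' : Set Ω} (hF : MeasurableSet[ℱ s] F)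
    (hF' : MeasurableSet[ℱ s'] F') (h k : H) :
    ∫ ω, M.elemIncr s t F A h ω * M.elemIncr s' t' F' B k ω ∂P
      = P.real (F ∩ F') * M.formIntegral (max s s') (min t t') (A ∩ B) h k := by
  wlog hss : s ≤ s' generalizing A B s t s' t' F F' h k with hwlog
  · have := hwlog hB hA hst' hst hF' hF k h (not_le.1 hss).le
    rw [Set.inter_comm F, max_comm, min_comm, Set.inter_comm A, formIntegral_symm, ← this]
    exact integral_congr_ae (ae_of_all _ fun ω => mul_comm _ _)
  rw [max_eq_right hss]
  rcases le_or_gt t s' with hts | hts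
  -- Disjoint time intervals: the covariance vanishes, and so does the integral over the empty
  -- intersection.
  · rw [integral_elemIncr_mul_of_le hA hB hst.le hts hst'.le hF hF', formIntegral,
      Set.Ioc_eq_empty (not_lt.2 ((min_le_left t t').trans hts))]
    simp
  have hFs' : MeasurableSet[ℱ s'] F := ℱ.mono hss _ hF
  have hi : ∀ {a b c d : ℝ≥0} {E E' : Set Ω}, MeasurableSet[ℱ a] E → MeasurableSet[ℱ c] E' →
      Integrable (fun ω => M.elemIncr a b E A h ω * M.elemIncr c d E' B k ω) P := fun hE hE' =>
    (memLp_elemIncr hA _ hE h).integrable_mul (memLp_elemIncr hB _ hE' k)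
  -- Cut the first increment at `s'`; its earlier part is orthogonal to everything that starts at
  -- `s'`. The later right end point is then cut in the same way, which leaves a common time
  -- interval.
  have h1 : ∫ ω, M.elemIncr s t F A h ω * M.elemIncr s' t' F' B k ω ∂P
      = ∫ ω, M.elemIncr s' t F A h ω * M.elemIncr s' t' F' B k ω ∂P := by
    simp only [elemIncr_split s s' t, add_mul]
    rw [integral_add (hi hF hF') (hi hFs' hF'),
      integral_elemIncr_mul_of_le hA hB hss le_rfl hst'.le hF hF', zero_add]
  rw [h1]
  rcases le_total t t' with htt | htt
  · rw [min_eq_left htt]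
    simp only [elemIncr_split s' t t', mul_add]
    rw [integral_add (hi hFs' hF') (hi hFs' (ℱ.mono hts.le _ hF')),
      integral_elemIncr_mul_of_le hA hB hts.le le_rfl htt hFs' (ℱ.mono hts.le _ hF'), add_zero]
    exact integral_elemIncr_mul_same hA hB hts hFs' hF' h k
  · rw [min_eq_right htt]
    simp only [elemIncr_split s' t' t F, add_mul]
    rw [integral_add (hi hFs' hF') (hi (ℱ.mono hst'.le _ hFs') hF')]
    have h2 : ∫ ω, M.elemIncr t' t F A h ω * M.elemIncr s' t' F' B k ω ∂P = 0 := by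
      rw [← integral_elemIncr_mul_of_le hB hA hst'.le le_rfl htt hF' (ℱ.mono hst'.le _ hFs') k h]
      exact integral_congr_ae (ae_of_all _ fun ω => mul_comm _ _)
    rw [h2, add_zero]
    exact integral_elemIncr_mul_same hA hB hst' hFs' hF' h k

variable {T : ℝ≥0}

/-- The elementary integrand `1_{(s, t]}(r) 1_F(ω) 1_A(u)`. -/
def elemInd (s t : ℝ≥0) (F : Set Ω) (A : Set U) (p : (Set.Icc (0 : ℝ≥0) T × Ω) × U) : ℝ :=
  (Set.Ioc s t).indicator 1 p.1.1.1 * F.indicator 1 p.1.2 * A.indicator 1 p.2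

omit [TopologicalSpace U] [MeasurableSpace U] [BorelSpace U] in
theorem elemInd_eq_indicator (s t : ℝ≥0) (F : Set Ω) (A : Set U)
    (p : (Set.Icc (0 : ℝ≥0) T × Ω) × U) : elemInd s t F A p
      = ({p | (p.1.1.1 ∈ Set.Ioc s t ∧ p.1.2 ∈ F) ∧ p.2 ∈ A} :
        Set ((Set.Icc (0 : ℝ≥0) T × Ω) × U)).indicator 1 p := by
  by_cases h1 : p.1.1.1 ∈ Set.Ioc s t <;> by_cases h2 : p.1.2 ∈ F <;> by_cases h3 : p.2 ∈ A <;>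
    simp [elemInd, h1, h2, h3, -Set.mem_Ioc]

/-- The integrand is a bounded form restricted to a box of finite measure, and the form does not
depend on `ω`; hence the factor `P(F)`. -/
theorem integrable_and_integral_elemInd (hA : A ∈ M.ring) {s t : ℝ≥0} (ht : t ≤ T)
    {F : Set Ω} (hF : MeasurableSet F) (h k : H) :
    Integrable (fun p : (Set.Icc (0 : ℝ≥0) T × Ω) × U =>
        elemInd s t F A p * (M.q p.1.1 p.2).form h k) (M.prodMeasure T) ∧
    ∫ p, elemInd s t F A p * (M.q p.1.1 p.2).form h k ∂(M.prodMeasure T)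
      = P.real F * M.formIntegral s t A h k := by
  set S : Set (Set.Icc (0 : ℝ≥0) T) := Subtype.val ⁻¹' Set.Ioc s t with hS
  have hSm : MeasurableSet S := measurable_subtype_coe measurableSet_Ioc
  have hAm := measurableSet_of_mem_ring hA
  have h1 : ∀ p : (Set.Icc (0 : ℝ≥0) T × Ω) × U, elemInd s t F A p * (M.q p.1.1 p.2).form h k
      = ((S ×ˢ F) ×ˢ A).indicator (fun p => (M.q p.1.1 p.2).form h k) p := by
    intro p
    rw [elemInd_eq_indicator]
    by_cases hp : p ∈ (S ×ˢ F) ×ˢ A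
    · rw [Set.indicator_of_mem hp, Set.indicator_of_mem (by exact hp)]
      simp
    · rw [Set.indicator_of_notMem hp, Set.indicator_of_notMem (by exact hp)]
      simp
  have hmeas : Measurable fun p : (Set.Icc (0 : ℝ≥0) T × Ω) × U => (M.q p.1.1 p.2).form h k :=
    (M.measurable_q h k).comp ((measurable_subtype_coe.comp
      (measurable_fst.comp measurable_fst)).prodMk measurable_snd)
  have hint : IntegrableOn (fun p : (Set.Icc (0 : ℝ≥0) T × Ω) × U => (M.q p.1.1 p.2).form h k)
      ((S ×ˢ F) ×ˢ A) (M.prodMeasure T) := by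
    obtain ⟨C, hC⟩ := M.bounded_q h k T
    refine Measure.integrableOn_of_bounded (M := C) ?_ hmeas.aestronglyMeasurable
      (ae_of_all _ fun p => hC _ p.1.1.2.2 _)
    rw [prodMeasure, Measure.prod_prod]
    exact (ENNReal.mul_lt_top (measure_lt_top _ _) (M.mu_lt_top A hA)).ne
  simp only [h1]
  refine ⟨hint.integrable_indicator ((hSm.prod hF).prod hAm), ?_⟩
  rw [integral_indicator ((hSm.prod hF).prod hAm), prodMeasure, setIntegral_prod _ hint]
  have h2 := setIntegral_prod_mul (μ := M.lamIcc T) (ν := P)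
    (fun r : Set.Icc (0 : ℝ≥0) T => ∫ u in A, (M.q r u).form h k ∂M.mu) (fun _ => (1 : ℝ)) S F
  simp only [mul_one] at h2
  rw [h2, setIntegral_const, smul_eq_mul, mul_one, mul_comm, formIntegral,
    setIntegral_prod _ (integrableOn_form hA s t h k)]
  congr 1
  -- From `λ` on the subtype `[0, T]` back to `λ` on the half-line: nothing is lost because `(s, t]
  -- ⊆ (0, T]`.
  rw [← integral_indicator hSm, ← integral_indicator measurableSet_Ioc, lamIcc]
  have h3 := integral_subtype_comap (μ := M.lam.restrict (Set.Ioc 0 T)) (s := Set.Icc (0 : ℝ≥0) T)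
    measurableSet_Icc ((Set.Ioc s t).indicator fun r => ∫ u in A, (M.q r u).form h k ∂M.mu)
  refine Eq.trans ?_ (h3.trans ?_)
  · exact integral_congr_ae (ae_of_all _ fun r => rfl)
  · rw [Measure.restrict_restrict measurableSet_Icc, integral_indicator measurableSet_Ioc,
      integral_indicator measurableSet_Ioc, Measure.restrict_restrict measurableSet_Ioc]
    congr 2
    ext r
    simp only [Set.mem_inter_iff, Set.mem_Ioc, Set.mem_Icc]
    exact ⟨fun hr => hr.1, fun hr => ⟨hr, ⟨zero_le, hr.2.trans ht⟩, zero_le.trans_lt hr.1,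
      hr.2.trans ht⟩⟩

omit [TopologicalSpace U] [MeasurableSpace U] [BorelSpace U] in
theorem elemInd_mul (s t s' t' : ℝ≥0) (F F' : Set Ω) (A B : Set U)
    (p : (Set.Icc (0 : ℝ≥0) T × Ω) × U) : elemInd s t F A p * elemInd s' t' F' B p
      = elemInd (max s s') (min t t') (F ∩ F') (A ∩ B) p := by
  simp only [elemInd, ← Set.Ioc_inter_Ioc]
  rw [Set.inter_indicator_one, Set.inter_indicator_one, Set.inter_indicator_one]
  simp only [Pi.mul_apply]
  ring

/-- The isometry for sums of elementary integrals. -/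
theorem lintegral_sum_elemIncr {ι : Type*} [Fintype ι] {s t : ι → ℝ≥0} {F : ι → Set Ω}
    {A : ι → Set U} (hst : ∀ i, s i < t i) (htT : ∀ i, t i ≤ T)
    (hF : ∀ i, MeasurableSet[ℱ (s i)] (F i)) (hA : ∀ i, A i ∈ M.ring) (h : ι → H) :
    ∫⁻ ω, ‖∑ i, M.elemIncr (s i) (t i) (F i) (A i) (h i) ω‖ₑ ^ 2 ∂P
      = ∫⁻ p : (Set.Icc (0 : ℝ≥0) T × Ω) × U,
        ‖∑ i, elemInd (s i) (t i) (F i) (A i) p • (M.q p.1.1 p.2).incl (h i)‖ₑ ^ 2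
          ∂(M.prodMeasure T) := by
  -- Both squares are expanded into double sums, which agree term by term by the bilinear isometry;
  -- products of elementary indicators are again elementary.
  have hL : ∀ ω, ‖∑ i, M.elemIncr (s i) (t i) (F i) (A i) (h i) ω‖ₑ ^ 2
      = ENNReal.ofReal (∑ i, ∑ j, M.elemIncr (s i) (t i) (F i) (A i) (h i) ω *
        M.elemIncr (s j) (t j) (F j) (A j) (h j) ω) := by
    intro ω
    rw [← Finset.sum_mul_sum, ← pow_two, ← ofReal_norm, ← ENNReal.ofReal_pow (norm_nonneg _),
      Real.norm_eq_abs, sq_abs]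
  have hexp : ∀ p : (Set.Icc (0 : ℝ≥0) T × Ω) × U,
      ‖∑ i, elemInd (s i) (t i) (F i) (A i) p • (M.q p.1.1 p.2).incl (h i)‖ ^ 2
      = ∑ i, ∑ j, elemInd (max (s i) (s j)) (min (t i) (t j)) (F i ∩ F j) (A i ∩ A j) p *
        (M.q p.1.1 p.2).form (h i) (h j) := by
    intro p
    rw [← real_inner_self_eq_norm_sq, sum_inner]
    refine Finset.sum_congr rfl fun i _ => ?_
    rw [inner_sum]
    refine Finset.sum_congr rfl fun j _ => ?_
    rw [real_inner_smul_left, real_inner_smul_right, HilbertianSeminorm.inner_incl, ← mul_assoc,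
      elemInd_mul]
  have hR : ∀ p : (Set.Icc (0 : ℝ≥0) T × Ω) × U,
      ‖∑ i, elemInd (s i) (t i) (F i) (A i) p • (M.q p.1.1 p.2).incl (h i)‖ₑ ^ 2
      = ENNReal.ofReal (∑ i, ∑ j, elemInd (max (s i) (s j)) (min (t i) (t j)) (F i ∩ F j)
        (A i ∩ A j) p * (M.q p.1.1 p.2).form (h i) (h j)) := by
    intro p
    rw [← hexp, ENNReal.ofReal_pow (norm_nonneg _), ofReal_norm]
  simp only [hL, hR]
  have hk : ∀ i j, _ := fun i j => integrable_and_integral_elemInd (T := T)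
    (M.isSetRing_ring.inter_mem (hA i) (hA j)) (s := max (s i) (s j)) (t := min (t i) (t j))
    ((min_le_left _ _).trans (htT i)) ((ℱ.le _ _ (hF i)).inter (ℱ.le _ _ (hF j))) (h i) (h j)
  have hiL : ∀ i j, Integrable (fun ω => M.elemIncr (s i) (t i) (F i) (A i) (h i) ω *
      M.elemIncr (s j) (t j) (F j) (A j) (h j) ω) P := fun i j =>
    (memLp_elemIncr (hA i) _ (hF i) _).integrable_mul (memLp_elemIncr (hA j) _ (hF j) _)
  rw [← ofReal_integral_eq_lintegral_ofReal, ← ofReal_integral_eq_lintegral_ofReal]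
  · congr 1
    rw [integral_finsetSum _ fun i _ => integrable_finsetSum _ fun j _ => hiL i j,
      integral_finsetSum _ fun i _ => integrable_finsetSum _ fun j _ => (hk i j).1]
    refine Finset.sum_congr rfl fun i _ => ?_
    rw [integral_finsetSum _ fun j _ => hiL i j, integral_finsetSum _ fun j _ => (hk i j).1]
    refine Finset.sum_congr rfl fun j _ => ?_
    rw [(hk i j).2, integral_elemIncr_mul (hA i) (hA j) (hst i) (hst j) (hF i) (hF j)]
  · exact integrable_finsetSum _ fun i _ => integrable_finsetSum _ fun j _ => (hk i j).1
  · refine ae_of_all _ fun p => ?_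
    simp only [Pi.zero_apply]
    rw [← hexp]
    positivity
  · exact integrable_finsetSum _ fun i _ => integrable_finsetSum _ fun j _ => hiL i j
  · refine ae_of_all _ fun ω => ?_
    simp only [Pi.zero_apply]
    rw [← Finset.sum_mul_sum]
    exact mul_self_nonneg _

end CylMartMeasure
end

/-! ### Radonification of the increments by Hilbert-Schmidt operators. -/

noncomputable section

section Radonification

variable {Ω : Type*} {mΩ : MeasurableSpace Ω} {ℱ : Filtration ℝ≥0 mΩ} {P : Measure Ω}
  [IsProbabilityMeasure P] {T : ℝ≥0}
  {G : Type*} [NormedAddCommGroup G] [InnerProductSpace ℝ G] [CompleteSpace G]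

theorem MeasureTheory.Martingale.clm_comp {ι F : Type*} [Preorder ι] [NormedAddCommGroup F]
    [NormedSpace ℝ F] [CompleteSpace F] {𝒢 : Filtration ι mΩ} {X : ι → Ω → F}
    (hX : Martingale X 𝒢 P) (L : F →L[ℝ] G) : Martingale (fun t ω => L (X t ω)) 𝒢 P := by
  refine ⟨fun t => L.continuous.comp_stronglyMeasurable (hX.1 t), fun s t hst => ?_⟩
  refine (L.comp_condExp_comm (hX.integrable t)).symm.trans ?_
  filter_upwards [hX.2 s t hst] with ω hω
  rw [Function.comp_apply, hω]

/-- The process `y k`, where `y` is a real martingale and `k : G`. -/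
def MartingaleProcess.smulRight (y : MartingaleProcess ℱ P T ℝ) (k : G) :
    MartingaleProcess ℱ P T G :=
  ⟨fun t ω => y.process t ω • k,
    y.process_mem.1.clm_comp (ContinuousLinearMap.toSpanSingleton ℝ k),
    fun ω t => ⟨(y.process_mem.2.1 ω t).1.smul_const k, by
      obtain ⟨l, hl⟩ := (y.process_mem.2.1 ω t).2
      exact ⟨l • k, hl.smul_const k⟩⟩, by
    have h : ∀ ω, supENorm (fun t ω => y.process t ω • k) ω
        = supENorm y.process ω * ‖k‖ₑ := by
      intro ω
      simp only [supENorm, enorm_smul, ENNReal.iSup_mul]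
    simp only [mENorm, h, ENNReal.mul_rpow_of_nonneg _ _ zero_le_two]
    rw [lintegral_mul_const' _ _ (by finiteness), ENNReal.mul_rpow_of_nonneg _ _ (by norm_num)]
    exact ENNReal.mul_lt_top y.process_mem.2.2 (by finiteness)⟩

namespace CylMartMeasure

variable {H : Type*} [NormedAddCommGroup H] [InnerProductSpace ℝ H] [CompleteSpace H]
  {U : Type*} [TopologicalSpace U] [MeasurableSpace U]
  {M : CylMartMeasure ℱ P H U} {A : Set U}

theorem incr_smul (s t : ℝ≥0) (A : Set U) (c : ℝ) (h : H) :
    M.incr s t A (c • h) =ᵐ[P] fun ω => c * M.incr s t A h ω := by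
  filter_upwards [AEEqFun.coeFn_smul c (M.toFun t A h), AEEqFun.coeFn_smul c (M.toFun s A h)]
    with ω h1 h2
  simp only [incr, map_smul, h1, h2, Pi.smul_apply, smul_eq_mul]
  ring

theorem incr_sub (s t : ℝ≥0) (A : Set U) (h k : H) :
    M.incr s t A (h - k) =ᵐ[P] fun ω => M.incr s t A h ω - M.incr s t A k ω := by
  filter_upwards [AEEqFun.coeFn_sub (M.toFun t A h) (M.toFun t A k),
    AEEqFun.coeFn_sub (M.toFun s A h) (M.toFun s A k)] with ω h1 h2
  simp only [incr, map_sub, h1, h2, Pi.sub_apply]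
  ring

theorem incr_sum (s t : ℝ≥0) (A : Set U) {ι : Type*} (F : Finset ι) (c : ι → ℝ) (h : ι → H) :
    M.incr s t A (∑ i ∈ F, c i • h i) =ᵐ[P] fun ω => ∑ i ∈ F, c i * M.incr s t A (h i) ω := by
  classical
  induction F using Finset.induction_on with
  | empty =>
    filter_upwards [AEEqFun.coeFn_zero (α := Ω) (β := ℝ) (μ := P)] with ω h1
    simp [incr, h1]
  | insert a F ha ih =>
    simp only [Finset.sum_insert ha]
    filter_upwards [ih, incr_add s t A (c a • h a) (∑ i ∈ F, c i • h i),
      incr_smul s t A (c a) (h a)] with ω h1 h2 h3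
    rw [h2, h1, h3]

/-- A difference of two martingales stopped at deterministic times. -/
theorem martingale_incr (hA : A ∈ M.ring) (s t : ℝ≥0) (h : H) :
    Martingale (fun (r : Set.Icc (0 : ℝ≥0) T) => M.incr (min s r) (min t r) A h)
      (filtrationIcc ℱ T) P := by
  have key : ∀ t : ℝ≥0, Martingale (fun (r : Set.Icc (0 : ℝ≥0) T) ω => M.toFun (min t r) A h ω)
      (filtrationIcc ℱ T) P := by
    intro t
    have hM := M.martingale A hA h
    refine ⟨fun r => (hM.1 (min t r)).mono (ℱ.mono (min_le_right _ _)), fun r r' hr => ?_⟩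
    have hr' : (r : ℝ≥0) ≤ r' := hr
    change P[fun ω => M.toFun (min t r') A h ω|ℱ r] =ᵐ[P] fun ω => M.toFun (min t r) A h ω
    rcases le_total t r with htr | htr
    · rw [min_eq_left htr, min_eq_left (htr.trans hr')]
      exact (condExp_of_stronglyMeasurable (ℱ.le _) ((hM.1 t).mono (ℱ.mono htr))
        (hM.integrable t)).eventuallyEq
    · rw [min_eq_right htr]
      exact hM.2 r (min t r') (le_min htr hr')
  exact (key t).sub (key s)

variable [BorelSpace U]

theorem eLpNorm_incr_le {C : ℝ} (hC0 : 0 ≤ C)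
    (hC : ∀ r ≤ T, ∀ u h, (M.q r u).val h ≤ C * ‖h‖) (hA : A ∈ M.ring) {a b : ℝ≥0} (hab : a ≤ b)
    (hb : b ≤ T) (h : H) : eLpNorm (M.incr a b A h) 2 P
      ≤ ENNReal.ofReal C * (M.lam (Set.Ioc a b) * M.mu A) ^ (1 / 2 : ℝ) * ‖h‖ₑ := by
  rcases hab.eq_or_lt with rfl | hab
  · have h0 : M.incr a a A h = 0 := by ext ω; simp [incr]
    simp [h0]
  have hfin : M.lam.prod M.mu (Set.Ioc a b ×ˢ A) = M.lam (Set.Ioc a b) * M.mu A :=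
    Measure.prod_prod _ _
  have hlt : M.lam (Set.Ioc a b) * M.mu A < ∞ :=
    ENNReal.mul_lt_top (M.lam_Ioc_lt_top a b) (M.mu_lt_top A hA)
  have h1 : ∫⁻ ω, ‖M.incr a b A h ω‖ₑ ^ 2 ∂P
      ≤ (ENNReal.ofReal C * ‖h‖ₑ) ^ 2 * (M.lam (Set.Ioc a b) * M.mu A) := by
    have h2 : ∀ ω, ‖M.incr a b A h ω‖ₑ ^ 2 = ENNReal.ofReal (M.incr a b A h ω ^ 2) := by
      intro ω
      rw [← ofReal_norm, ← ENNReal.ofReal_pow (norm_nonneg _), Real.norm_eq_abs, sq_abs]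
    simp only [h2]
    rw [← ofReal_integral_eq_lintegral_ofReal (memLp_incr hA a b h).integrable_sq
      (ae_of_all _ fun ω => sq_nonneg _), integral_incr_sq hA hab]
    have h3 : M.formIntegral a b A h h ≤ (C * ‖h‖) ^ 2 * (M.lam.prod M.mu).real (Set.Ioc a b ×ˢ A) := by
      refine (Real.le_norm_self _).trans (norm_setIntegral_le_of_norm_le_const (by rwa [hfin])
        fun p hp => ?_)
      rw [Real.norm_of_nonneg ((M.q p.1 p.2).nonneg h), ← Real.sq_sqrt ((M.q p.1 p.2).nonneg h)]
      exact pow_le_pow_left₀ (Real.sqrt_nonneg _) (hC _ (hp.1.2.trans hb) _ h) 2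
    refine (ENNReal.ofReal_le_ofReal h3).trans_eq ?_
    rw [ENNReal.ofReal_mul (by positivity), ENNReal.ofReal_pow (by positivity),
      ENNReal.ofReal_mul hC0, ofReal_norm, Measure.real, ENNReal.ofReal_toReal (by
        rw [hfin]; exact hlt.ne), hfin]
  rw [eLpNorm_two_eq]
  refine (ENNReal.rpow_le_rpow h1 (by norm_num)).trans_eq ?_
  rw [ENNReal.mul_rpow_of_nonneg _ _ (by norm_num), ← ENNReal.rpow_natCast, ← ENNReal.rpow_mul]
  norm_num
  ring

/-- The intervals `(r, r']` have finite measure and decrease to the empty set; an atom of `λ` at `r`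
is excluded by the half-open form. -/
theorem tendsto_lam_Ioc (M : CylMartMeasure ℱ P H U) (r : ℝ≥0) :
    Tendsto (fun r' => M.lam (Set.Ioc r r')) (𝓝[>] r) (𝓝 0) := by
  have h := tendsto_measure_biInter_gt (μ := M.lam) (s := fun r' => Set.Ioc r r') (a := r)
    (fun _ _ => measurableSet_Ioc.nullMeasurableSet) (fun i j _ hij => Set.Ioc_subset_Ioc_right hij)
    ⟨r + 1, lt_add_of_pos_right r one_pos, (M.lam_Ioc_lt_top _ _).ne⟩
  have h0 : ⋂ r' > r, Set.Ioc r r' = ∅ := by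
    refine Set.eq_empty_of_forall_notMem fun x hx => ?_
    simp only [Set.mem_iInter] at hx
    have h1 := hx (r + 1) (lt_add_of_pos_right r one_pos)
    obtain ⟨y, hy1, hy2⟩ := exists_between h1.1
    exact absurd (hx y hy1).2 (not_le.2 hy2)
  rw [h0, measure_empty] at h
  exact h

/-- The `L²` distance between times `r < r'` is controlled by `λ((r, r'])`, which gives the right
continuity needed for a càdlàg modification. -/
theorem exists_process_incr (hT : 0 < T) (hnull : ∀ N : Set Ω, P N = 0 → MeasurableSet[ℱ 0] N)
    (hA : A ∈ M.ring) (s t : ℝ≥0) (h : H) :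
    ∃ y : MartingaleProcess ℱ P T ℝ, ∀ r, y.process r =ᵐ[P] M.incr (min s r) (min t r) A h := by
  refine MartingaleProcess.exists_modification hT hnull (martingale_incr hA s t h)
    (fun r => memLp_incr hA _ _ h) fun r => ?_
  obtain ⟨C, hC0, hC⟩ := M.exists_val_le T
  have hle : ∀ r' : Set.Icc (0 : ℝ≥0) T, r < r' →
      eLpNorm (M.incr (min s r') (min t r') A h - M.incr (min s r) (min t r) A h) 2 P
        ≤ 2 * (ENNReal.ofReal C * (M.lam (Set.Ioc (r : ℝ≥0) r') * M.mu A) ^ (1 / 2 : ℝ) * ‖h‖ₑ) := by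
    intro r' hr
    have hr' : (r : ℝ≥0) ≤ r' := hr.le
    have h1 : M.incr (min s r') (min t r') A h - M.incr (min s r) (min t r) A h
        = M.incr (min t r) (min t r') A h - M.incr (min s r) (min s r') A h := by
      ext ω; simp only [incr, Pi.sub_apply]; ring
    have h2 : ∀ t : ℝ≥0, eLpNorm (M.incr (min t r) (min t r') A h) 2 P
        ≤ ENNReal.ofReal C * (M.lam (Set.Ioc (r : ℝ≥0) r') * M.mu A) ^ (1 / 2 : ℝ) * ‖h‖ₑ := by
      intro t
      refine (eLpNorm_incr_le hC0 hC hA (min_le_min_left t hr') ((min_le_right _ _).trans r'.2.2)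
        h).trans ?_
      gcongr ENNReal.ofReal C * (?_ * _) ^ _ * _
      refine measure_mono fun x hx => ?_
      rcases le_total t r with htr | htr
      · rw [min_eq_left htr, min_eq_left (htr.trans hr')] at hx
        exact absurd hx (by simp)
      · rw [min_eq_right htr] at hx
        exact ⟨hx.1, hx.2.trans (min_le_right _ _)⟩
    rw [h1, two_mul]
    exact (eLpNorm_sub_le (memLp_incr hA _ _ h).1 (memLp_incr hA _ _ h).1 one_le_two).trans
      (add_le_add (h2 t) (h2 s))
  have hval : Tendsto (Subtype.val : Set.Icc (0 : ℝ≥0) T → ℝ≥0) (𝓝[>] r) (𝓝[>] (r : ℝ≥0)) :=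
    tendsto_nhdsWithin_iff.2 ⟨continuous_subtype_val.continuousWithinAt,
      eventually_nhdsWithin_of_forall fun _ hx => hx⟩
  have hlim : Tendsto (fun r' : Set.Icc (0 : ℝ≥0) T => 2 * (ENNReal.ofReal C *
      (M.lam (Set.Ioc (r : ℝ≥0) r') * M.mu A) ^ (1 / 2 : ℝ) * ‖h‖ₑ)) (𝓝[>] r) (𝓝 0) := by
    have h1 := ENNReal.Tendsto.mul_const ((M.tendsto_lam_Ioc r).comp hval)
      (b := M.mu A) (Or.inr (M.mu_lt_top A hA).ne)
    have h2 := (ENNReal.continuous_rpow_const (y := 1 / 2)).tendsto _ |>.comp h1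
    have h3 := ENNReal.Tendsto.const_mul (ENNReal.Tendsto.mul_const (ENNReal.Tendsto.const_mul h2
      (a := ENNReal.ofReal C) (Or.inr ENNReal.ofReal_ne_top)) (b := ‖h‖ₑ)
      (Or.inr enorm_ne_top)) (a := 2) (Or.inr ENNReal.ofNat_ne_top)
    simpa [Function.comp_def] using h3
  exact tendsto_of_tendsto_of_tendsto_of_le_of_le' tendsto_const_nhds hlim
    (Eventually.of_forall fun _ => zero_le) (eventually_nhdsWithin_of_forall hle)

variable [TopologicalSpace.SeparableSpace G]

theorem exists_eLpNorm_incr_min_le (M : CylMartMeasure ℱ P H U) (hA : A ∈ M.ring) {s t : ℝ≥0}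
    (hst : s ≤ t) : ∃ K : ℝ≥0∞, K < ∞ ∧ ∀ (r : Set.Icc (0 : ℝ≥0) T) h,
      eLpNorm (M.incr (min s r) (min t r) A h) 2 P ≤ K * ‖h‖ₑ := by
  obtain ⟨C, hC0, hC⟩ := M.exists_val_le T
  refine ⟨ENNReal.ofReal C * (M.lam (Set.Ioc 0 T) * M.mu A) ^ (1 / 2 : ℝ),
    ENNReal.mul_lt_top ENNReal.ofReal_lt_top (ENNReal.rpow_lt_top_of_nonneg (by norm_num)
      (ENNReal.mul_lt_top (M.lam_Ioc_lt_top 0 T) (M.mu_lt_top A hA)).ne), fun r h => ?_⟩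
  refine (eLpNorm_incr_le hC0 hC hA (min_le_min_right _ hst) ((min_le_right _ _).trans r.2.2)
    h).trans ?_
  gcongr ENNReal.ofReal C * (?_ * _) ^ _ * _
  exact measure_mono (Set.Ioc_subset_Ioc zero_le ((min_le_right _ _).trans r.2.2))

theorem mk_sum (F : Finset (hsIndex G)) (x : hsIndex G → MartingaleProcess ℱ P T G) :
    (∑ j ∈ F, SeparationQuotient.mk (x j) : MartingaleSpace ℱ P T G)
      = SeparationQuotient.mk (∑ j ∈ F, x j) :=
  (map_sum (SeparationQuotient.mkCLM ℝ (MartingaleProcess ℱ P T G)) x F).symm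

theorem sum_smulRight_apply (y : hsIndex G → MartingaleProcess ℱ P T ℝ) (b : hsIndex G → G)
    (F : Finset (hsIndex G)) (r : Set.Icc (0 : ℝ≥0) T) (ω : Ω) :
    (∑ j ∈ F, (y j).smulRight (b j)).process r ω = ∑ j ∈ F, (y j).process r ω • b j := by
  rw [map_sum, Finset.sum_apply, Finset.sum_apply]
  rfl

/-- Orthonormality of the `b j` and Doob's inequality at `T` give `‖∑_F y_j b_j‖² ≤ 4K² ∑_F ‖S*
b_j‖²`; the 4 is the square of Doob's constant. As `S` is Hilbert-Schmidt, the right side is a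
convergent series, so the sums satisfy the Cauchy criterion. -/
theorem summable_smulRight (hT : 0 < T)
    (hnull : ∀ N : Set Ω, P N = 0 → MeasurableSet[ℱ 0] N)
    (hA : A ∈ M.ring) {s t : ℝ≥0} (hst : s ≤ t) (S : HilbertSchmidt H G)
    {y : hsIndex G → MartingaleProcess ℱ P T ℝ} (hy : ∀ j r, (y j).process r =ᵐ[P]
      M.incr (min s r) (min t r) A (ContinuousLinearMap.adjoint S.toCLM (hsBasis G j))) :
    Summable fun j => (SeparationQuotient.mk ((y j).smulRight (hsBasis G j)) :
      MartingaleSpace ℱ P T G) := by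
  have := MartingaleSpace.completeSpace (P := P) (G := G) hT hnull
  set b := hsBasis G with hb
  set k : hsIndex G → H := fun j => ContinuousLinearMap.adjoint S.toCLM (b j) with hk
  set x : hsIndex G → MartingaleProcess ℱ P T G := fun j => (y j).smulRight (b j) with hxdef
  obtain ⟨K, hK, hle⟩ := exists_eLpNorm_incr_min_le (T := T) M hA hst
  have hS : ∑' j, ‖k j‖ₑ ^ 2 ≠ ∞ := by
    rw [← S.enorm_sq_adjoint b]
    finiteness
  have hbound : ∀ F : Finset (hsIndex G), ‖∑ j ∈ F, x j‖ₑ ^ 2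
      ≤ 4 * K ^ 2 * ∑ j ∈ F, ‖k j‖ₑ ^ 2 := by
    intro F
    have h1 : ∀ ω, ‖(∑ j ∈ F, x j).process (lastTime T) ω‖ₑ ^ 2
        = ∑ j ∈ F, ‖(y j).process (lastTime T) ω‖ₑ ^ 2 := by
      intro ω
      rw [sum_smulRight_apply, ← ofReal_norm, ← ENNReal.ofReal_pow (norm_nonneg _), ← real_inner_self_eq_norm_sq,
        b.orthonormal.inner_sum, ENNReal.ofReal_sum_of_nonneg fun j _ => by
          simpa using mul_self_nonneg _]
      refine Finset.sum_congr rfl fun j _ => ?_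
      rw [← ofReal_norm, ← ENNReal.ofReal_pow (norm_nonneg _), Real.norm_eq_abs, sq_abs]
      simp [pow_two]
    calc ‖∑ j ∈ F, x j‖ₑ ^ 2
        ≤ (2 * eLpNorm ((∑ j ∈ F, x j).process (lastTime T)) 2 P) ^ 2 := by
          gcongr
          exact MartingaleProcess.enorm_le hT _
      _ = 4 * ∑ j ∈ F, eLpNorm ((y j).process (lastTime T)) 2 P ^ 2 := by
          rw [mul_pow, eLpNorm_two_sq]
          simp only [h1, eLpNorm_two_sq]
          rw [lintegral_finsetSum _ fun j _ =>
            ((y j).stronglyMeasurable (lastTime T)).enorm.pow_const 2]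
          norm_num
      _ ≤ 4 * ∑ j ∈ F, (K * ‖k j‖ₑ) ^ 2 := by
          gcongr with j _
          rw [eLpNorm_congr_ae (hy j (lastTime T))]
          exact hle _ _
      _ = _ := by simp only [mul_pow, ← Finset.mul_sum, mul_assoc]
  rw [summable_iff_vanishing_norm]
  intro ε hε
  have h4 : 4 * K ^ 2 * ∑' j, ‖k j‖ₑ ^ 2 ≠ ∞ := by finiteness
  rw [← ENNReal.tsum_mul_left] at h4
  have h5 := ENNReal.tendsto_tsum_compl_atTop_zero h4
  have h6 : (0 : ℝ≥0∞) < ENNReal.ofReal ε ^ 2 := by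
    have := ENNReal.ofReal_pos.2 hε
    positivity
  obtain ⟨F₀, hF₀⟩ := (h5.eventually_lt_const h6).exists
  refine ⟨F₀, fun F hF => ?_⟩
  have h7 : ‖∑ j ∈ F, x j‖ₑ ^ 2 < ENNReal.ofReal ε ^ 2 := by
    refine (hbound F).trans_lt (lt_of_le_of_lt ?_ hF₀)
    rw [Finset.mul_sum, ← Finset.tsum_subtype F]
    exact ENNReal.tsum_mono_subtype (fun j => 4 * K ^ 2 * ‖k j‖ₑ ^ 2) (s := {j | j ∈ F})
      (t := {j | j ∉ F₀}) fun j hj hj' => Finset.disjoint_left.1 hF hj hj'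
  rw [ENNReal.pow_lt_pow_left_iff two_ne_zero] at h7
  rw [mk_sum, SeparationQuotient.norm_mk]
  rw [← ofReal_norm] at h7
  exact (ENNReal.ofReal_lt_ofReal_iff hε).1 h7

/-- For a finite `F`, pairing the partial sum with `g` gives the increment at `S*` of the projection
of `g`. The error consists of the tail of the series for `Y` and of `S*` applied to the tail of `g`;
both tend to zero along `F`. -/
theorem isRadonification_of_hasSum
    (hA : A ∈ M.ring) {s t : ℝ≥0} (hst : s ≤ t) (S : HilbertSchmidt H G)
    {y : hsIndex G → MartingaleProcess ℱ P T ℝ} (hy : ∀ j r, (y j).process r =ᵐ[P]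
      M.incr (min s r) (min t r) A (ContinuousLinearMap.adjoint S.toCLM (hsBasis G j))) {Y : MartingaleSpace ℱ P T G}
    (hY : HasSum (fun j => (SeparationQuotient.mk ((y j).smulRight (hsBasis G j)) :
      MartingaleSpace ℱ P T G)) Y) : M.IsRadonification s t A S Y := by
  set b := hsBasis G with hb
  set k : hsIndex G → H := fun j => ContinuousLinearMap.adjoint S.toCLM (b j) with hk
  set x : hsIndex G → MartingaleProcess ℱ P T G := fun j => (y j).smulRight (b j) with hxdef
  obtain ⟨K, hK, hle⟩ := exists_eLpNorm_incr_min_le (T := T) M hA hst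
  intro r g
  set v := M.incr (min s r) (min t r) A (ContinuousLinearMap.adjoint S.toCLM g) with hv
  have hf2 : ∀ X : MartingaleSpace ℱ P T G, MemLp (fun ω => (inner ℝ (X.path r ω) g : ℝ)) 2 P :=
    fun X => ((MartingaleSpace.memLp_path X r).inner_const g)
  have h1 : ∀ F : Finset (hsIndex G), eLpNorm (fun ω => (inner ℝ (Y.path r ω) g : ℝ) - v ω) 2 P
      ≤ ‖Y - ∑ j ∈ F, SeparationQuotient.mk (x j)‖ₑ * ‖g‖ₑ + K * ‖ContinuousLinearMap.adjoint S.toCLM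
        (∑ j ∈ F, b.repr g j • b j - g)‖ₑ := by
    intro F
    set X : MartingaleSpace ℱ P T G := ∑ j ∈ F, SeparationQuotient.mk (x j) with hX
    have e1 : ∀ᵐ ω ∂P, (inner ℝ (Y.path r ω) g : ℝ) - v ω
        = inner ℝ ((Y - X).path r ω) g + M.incr (min s r) (min t r) A
          (ContinuousLinearMap.adjoint S.toCLM (∑ j ∈ F, b.repr g j • b j - g)) ω := by
      have e2 := MartingaleSpace.path_mk (∑ j ∈ F, x j)
      rw [← mk_sum, ← hX] at e2
      have e3 := incr_sum (M := M) (min s r) (min t r) A F (fun j => b.repr g j) k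
      have e4 := incr_sub (M := M) (min s r) (min t r) A (∑ j ∈ F, b.repr g j • k j)
        (ContinuousLinearMap.adjoint S.toCLM g)
      have e5 : ∀ᵐ ω ∂P, ∀ j ∈ F, (y j).process r ω = M.incr (min s r) (min t r) A (k j) ω :=
        (Finset.eventually_all F).2 fun j _ => hy j r
      filter_upwards [e2, e3, e4, e5, MartingaleSpace.path_sub Y X] with ω d2 d3 d4 d5 d6
      have d7 : ContinuousLinearMap.adjoint S.toCLM (∑ j ∈ F, b.repr g j • b j - g)
          = ∑ j ∈ F, b.repr g j • k j - ContinuousLinearMap.adjoint S.toCLM g := by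
        simp only [map_sub, map_sum, map_smul, hk]
      rw [d7, d4, d3, d6, d2, sum_smulRight_apply, inner_sub_left, sum_inner]
      have d8 : ∑ j ∈ F, (inner ℝ ((y j).process r ω • b j) g : ℝ)
          = ∑ j ∈ F, b.repr g j * M.incr (min s r) (min t r) A (k j) ω := by
        refine Finset.sum_congr rfl fun j hj => ?_
        rw [real_inner_smul_left, d5 j hj, b.repr_apply_apply, mul_comm]
      rw [d8]
      ring
    rw [eLpNorm_congr_ae e1]
    refine (eLpNorm_add_le (hf2 (Y - X)).1 (memLp_incr hA _ _ _).1 one_le_two).trans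
      (add_le_add ?_ (hle r _))
    refine (eLpNorm_le_mul_eLpNorm_of_ae_le_mul (g := (Y - X).path r) (c := ‖g‖)
      (ae_of_all _ fun ω => ?_) 2).trans ?_
    · rw [mul_comm]
      exact norm_inner_le_norm _ _
    · rw [ofReal_norm, mul_comm]
      gcongr
      exact MartingaleSpace.eLpNorm_path_le _ r
  have h2 : Tendsto (fun F : Finset (hsIndex G) =>
      ‖Y - ∑ j ∈ F, SeparationQuotient.mk (x j)‖ₑ * ‖g‖ₑ + K * ‖ContinuousLinearMap.adjoint S.toCLM
        (∑ j ∈ F, b.repr g j • b j - g)‖ₑ) atTop (𝓝 0) := by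
    have h3 := ((tendsto_const_nhds (x := Y)).sub hY).enorm
    have h4 := ((ContinuousLinearMap.adjoint S.toCLM).continuous.tendsto _).comp
      (Tendsto.sub (b.hasSum_repr g) (tendsto_const_nhds (x := g))) |>.enorm
    have h5 := (ENNReal.Tendsto.mul_const h3 (b := ‖g‖ₑ) (Or.inr enorm_ne_top)).add
      (ENNReal.Tendsto.const_mul h4 (a := K) (Or.inr hK.ne))
    simpa [Function.comp_def] using h5
  have h6 : eLpNorm ((fun ω => (inner ℝ (Y.path r ω) g : ℝ)) - v) 2 P = 0 :=
    le_antisymm (ge_of_tendsto' h2 h1) zero_le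
  rw [eLpNorm_eq_zero_iff ((hf2 Y).1.sub (memLp_incr hA _ _ _).1) two_ne_zero] at h6
  filter_upwards [h6] with ω hω
  exact sub_eq_zero.1 hω

theorem exists_isRadonification (hT : 0 < T)
    (hnull : ∀ N : Set Ω, P N = 0 → MeasurableSet[ℱ 0] N)
    (hA : A ∈ M.ring) {s t : ℝ≥0} (hst : s ≤ t) (S : HilbertSchmidt H G) :
    ∃ Y : MartingaleSpace ℱ P T G, M.IsRadonification s t A S Y := by
  choose y hy using fun j => exists_process_incr hT hnull hA s t
    (ContinuousLinearMap.adjoint S.toCLM (hsBasis G j))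
  obtain ⟨Y, hY⟩ := summable_smulRight hT hnull hA hst S hy
  exact ⟨Y, isRadonification_of_hasSum hA hst S hy hY⟩

/-- If `Z` vanishes up to time `s` and `F ∈ ℱ_s`, then `1_F Z` is a martingale. -/
theorem _root_.MartingaleProcess.exists_indicator
    (hnull : ∀ N : Set Ω, P N = 0 → MeasurableSet[ℱ 0] N)
    (Z : MartingaleProcess ℱ P T G) {s : Set.Icc (0 : ℝ≥0) T} (h0 : ∀ r ≤ s, Z.process r =ᵐ[P] 0)
    {F : Set Ω} (hF : MeasurableSet[ℱ s] F) :
    ∃ X : MartingaleProcess ℱ P T G, ∀ r ω, X.process r ω = F.indicator (Z.process r) ω := by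
  have hFm : MeasurableSet F := ℱ.le _ _ hF
  have hi0 : ∀ r ≤ s, F.indicator (Z.process r) =ᵐ[P] 0 := fun r hr => by
    filter_upwards [h0 r hr] with ω hω
    by_cases hF : ω ∈ F <;> simp [hF, hω]
  have hM : Martingale (fun r => F.indicator (Z.process r)) (filtrationIcc ℱ T) P := by
    refine ⟨fun r => ?_, fun r r' hr => ?_⟩
    · rcases le_total r s with hrs | hrs
      · exact stronglyMeasurable_of_ae_eq (fun N hN => ℱ.mono zero_le _ (hnull N hN))
          stronglyMeasurable_zero (hi0 r hrs)
      · exact (Z.process_mem.1.1 r).indicator (ℱ.mono (show (s : ℝ≥0) ≤ r from hrs) _ hF)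
    · rcases le_total s r with hrs | hrs
      · refine (condExp_indicator (Z.process_mem.1.integrable r')
          (ℱ.mono (show (s : ℝ≥0) ≤ r from hrs) _ hF)).trans ?_
        exact (Z.process_mem.1.2 r r' hr).indicator
      · refine EventuallyEq.trans ?_ (hi0 r hrs).symm
        rcases le_total r' s with hrs' | hrs'
        · refine (condExp_congr_ae (hi0 r' hrs')).trans ?_
          rw [condExp_zero]
        -- For `r ≤ s ≤ r'` condition first on `ℱ_s`, which contains `F`; there the result is almost
        -- surely zero, and the tower property finishes.
        · have h1 : P[F.indicator (Z.process r')|filtrationIcc ℱ T s] =ᵐ[P] 0 :=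
            ((condExp_indicator (Z.process_mem.1.integrable r') hF).trans
              (Z.process_mem.1.2 s r' hrs').indicator).trans (hi0 s le_rfl)
          refine (condExp_condExp_of_le ((filtrationIcc ℱ T).mono hrs)
            ((filtrationIcc ℱ T).le s)).symm.trans ((condExp_congr_ae h1).trans ?_)
          rw [condExp_zero]
  refine ⟨⟨fun r => F.indicator (Z.process r), hM, fun ω => ?_, ?_⟩, fun r ω => rfl⟩
  · by_cases hω : ω ∈ F
    · simpa only [Set.indicator_of_mem hω] using Z.process_mem.2.1 ω
    · simp only [Set.indicator_of_notMem hω]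
      exact fun t => ⟨continuousWithinAt_const, 0, tendsto_const_nhds⟩
  · refine lt_of_le_of_lt ?_ Z.process_mem.2.2
    unfold mENorm
    gcongr with ω
    exact iSup_mono fun t => enorm_indicator_le_enorm_self _ _

/-- The increment over `(s ∧ r, t ∧ r]` is zero for `r ≤ s`, so `Y` vanishes up to `s` and
multiplication by `1_F` keeps it a martingale. -/
theorem exists_indicator_radonification
    (hnull : ∀ N : Set Ω, P N = 0 → MeasurableSet[ℱ 0] N)
    {s t : ℝ≥0} (hst : s ≤ t) (htT : t ≤ T) {S : HilbertSchmidt H G}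
    {Y : MartingaleSpace ℱ P T G} (hY : M.IsRadonification s t A S Y) {F : Set Ω}
    (hF : MeasurableSet[ℱ s] F) : ∃ X : MartingaleSpace ℱ P T G,
      ∀ᵐ ω ∂P, ∀ r, X.path r ω = (F.indicator 1 ω : ℝ) • Y.path r ω := by
  have : SecondCountableTopology G := UniformSpace.secondCountable_of_separable G
  have h0 : ∀ r ≤ (⟨s, zero_le, hst.trans htT⟩ : Set.Icc (0 : ℝ≥0) T),
      Y.rep.process r =ᵐ[P] 0 := by
    refine fun r hr => ae_eq_zero_of_forall_inner (𝕜 := ℝ) fun g => ?_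
    have hr' : (r : ℝ≥0) ≤ s := hr
    have h1 := hY r g
    rw [min_eq_right hr', min_eq_right (hr'.trans hst)] at h1
    filter_upwards [h1] with ω hω
    rw [real_inner_comm, MartingaleSpace.process_rep, hω, sub_self, Pi.zero_apply]
  obtain ⟨X, hX⟩ := Y.rep.exists_indicator hnull h0 hF
  refine ⟨SeparationQuotient.mk X, ?_⟩
  filter_upwards [MartingaleSpace.path_mk X] with ω hω r
  rw [hω, hX, MartingaleSpace.process_rep]
  by_cases h : ω ∈ F <;> simp [h]

end CylMartMeasure

end Radonification
end

/-! ### Simple integrands: isometry, uniqueness and continuity of the extension. -/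

noncomputable section

theorem measurable_enorm_adjoint_sq {X H G : Type*} [MeasurableSpace X] [NormedAddCommGroup H]
    [InnerProductSpace ℝ H] [NormedAddCommGroup G] [InnerProductSpace ℝ G] [CompleteSpace G]
    [TopologicalSpace.SeparableSpace H] {q : X → HilbertianSeminorm H}
    (hq : IsMeasurableSeminorm q) {Φ : ∀ x, HilbertSchmidt (q x).Space G}
    (hΦ : IsMeasurableOperatorField Φ) (g : G) :
    Measurable fun x => ‖ContinuousLinearMap.adjoint (Φ x).toCLM g‖ₑ ^ 2 := by
  have h : ∀ x, ‖ContinuousLinearMap.adjoint (Φ x).toCLM g‖ₑ ^ 2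
      = ∑' n, ‖(inner ℝ g ((Φ x).toCLM ((q x).orthoSeq n)) : ℝ)‖ₑ ^ 2 := by
    intro x
    rw [(q x).isParsevalSeq_orthoSeq.enorm_sq_eq]
    exact tsum_congr fun n => by rw [ContinuousLinearMap.adjoint_inner_right, real_inner_comm]
  simp only [h]
  exact Measurable.tsum fun n =>
    ((IsGeneratedField.orthoSeq hq n).measurable_apply hΦ g).enorm.pow_const 2

namespace CylMartMeasure

variable {Ω : Type*} {mΩ : MeasurableSpace Ω} {ℱ : Filtration ℝ≥0 mΩ} {P : Measure Ω}
  [IsProbabilityMeasure P] {T : ℝ≥0}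
  {G : Type*} [NormedAddCommGroup G] [InnerProductSpace ℝ G] [CompleteSpace G]
  {H : Type*} [NormedAddCommGroup H] [InnerProductSpace ℝ H] [CompleteSpace H]
  {U : Type*} [TopologicalSpace U] [MeasurableSpace U]
  {M : CylMartMeasure ℱ P H U}

/-- Simple integrands and their integrals, written as sums over one index. -/
def IsElementary (M : CylMartMeasure ℱ P H U) (Ψ : M.Integrand T G) (X : MartingaleSpace ℱ P T G) :
    Prop :=
  ∃ (ι : Type) (_ : Fintype ι) (s t : ι → ℝ≥0) (F : ι → Set Ω) (A : ι → Set U)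
    (S : ι → HilbertSchmidt H G) (Y : ι → MartingaleSpace ℱ P T G),
    (∀ i, s i < t i ∧ t i ≤ T ∧ MeasurableSet[ℱ (s i)] (F i)) ∧ (∀ i, A i ∈ M.ring) ∧
    (∀ r ω u, (Ψ r ω u).toCLM = ∑ i, elemInd (s i) (t i) (F i) (A i) ((r, ω), u) •
        ((S i).toCLM ∘L ContinuousLinearMap.adjoint (M.q r u).incl)) ∧
    (∀ i, M.IsRadonification (s i) (t i) (A i) (S i) (Y i)) ∧
    ∀ᵐ ω ∂P, ∀ r, X.path r ω = ∑ i, ((F i).indicator 1 ω : ℝ) • (Y i).path r ω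

theorem isRadonification_zero (s t : ℝ≥0) (A : Set U) :
    M.IsRadonification s t A 0 (0 : MartingaleSpace ℱ P T G) := by
  intro r g
  filter_upwards [MartingaleSpace.path_zero (P := P) (ℱ := ℱ) (T := T) (G := G),
    AEEqFun.coeFn_zero (α := Ω) (β := ℝ) (μ := P)] with ω h1 h2
  simp [h1, h2]

theorem IsRadonification.smul {s t : ℝ≥0} {A : Set U} {S : HilbertSchmidt H G}
    {Y : MartingaleSpace ℱ P T G} (h : M.IsRadonification s t A S Y) (c : ℝ) :
    M.IsRadonification s t A (c • S) (c • Y) := by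
  intro r g
  have h1 := incr_smul (M := M) (min s r) (min t r) A c (ContinuousLinearMap.adjoint S.toCLM g)
  filter_upwards [MartingaleSpace.path_smul c Y, h r g, h1] with ω e1 e2 e3
  simp only [incr] at e3
  rw [e1, real_inner_smul_left, e2, map_smul, map_smulₛₗ, conj_trivial, smul_apply, e3]

/-- A single sum is placed on the diagonal of a double sum, with zero operators and zero martingales
off the diagonal. -/
theorem IsElementary.isSimpleIntegral {Ψ : M.Integrand T G} {X : MartingaleSpace ℱ P T G}
    (h : M.IsElementary Ψ X) : M.IsSimpleIntegral Ψ X := by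
  classical
  obtain ⟨ι, hι, s, t, F, A, S, Y, h1, h2, h3, h4, h5⟩ := h
  let e := (Fintype.equivFin ι).symm
  refine ⟨Fintype.card ι, Fintype.card ι, s ∘ e, t ∘ e, F ∘ e, A ∘ e,
    fun i j => if i = j then S (e i) else 0, fun i j => if i = j then Y (e i) else 0,
    fun i => h1 (e i), fun j => h2 (e j), fun r ω u => ?_, fun i j => ?_, ?_⟩
  · rw [h3, ← e.sum_comp]
    refine Finset.sum_congr rfl fun i _ => ?_
    rw [Finset.sum_eq_single i (fun j _ hj => by simp [hj.symm]) (fun hi => absurd (Finset.mem_univ i) hi)]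
    simp [elemInd]
  · by_cases hij : i = j
    · subst hij
      simpa using h4 (e i)
    · simpa [hij] using isRadonification_zero _ _ _
  · filter_upwards [h5, MartingaleSpace.path_zero (P := P) (ℱ := ℱ) (T := T) (G := G)]
      with ω hω h0 r
    rw [hω, ← e.sum_comp]
    refine Finset.sum_congr rfl fun i _ => ?_
    rw [Finset.sum_eq_single i (fun j _ hj => by simp [hj.symm, h0])
      (fun hi => absurd (Finset.mem_univ i) hi)]
    simp

theorem IsSimpleIntegral.isElementary {Ψ : M.Integrand T G} {X : MartingaleSpace ℱ P T G}
    (h : M.IsSimpleIntegral Ψ X) : M.IsElementary Ψ X := by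
  obtain ⟨n, m, s, t, F, A, S, Y, h1, h2, h3, h4, h5⟩ := h
  refine ⟨Fin n × Fin m, inferInstance, fun p => s p.1, fun p => t p.1, fun p => F p.1,
    fun p => A p.2, fun p => S p.1 p.2, fun p => Y p.1 p.2, fun p => h1 p.1, fun p => h2 p.2,
    fun r ω u => ?_, fun p => h4 p.1 p.2, ?_⟩
  · rw [h3, Fintype.sum_prod_type]
    rfl
  · filter_upwards [h5] with ω hω r
    rw [hω, Fintype.sum_prod_type]

namespace IsElementary

theorem zero : M.IsElementary (0 : M.Integrand T G) 0 := by
  refine ⟨Empty, inferInstance, Empty.elim, Empty.elim, Empty.elim, Empty.elim, Empty.elim,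
    Empty.elim, fun i => i.elim, fun i => i.elim, fun r ω u => ?_, fun i => i.elim, ?_⟩
  · rw [Finset.univ_eq_empty, Finset.sum_empty]
    exact map_zero _
  · filter_upwards [MartingaleSpace.path_zero (P := P) (ℱ := ℱ) (T := T) (G := G)] with ω h0 r
    rw [h0, Finset.univ_eq_empty, Finset.sum_empty]

theorem add {Ψ Ψ' : M.Integrand T G} {X X' : MartingaleSpace ℱ P T G} (h : M.IsElementary Ψ X)
    (h' : M.IsElementary Ψ' X') : M.IsElementary (Ψ + Ψ') (X + X') := by
  obtain ⟨ι, hι, s, t, F, A, S, Y, h1, h2, h3, h4, h5⟩ := h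
  obtain ⟨ι', hι', s', t', F', A', S', Y', h1', h2', h3', h4', h5'⟩ := h'
  refine ⟨ι ⊕ ι', inferInstance, Sum.elim s s', Sum.elim t t', Sum.elim F F', Sum.elim A A',
    Sum.elim S S', Sum.elim Y Y', ?_, ?_, fun r ω u => ?_, ?_, ?_⟩
  · rintro (i | i)
    exacts [h1 i, h1' i]
  · rintro (i | i)
    exacts [h2 i, h2' i]
  · rw [Fintype.sum_sum_type]
    simp only [Sum.elim_inl, Sum.elim_inr]
    rw [← h3, ← h3']
    exact map_add _ _ _
  · rintro (i | i)
    exacts [h4 i, h4' i]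
  · filter_upwards [h5, h5', MartingaleSpace.path_add X X'] with ω e1 e2 e3 r
    rw [Fintype.sum_sum_type, e3, e1, e2]
    rfl

theorem smul {Ψ : M.Integrand T G} {X : MartingaleSpace ℱ P T G} (h : M.IsElementary Ψ X)
    (c : ℝ) : M.IsElementary (c • Ψ) (c • X) := by
  obtain ⟨ι, hι, s, t, F, A, S, Y, h1, h2, h3, h4, h5⟩ := h
  refine ⟨ι, hι, s, t, F, A, fun i => c • S i, fun i => c • Y i, h1, h2, fun r ω u => ?_,
    fun i => (h4 i).smul c, ?_⟩
  · refine (map_smul (HilbertSchmidt.toCLM) c (Ψ r ω u)).trans ?_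
    rw [h3, Finset.smul_sum]
    refine Finset.sum_congr rfl fun i _ => ?_
    rw [map_smul, ContinuousLinearMap.smul_comp, smul_comm]
  · have h6 : ∀ᵐ ω ∂P, ∀ i r, (c • Y i).path r ω = c • (Y i).path r ω :=
      ae_all_iff.2 fun i => MartingaleSpace.path_smul c (Y i)
    filter_upwards [h5, h6, MartingaleSpace.path_smul c X] with ω e1 e2 e3 r
    rw [e3, e1, Finset.smul_sum]
    refine Finset.sum_congr rfl fun i _ => ?_
    rw [e2, smul_comm]

theorem sub {Ψ Ψ' : M.Integrand T G} {X X' : MartingaleSpace ℱ P T G} (h : M.IsElementary Ψ X)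
    (h' : M.IsElementary Ψ' X') : M.IsElementary (Ψ - Ψ') (X - X') := by
  have := h.add (h'.smul (-1))
  rwa [neg_one_smul, neg_one_smul, ← sub_eq_add_neg, ← sub_eq_add_neg] at this

end IsElementary

theorem adjoint_sum_elemInd {ι : Type*} [Fintype ι] {q : HilbertianSeminorm H}
    {Φ : HilbertSchmidt q.Space G} {c : ι → ℝ} {S : ι → HilbertSchmidt H G}
    (h : Φ.toCLM = ∑ i, c i • ((S i).toCLM ∘L ContinuousLinearMap.adjoint q.incl)) (g : G) :
    ContinuousLinearMap.adjoint Φ.toCLM g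
      = ∑ i, c i • q.incl (ContinuousLinearMap.adjoint (S i).toCLM g) := by
  rw [h, map_sum, sum_apply]
  refine Finset.sum_congr rfl fun i _ => ?_
  rw [map_smulₛₗ, conj_trivial, smul_apply, ContinuousLinearMap.adjoint_comp,
    ContinuousLinearMap.adjoint_adjoint]
  rfl

variable [BorelSpace U]

theorem measurable_elemInd {s t : ℝ≥0} {F : Set Ω} (hF : MeasurableSet[ℱ s] F) {A : Set U}
    (hA : MeasurableSet A) : Measurable fun p : PredSpace ℱ T U => elemInd s t F A p := by
  have h : (fun p : PredSpace ℱ T U => elemInd s t F A p)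
      = ({p : PredSpace ℱ T U | (p.1.1.1 ∈ Set.Ioc s t ∧ p.1.2 ∈ F) ∧ p.2 ∈ A}).indicator 1 :=
    funext fun p => elemInd_eq_indicator s t F A p
  rw [h]
  exact measurable_one.indicator (measurableSet_predSpace_rect hF hA)

theorem IsElementary.isMeasurableOperatorField {Ψ : M.Integrand T G}
    {X : MartingaleSpace ℱ P T G} (h : M.IsElementary Ψ X) :
    IsMeasurableOperatorField (M.toField Ψ) := by
  obtain ⟨ι, hι, s, t, F, A, S, Y, h1, h2, h3, h4, h5⟩ := h
  intro k g
  have h6 : ∀ p : PredSpace ℱ T U, (inner ℝ (ContinuousLinearMap.adjoint (M.toField Ψ p).toCLM g)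
      ((M.predSeminorm T p).incl k) : ℝ) = ∑ i, elemInd (s i) (t i) (F i) (A i) p *
        (M.predSeminorm T p).form (ContinuousLinearMap.adjoint (S i).toCLM g) k := by
    intro p
    have h7 := adjoint_sum_elemInd (Φ := M.toField Ψ p) (h3 p.1.1 p.1.2 p.2) g
    rw [h7]
    refine (sum_inner _ _ _).trans (Finset.sum_congr rfl fun i _ => ?_)
    exact (real_inner_smul_left _ _ _).trans
      (congrArg _ (HilbertianSeminorm.inner_incl (M.predSeminorm T p) _ _))
  simp only [h6]
  exact Finset.measurable_fun_sum _ fun i _ => (measurable_elemInd (h1 i).2.2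
    (measurableSet_of_mem_ring (h2 i))).mul (M.isMeasurableSeminorm_predSeminorm _ _)

variable [TopologicalSpace.SeparableSpace G] [TopologicalSpace.SeparableSpace H]

theorem lintegral_predMeasure_eq {f : PredSpace ℱ T U → ℝ≥0∞} (hf : Measurable f) :
    ∫⁻ p, f p ∂(M.predMeasure T) = ∫⁻ p, f (toPred ℱ p) ∂(M.prodMeasure T) := by
  rw [predMeasure, lintegral_map hf measurable_toPred]

/-- The Itô isometry for simple integrands. -/
theorem IsElementary.eLpNorm_path {Ψ : M.Integrand T G} {X : MartingaleSpace ℱ P T G}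
    (h : M.IsElementary Ψ X) : eLpNorm (X.path (lastTime T)) 2 P = M.lambdaENorm Ψ := by
  have hm := h.isMeasurableOperatorField
  rw [M.lambdaENorm_eq hm, eLpNorm_two_eq, eLpNorm_two_eq]
  congr 1
  simp only [enorm_norm]
  rw [lintegral_predMeasure_eq ((M.measurable_enorm_toField hm).pow_const 2)]
  -- The isometry is checked coordinate by coordinate in `G`. A basis indexed by a subset of `ℕ` is
  -- taken, so that sums and integrals may be exchanged.
  obtain ⟨b, -⟩ := (isParsevalSeq_orthoSeq G).exists_hilbertBasis
  obtain ⟨ι, hι, s, t, F, A, S, Y, h1, h2, h3, h4, h5⟩ := h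
  have hL : ∀ j, ∫⁻ ω, ‖(inner ℝ (X.path (lastTime T) ω) (b j) : ℝ)‖ₑ ^ 2 ∂P
      = ∫⁻ p, ‖ContinuousLinearMap.adjoint (M.toField Ψ (toPred ℱ p)).toCLM (b j)‖ₑ ^ 2
        ∂(M.prodMeasure T) := by
    intro j
    have h6 := lintegral_sum_elemIncr (M := M) (T := T) (fun i => (h1 i).1) (fun i => (h1 i).2.1)
      (fun i => (h1 i).2.2) h2 (fun i => ContinuousLinearMap.adjoint (S i).toCLM (b j))
    refine Eq.trans (lintegral_congr_ae ?_) (h6.trans (lintegral_congr fun p => ?_))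
    · have h7 : ∀ᵐ ω ∂P, ∀ i, (inner ℝ ((Y i).path (lastTime T) ω) (b j) : ℝ)
          = M.incr (s i) (t i) (A i) (ContinuousLinearMap.adjoint (S i).toCLM (b j)) ω := by
        refine ae_all_iff.2 fun i => ?_
        have h8 := h4 i (lastTime T) (b j)
        rwa [min_eq_left (show t i ≤ (lastTime T : ℝ≥0) from (h1 i).2.1),
          min_eq_left (show s i ≤ (lastTime T : ℝ≥0) from (h1 i).1.le.trans (h1 i).2.1)] at h8
      filter_upwards [h5, h7] with ω e1 e2
      rw [e1, sum_inner]
      congr 2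
      refine Finset.sum_congr rfl fun i _ => ?_
      rw [real_inner_smul_left, e2]
      by_cases hω : ω ∈ F i <;> simp [elemIncr, hω]
    · rw [← adjoint_sum_elemInd (h3 p.1.1 p.1.2 p.2)]
      rfl
  calc ∫⁻ ω, ‖X.path (lastTime T) ω‖ₑ ^ 2 ∂P
      = ∑' j, ∫⁻ ω, ‖(inner ℝ (X.path (lastTime T) ω) (b j) : ℝ)‖ₑ ^ 2 ∂P := by
        rw [← lintegral_tsum fun j => ((X.memLp_path _).1.inner_const.enorm.pow_const 2)]
        exact lintegral_congr fun ω => enorm_sq_eq_tsum_hilbertBasis b _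
    _ = ∑' j, ∫⁻ p, ‖ContinuousLinearMap.adjoint (M.toField Ψ (toPred ℱ p)).toCLM (b j)‖ₑ ^ 2
        ∂(M.prodMeasure T) := tsum_congr hL
    _ = _ := by
        rw [← lintegral_tsum]
        · exact lintegral_congr fun p => (HilbertSchmidt.enorm_sq_adjoint b _).symm
        · intro j
          exact ((measurable_enorm_adjoint_sq M.isMeasurableSeminorm_predSeminorm hm
            (b j)).comp measurable_toPred).aemeasurable

theorem IsElementary.enorm_le (hT : 0 < T) {Ψ : M.Integrand T G} {X : MartingaleSpace ℱ P T G}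
    (h : M.IsElementary Ψ X) : ‖X‖ₑ ≤ 2 * M.lambdaENorm Ψ := by
  rw [← h.eLpNorm_path]
  exact X.enorm_le hT

theorem IsElementary.isLambda2 {Ψ : M.Integrand T G} {X : MartingaleSpace ℱ P T G}
    (h : M.IsElementary Ψ X) : M.IsLambda2 Ψ :=
  ⟨h.isMeasurableOperatorField, by rw [← h.eLpNorm_path]; exact (X.memLp_path _).2⟩

omit [BorelSpace U] [TopologicalSpace.SeparableSpace G] [TopologicalSpace.SeparableSpace H] in
theorem lambdaENorm_sub_comm (Φ Ψ : M.Integrand T G) :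
    M.lambdaENorm (Φ - Ψ) = M.lambdaENorm (Ψ - Φ) := by
  have h : ∀ r ω u, ‖(Φ - Ψ) r ω u‖ₑ = ‖(Ψ - Φ) r ω u‖ₑ := fun r ω u =>
    enorm_sub_rev (Φ r ω u) (Ψ r ω u)
  simp only [lambdaENorm, h]

/-- Replace both integrals by simple ones and use `‖X‖ ≤ 2‖Ψ‖` for their difference. Uniqueness and
the Lipschitz bound for the stochastic integral both follow. -/
theorem IsStochasticIntegral.enorm_sub_le (hT : 0 < T) {Φ Φ' : M.Integrand T G}
    {X X' : MartingaleSpace ℱ P T G} (h : M.IsStochasticIntegral Φ X)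
    (h' : M.IsStochasticIntegral Φ' X') : ‖X - X'‖ₑ ≤ 2 * M.lambdaENorm (Φ - Φ') := by
  refine ENNReal.le_of_forall_pos_le_add fun ε hε _ => ?_
  -- Six copies of the error arise: one for each of `X`, `X'`, and two for each of the integrands
  -- because of the factor 2.
  have hε' : (0 : ℝ≥0∞) < ε / 6 := by
    simp [hε.ne']
  obtain ⟨Ψ, Y, h1, h2, h3⟩ := h.2 _ hε'
  obtain ⟨Ψ', Y', h1', h2', h3'⟩ := h'.2 _ hε'
  have e := h1.isElementary
  have e' := h1'.isElementary
  have hm : IsMeasurableOperatorField (M.toField Φ) := h.1.1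
  have hm' : IsMeasurableOperatorField (M.toField Φ') := h'.1.1
  have k1 := M.lambdaENorm_triangle e.isMeasurableOperatorField hm e'.isMeasurableOperatorField
  have k2 := M.lambdaENorm_triangle hm hm' e'.isMeasurableOperatorField
  rw [lambdaENorm_sub_comm] at h2
  calc ‖X - X'‖ₑ = ‖(X - Y) + (Y - Y') - (X' - Y')‖ₑ := by congr 1; abel
    _ ≤ ‖X - Y‖ₑ + ‖Y - Y'‖ₑ + ‖X' - Y'‖ₑ := (_root_.enorm_sub_le).trans (by gcongr; exact enorm_add_le _ _)
    _ ≤ ε / 6 + 2 * (ε / 6 + (M.lambdaENorm (Φ - Φ') + ε / 6)) + ε / 6 := by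
        gcongr
        refine ((e.sub e').enorm_le hT).trans ?_
        gcongr
        exact k1.trans (add_le_add h2.le (k2.trans (add_le_add le_rfl h2'.le)))
    _ = 2 * M.lambdaENorm (Φ - Φ') + 6 * (ε / 6) := by ring
    _ = _ := by rw [ENNReal.mul_div_cancel (by norm_num) (by norm_num)]

theorem IsStochasticIntegral.unique (hT : 0 < T) {Φ : M.Integrand T G}
    {X X' : MartingaleSpace ℱ P T G} (h : M.IsStochasticIntegral Φ X)
    (h' : M.IsStochasticIntegral Φ X') : X = X' := by
  have h1 := h.enorm_sub_le hT h'
  have h2 : M.lambdaENorm (Φ - Φ) = 0 := by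
    rw [sub_self]
    simp [lambdaENorm]
  rw [h2, mul_zero] at h1
  exact sub_eq_zero.1 (enorm_eq_zero.1 (le_antisymm h1 zero_le))

theorem IsStochasticIntegral.stochasticIntegral_eq (hT : 0 < T) {Φ : M.Integrand T G}
    {X : MartingaleSpace ℱ P T G} (h : M.IsStochasticIntegral Φ X) :
    M.stochasticIntegral Φ = X := by
  have hex : ∃ X, M.IsStochasticIntegral Φ X := ⟨X, h⟩
  rw [stochasticIntegral, dif_pos hex]
  exact hex.choose_spec.unique hT h

omit [BorelSpace U] [TopologicalSpace.SeparableSpace G] [TopologicalSpace.SeparableSpace H] in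
theorem isStochasticIntegral_of_tendsto {κ : Type*} {l : Filter κ} [l.NeBot]
    {Φ : M.Integrand T G} {X : MartingaleSpace ℱ P T G} {Ψ : κ → M.Integrand T G}
    {Y : κ → MartingaleSpace ℱ P T G} (hΦ : M.IsLambda2 Φ) (h : ∀ n, M.IsElementary (Ψ n) (Y n))
    (hΨ : Tendsto (fun n => M.lambdaENorm (Φ - Ψ n)) l (𝓝 0))
    (hY : Tendsto (fun n => ‖X - Y n‖ₑ) l (𝓝 0)) : M.IsStochasticIntegral Φ X := by
  refine ⟨hΦ, fun ε hε => ?_⟩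
  obtain ⟨n, h1, h2⟩ := ((hΨ.eventually_lt_const hε).and (hY.eventually_lt_const hε)).exists
  exact ⟨Ψ n, Y n, (h n).isSimpleIntegral, h1, h2⟩

/-- Composing `x ↦ ⟨h, x⟩ g` with the adjoint of `i_q` gives the rank one operator of `i_q h` and
`g`, so these fields have exactly the shape of simple integrands. -/
theorem exists_isElementary_rect (hT : 0 < T)
    (hnull : ∀ N : Set Ω, P N = 0 → MeasurableSet[ℱ 0] N) {A : Set U} (hA : A ∈ M.ring)
    {s t : ℝ≥0} (hst : s < t) (htT : t ≤ T) {F : Set Ω} (hF : MeasurableSet[ℱ s] F)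
    (h : H) (g : G) : ∃ X : MartingaleSpace ℱ P T G, M.IsElementary (fun r ω u =>
      elemInd s t F A ((r, ω), u) • HilbertSchmidt.rankOne ((M.q r u).incl h) g) X := by
  obtain ⟨Y, hY⟩ := exists_isRadonification hT hnull hA hst.le (HilbertSchmidt.rankOne h g)
  obtain ⟨X, hX⟩ := exists_indicator_radonification hnull hst.le htT hY hF
  refine ⟨X, Unit, inferInstance, fun _ => s, fun _ => t, fun _ => F, fun _ => A,
    fun _ => HilbertSchmidt.rankOne h g, fun _ => Y, fun _ => ⟨hst, htT, hF⟩, fun _ => hA,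
    fun r ω u => ?_, fun _ => hY, ?_⟩
  · rw [Finset.univ_unique, Finset.sum_singleton, map_smul]
    congr 1
    ext x
    rw [HilbertSchmidt.rankOne_apply, ContinuousLinearMap.comp_apply,
      HilbertSchmidt.rankOne_apply, ContinuousLinearMap.adjoint_inner_right]
  · filter_upwards [hX] with ω hω r
    rw [hω, Finset.univ_unique, Finset.sum_singleton]

end CylMartMeasure
end

/-! ### The mixed norm `∫ ‖f(·, e)‖₂ ϱ(de)` and Minkowski's inequality. -/

noncomputable section

section MixedNorm

variable {X E : Type*} [MeasurableSpace X] [MeasurableSpace E] {ν : Measure X} {ϱ : Measure E}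

/-- The norm `∫ ‖f(·, e)‖₂ ϱ(de)`. -/
def mixedENorm (ν : Measure X) (ϱ : Measure E) (f : X × E → ℝ≥0∞) : ℝ≥0∞ :=
  ∫⁻ e, (∫⁻ x, f (x, e) ^ 2 ∂ν) ^ (1 / 2 : ℝ) ∂ϱ

theorem mixedENorm_mono {f g : X × E → ℝ≥0∞} (h : ∀ x, f x ≤ g x) :
    mixedENorm ν ϱ f ≤ mixedENorm ν ϱ g := by
  unfold mixedENorm
  gcongr with e x
  exact h _

theorem measurable_rpow_lintegral_sq [SFinite ν] {f : X × E → ℝ≥0∞} (hf : Measurable f) :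
    Measurable fun e => (∫⁻ x, f (x, e) ^ 2 ∂ν) ^ (1 / 2 : ℝ) :=
  (hf.pow_const 2).lintegral_prod_left'.pow_const _

theorem mixedENorm_add_le [SFinite ν] {f g : X × E → ℝ≥0∞} (hf : Measurable f)
    (hg : Measurable g) :
    mixedENorm ν ϱ (fun x => f x + g x) ≤ mixedENorm ν ϱ f + mixedENorm ν ϱ g := by
  unfold mixedENorm
  rw [← lintegral_add_left (measurable_rpow_lintegral_sq hf)]
  refine lintegral_mono fun e => ?_
  have h := ENNReal.lintegral_Lp_add_le (μ := ν) (f := fun x => f (x, e)) (g := fun x => g (x, e))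
    (hf.comp measurable_prodMk_right).aemeasurable (hg.comp measurable_prodMk_right).aemeasurable
    one_le_two
  simpa only [ENNReal.rpow_two, Pi.add_apply] using h

theorem mixedENorm_const_mul {c : ℝ≥0∞} (hc : c ≠ ∞) (f : X × E → ℝ≥0∞) :
    mixedENorm ν ϱ (fun x => c * f x) = c * mixedENorm ν ϱ f := by
  unfold mixedENorm
  rw [← lintegral_const_mul' _ _ hc]
  refine lintegral_congr fun e => ?_
  simp only [mul_pow]
  rw [lintegral_const_mul' _ _ (by finiteness), ENNReal.mul_rpow_of_nonneg _ _ (by norm_num),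
    ← ENNReal.rpow_natCast, ← ENNReal.rpow_mul]
  norm_num

theorem ae_lintegral_sq_lt_top [SFinite ν] {f : X × E → ℝ≥0∞} (hf : Measurable f)
    (h : mixedENorm ν ϱ f ≠ ∞) : ∀ᵐ e ∂ϱ, ∫⁻ x, f (x, e) ^ 2 ∂ν < ∞ := by
  filter_upwards [ae_lt_top (measurable_rpow_lintegral_sq hf) h] with e he
  by_contra h1
  rw [not_lt_top_iff.1 h1, ENNReal.top_rpow_of_pos (by norm_num)] at he
  exact lt_irrefl _ he

/-- Dominated convergence for the mixed norm. -/
theorem tendsto_mixedENorm_zero [SFinite ν] {f : ℕ → X × E → ℝ≥0∞} {F : X × E → ℝ≥0∞}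
    (hf : ∀ n, Measurable (f n)) (hF : Measurable F) (hle : ∀ n x, f n x ≤ F x)
    (hfin : mixedENorm ν ϱ F ≠ ∞)
    (hlim : ∀ e, ∀ᵐ x ∂ν, Tendsto (fun n => f n (x, e)) atTop (𝓝 0)) :
    Tendsto (fun n => mixedENorm ν ϱ (f n)) atTop (𝓝 0) := by
  -- Dominated convergence is used twice: in `x` for almost every `e`, then in `e`.
  have h := tendsto_lintegral_of_dominated_convergence (μ := ϱ)
    (F := fun n e => (∫⁻ x, f n (x, e) ^ 2 ∂ν) ^ (1 / 2 : ℝ)) (f := fun _ => 0)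
    (fun e => (∫⁻ x, F (x, e) ^ 2 ∂ν) ^ (1 / 2 : ℝ))
    (fun n => measurable_rpow_lintegral_sq (hf n)) (fun n => ae_of_all _ fun e => ?_) hfin ?_
  · simpa [mixedENorm] using h
  · exact ENNReal.rpow_le_rpow (lintegral_mono fun x => pow_le_pow_left' (hle n _) 2) (by norm_num)
  · filter_upwards [ae_lintegral_sq_lt_top hF hfin] with e he
    have h1 := tendsto_lintegral_of_dominated_convergence (μ := ν)
      (F := fun n x => f n (x, e) ^ 2) (f := fun _ => 0) (fun x => F (x, e) ^ 2)
      (fun n => ((hf n).comp measurable_prodMk_right).pow_const 2)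
      (fun n => ae_of_all _ fun x => pow_le_pow_left' (hle n _) 2) he.ne ?_
    · rw [lintegral_zero] at h1
      have h2 := (ENNReal.continuous_rpow_const (y := 1 / 2)).tendsto _ |>.comp h1
      simpa [Function.comp_def] using h2
    · filter_upwards [hlim e] with x hx
      have h2 := (ENNReal.continuous_pow 2).tendsto _ |>.comp hx
      simpa [Function.comp_def] using h2

/-- Minkowski's inequality for integrals, with exponent `2`. -/
theorem lintegral_sq_lintegral_le [SigmaFinite ν] [SFinite ϱ] {f : X × E → ℝ≥0∞}
    (hf : Measurable f) :
    (∫⁻ x, (∫⁻ e, f (x, e) ∂ϱ) ^ 2 ∂ν) ^ (1 / 2 : ℝ) ≤ mixedENorm ν ϱ f := by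
  set g : X → ℝ≥0∞ := fun x => ∫⁻ e, f (x, e) ∂ϱ with hg
  have hgm : Measurable g := hf.lintegral_prod_right'
  -- Truncation in size and in space makes `∫ gn²` finite, so that its square root can be cancelled
  -- below; monotone convergence removes it at the end.
  let gn : ℕ → X → ℝ≥0∞ := fun n => (spanningSets ν n).indicator fun x => min (g x) n
  have hgnm : ∀ n, Measurable (gn n) := fun n =>
    (hgm.min measurable_const).indicator (measurableSet_spanningSets ν n)
  have hgn_le : ∀ n x, gn n x ≤ g x := fun n x =>
    (Set.indicator_le_self' (fun _ _ => zero_le) x).trans (min_le_left _ _)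
  have hbound : ∀ n, ∫⁻ x, gn n x ^ 2 ∂ν ≤ mixedENorm ν ϱ f ^ 2 := by
    intro n
    have hfin : ∫⁻ x, gn n x ^ 2 ∂ν ≠ ∞ := by
      have h1 : ∀ x, gn n x ^ 2 ≤ (spanningSets ν n).indicator (fun _ => (n : ℝ≥0∞) ^ 2) x := by
        intro x
        by_cases hx : x ∈ spanningSets ν n
        · simp only [gn, Set.indicator_of_mem hx]
          gcongr
          exact min_le_right _ _
        · simp [gn, Set.indicator_of_notMem hx]
      refine ((lintegral_mono h1).trans_lt ?_).ne
      rw [lintegral_indicator_const (measurableSet_spanningSets ν n)]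
      exact ENNReal.mul_lt_top (by finiteness) (measure_spanningSets_lt_top ν n)
    set A := ∫⁻ x, gn n x ^ 2 ∂ν with hA
    -- Duality: bound one factor of `gn²` by `g = ∫ f de`, exchange the integrals, and apply
    -- Cauchy-Schwarz for each `e`.
    have h2 : A ≤ A ^ (1 / 2 : ℝ) * mixedENorm ν ϱ f := by
      calc A ≤ ∫⁻ x, ∫⁻ e, gn n x * f (x, e) ∂ϱ ∂ν := by
            refine lintegral_mono fun x => ?_
            rw [lintegral_const_mul _ (f := fun e => f (x, e)) (hf.comp measurable_prodMk_left), pow_two]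
            exact mul_le_mul_right (hgn_le n x) _
        _ = ∫⁻ e, ∫⁻ x, gn n x * f (x, e) ∂ν ∂ϱ :=
            lintegral_lintegral_swap (((hgnm n).comp measurable_fst).mul hf).aemeasurable
        _ ≤ ∫⁻ e, A ^ (1 / 2 : ℝ) * (∫⁻ x, f (x, e) ^ 2 ∂ν) ^ (1 / 2 : ℝ) ∂ϱ := by
            refine lintegral_mono fun e => ?_
            have h3 := ENNReal.lintegral_mul_le_Lp_mul_Lq ν Real.HolderConjugate.two_two
              (hgnm n).aemeasurable (hf.comp (measurable_prodMk_right (y := e))).aemeasurable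
            simpa only [ENNReal.rpow_two, Pi.mul_apply, Function.comp_apply] using h3
        _ = _ := lintegral_const_mul _ (measurable_rpow_lintegral_sq hf)
    rcases eq_or_ne A 0 with h0 | h0
    · rw [h0]; exact zero_le
    have h4 : A = A ^ (1 / 2 : ℝ) * A ^ (1 / 2 : ℝ) := by
      rw [← ENNReal.rpow_add _ _ h0 hfin]
      norm_num
    have h5 : A ^ (1 / 2 : ℝ) ≤ mixedENorm ν ϱ f := by
      rw [h4, ← h4] at h2
      conv_lhs at h2 => rw [h4]
      refine (ENNReal.mul_le_mul_iff_right ?_ ?_).1 h2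
      · rw [Ne, ENNReal.rpow_eq_zero_iff_of_pos (by norm_num)]
        exact h0
      · exact ENNReal.rpow_ne_top_of_nonneg (by norm_num) hfin
    rw [h4, pow_two]
    exact mul_le_mul' h5 h5
  have hlim : Tendsto (fun n => ∫⁻ x, gn n x ^ 2 ∂ν) atTop (𝓝 (∫⁻ x, g x ^ 2 ∂ν)) := by
    refine lintegral_tendsto_of_tendsto_of_monotone (fun n => ((hgnm n).pow_const 2).aemeasurable)
      (ae_of_all _ fun x n m hnm => ?_) (ae_of_all _ fun x => ?_)
    · refine pow_le_pow_left' ?_ 2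
      refine Set.indicator_le_indicator_of_subset (monotone_spanningSets ν hnm)
        (fun _ => zero_le) x |>.trans ?_
      refine Set.indicator_le_indicator ?_
      exact min_le_min le_rfl (by exact_mod_cast hnm)
    · refine ((ENNReal.continuous_pow 2).tendsto _).comp ?_
      have h1 : Tendsto (fun n : ℕ => min (g x) n) atTop (𝓝 (min (g x) ∞)) :=
        tendsto_const_nhds.min ENNReal.tendsto_nat_nhds_top
      rw [min_top_right] at h1
      refine h1.congr' ?_
      filter_upwards [eventually_ge_atTop (spanningSetsIndex ν x)] with n hn
      exact (Set.indicator_of_mem (monotone_spanningSets ν hn (mem_spanningSetsIndex ν x))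
        fun x => min (g x) (n : ℝ≥0∞)).symm
  have h6 := le_of_tendsto' hlim hbound
  refine (ENNReal.rpow_le_rpow h6 (by norm_num)).trans_eq ?_
  rw [← ENNReal.rpow_natCast, ← ENNReal.rpow_mul]
  norm_num

end MixedNorm
end

/-! ### π-systems generating the σ-algebra of the integrands. -/

noncomputable section

section Generators

variable {Ω : Type*} {mΩ : MeasurableSpace Ω}

/-- The usual generators of the predictable σ-algebra, on `[0, T] × Ω`. -/
def predictableRect (ℱ : Filtration ℝ≥0 mΩ) (T : ℝ≥0) : Set (Set (Set.Icc (0 : ℝ≥0) T × Ω)) :=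
  {s | ∃ F, MeasurableSet[ℱ 0] F ∧ s = {p | p.1.1 = 0 ∧ p.2 ∈ F}} ∪
    {s | ∃ i F, MeasurableSet[ℱ i] F ∧ s = {p | i < p.1.1 ∧ p.2 ∈ F}}

theorem isPiSystem_predictableRect (ℱ : Filtration ℝ≥0 mΩ) (T : ℝ≥0) :
    IsPiSystem (predictableRect ℱ T) := by
  rintro _ (⟨F, hF, rfl⟩ | ⟨i, F, hF, rfl⟩) _ (⟨F', hF', rfl⟩ | ⟨j, F', hF', rfl⟩) hne
  · exact Or.inl ⟨F ∩ F', hF.inter hF', by ext; simp; tauto⟩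
  · obtain ⟨p, h1, h2⟩ := hne
    exact absurd (h1.1 ▸ h2.1) not_lt_zero
  · obtain ⟨p, h1, h2⟩ := hne
    exact absurd (h2.1 ▸ h1.1) not_lt_zero
  · refine Or.inr ⟨max i j, F ∩ F', (ℱ.mono (le_max_left i j) _ hF).inter
      (ℱ.mono (le_max_right i j) _ hF'), ?_⟩
    ext
    simp only [Set.mem_inter_iff, Set.mem_ofPred_eq, max_lt_iff]
    tauto

theorem generateFrom_predictableRect (ℱ : Filtration ℝ≥0 mΩ) (T : ℝ≥0) :
    MeasurableSpace.generateFrom (predictableRect ℱ T) = CylMartMeasure.predictableIcc ℱ T := by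
  rw [CylMartMeasure.predictableIcc, Filtration.predictable, MeasurableSpace.comap_generateFrom,
    Set.image_union]
  congr 1
  ext s
  constructor
  · rintro (⟨F, hF, rfl⟩ | ⟨i, F, hF, rfl⟩)
    · exact Or.inl ⟨_, ⟨F, hF, rfl⟩, by ext; simp⟩
    · exact Or.inr ⟨_, ⟨i, F, hF, rfl⟩, by ext; simp⟩
  · rintro (⟨_, ⟨F, hF, rfl⟩, rfl⟩ | ⟨_, ⟨i, F, hF, rfl⟩, rfl⟩)
    · exact Or.inl ⟨F, hF, by ext; simp⟩
    · exact Or.inr ⟨i, F, hF, by ext; simp⟩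

theorem isCountablySpanning_predictableRect (ℱ : Filtration ℝ≥0 mΩ) (T : ℝ≥0) :
    IsCountablySpanning (predictableRect ℱ T) := by
  refine ⟨fun n => if n = 0 then {p | p.1.1 = 0 ∧ p.2 ∈ Set.univ}
    else {p | 0 < p.1.1 ∧ p.2 ∈ Set.univ}, fun n => ?_, ?_⟩
  · by_cases hn : n = 0
    · simp only [hn, if_true]
      exact Or.inl ⟨_, MeasurableSet.univ, rfl⟩
    · simp only [hn, if_false]
      exact Or.inr ⟨0, _, MeasurableSet.univ, rfl⟩
  · refine Set.eq_univ_of_forall fun p => Set.mem_iUnion.2 ?_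
    rcases eq_or_lt_of_le (zero_le (a := p.1.1)) with h | h
    · exact ⟨0, by simp [h.symm]⟩
    · exact ⟨1, by simp [h]⟩

theorem IsCountablySpanning.of_univ_mem {α : Type*} {C : Set (Set α)} (h : Set.univ ∈ C) :
    IsCountablySpanning C := ⟨fun _ => Set.univ, fun _ => h, Set.iUnion_const _⟩

variable {ℱ : Filtration ℝ≥0 mΩ} {P : Measure Ω}
  {H : Type*} [NormedAddCommGroup H] [InnerProductSpace ℝ H]
  {U : Type*} [TopologicalSpace U] [MeasurableSpace U] [BorelSpace U]

/-- A π-system that generates the σ-algebra of `[0, T] × Ω × U × E`. -/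
def CylMartMeasure.boxes (M : CylMartMeasure ℱ P H U) (T : ℝ≥0) (E : Type*) [MeasurableSpace E] :
    Set (Set (PredSpace ℱ T U × E)) :=
  Set.image2 (· ×ˢ ·) (Set.image2 (· ×ˢ ·) (predictableRect ℱ T) (insert Set.univ M.ring) :
    Set (Set (PredSpace ℱ T U))) {s | MeasurableSet s}

theorem CylMartMeasure.isPiSystem_boxes (M : CylMartMeasure ℱ P H U) (T : ℝ≥0) (E : Type*)
    [MeasurableSpace E] : IsPiSystem (M.boxes T E) := by
  refine IsPiSystem.prod (IsPiSystem.prod (isPiSystem_predictableRect ℱ T) ?_)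
    MeasurableSpace.isPiSystem_measurableSet
  exact (M.isSetRing_ring.isSetSemiring.isPiSystem).insert_univ

/-- The ring need not contain `U`, nor cover it by countably many members without exception; adding
the whole space makes the factor countably spanning without changing the generated σ-algebra. -/
theorem CylMartMeasure.generateFrom_boxes (M : CylMartMeasure ℱ P H U) (T : ℝ≥0) (E : Type*)
    [MeasurableSpace E] : (inferInstance : MeasurableSpace (PredSpace ℱ T U × E))
      = MeasurableSpace.generateFrom (M.boxes T E) := by
  have hU : MeasurableSpace.generateFrom (insert Set.univ M.ring)
      = (inferInstance : MeasurableSpace U) := by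
    rw [MeasurableSpace.generateFrom_insert_univ, M.generateFrom_ring, BorelSpace.measurable_eq (α := U)]
  have hsU : IsCountablySpanning (insert Set.univ M.ring) :=
    .of_univ_mem (Set.mem_insert _ _)
  refine (generateFrom_eq_prod (α := PredSpace ℱ T U) (β := E) ?_ MeasurableSpace.generateFrom_measurableSet
    ((isCountablySpanning_predictableRect ℱ T).prod hsU) isCountablySpanning_measurableSet).symm
  exact @generateFrom_eq_prod (Set.Icc (0 : ℝ≥0) T × Ω) U (CylMartMeasure.predictableIcc ℱ T) _ _ _
    (generateFrom_predictableRect ℱ T) hU (isCountablySpanning_predictableRect ℱ T) hsU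

end Generators
end

/-! ### Approximable integrands with a parameter: boxes. -/

noncomputable section

theorem indicator_one_eq_mul {α β γ : Type*} {s : Set α} {t : Set β} {u : Set γ} {x : α} {y : β}
    {z : γ} (h : x ∈ s ↔ y ∈ t ∧ z ∈ u) :
    (s.indicator 1 x : ℝ) = t.indicator 1 y * u.indicator 1 z := by
  classical
  simp only [Set.indicator_apply, Pi.one_apply, h, ite_and]
  split_ifs <;> simp

namespace CylMartMeasure

variable {Ω : Type*} {mΩ : MeasurableSpace Ω} {ℱ : Filtration ℝ≥0 mΩ} {P : Measure Ω}
  [IsProbabilityMeasure P] {T : ℝ≥0}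
  {G : Type*} [NormedAddCommGroup G] [InnerProductSpace ℝ G] [CompleteSpace G]
  {H : Type*} [NormedAddCommGroup H] [InnerProductSpace ℝ H] [CompleteSpace H]
  {U : Type*} [TopologicalSpace U] [MeasurableSpace U]
  {M : CylMartMeasure ℱ P H U} {E : Type*} [MeasurableSpace E] {ϱ : Measure E}

/-- Integrands with a parameter in `E`, as fields of operators. -/
abbrev XiField (M : CylMartMeasure ℱ P H U) (T : ℝ≥0) (E G : Type*) [NormedAddCommGroup G]
    [InnerProductSpace ℝ G] [CompleteSpace G] : Type _ :=
  ∀ x : PredSpace ℱ T U × E, HilbertSchmidt (M.predSeminorm T x.1).Space G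

/-- Weak measurability of an integrand with a parameter. -/
abbrev IsMeasurableXi (Φ : M.XiField T E G) : Prop :=
  IsMeasurableOperatorField (q := fun x : PredSpace ℱ T U × E => M.predSeminorm T x.1) Φ

/-- The norm `∫ ‖Φ(·, e)‖_{Λ²} ϱ(de)`. -/
def xiENorm (ϱ : Measure E) (Φ : M.XiField T E G) : ℝ≥0∞ :=
  mixedENorm (M.predMeasure T) ϱ fun x => ‖Φ x‖ₑ

/-- `Ψ = ∑ 1_{B_k}(e) ψ_k`, where the `ψ_k` are simple integrands, and
`ζ = ∑ 1_{B_k}(e) Z_k`, where the `Z_k` are their integrals. -/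
def IsSimpleXi (ϱ : Measure E) (Ψ : M.XiField T E G) (ζ : E → MartingaleProcess ℱ P T G) : Prop :=
  ∃ (κ : Type) (_ : Fintype κ) (B : κ → Set E) (ψ : κ → M.Integrand T G)
    (Z : κ → MartingaleProcess ℱ P T G),
    (∀ k, MeasurableSet (B k) ∧ ϱ (B k) < ∞ ∧
      M.IsElementary (ψ k) (SeparationQuotient.mk (Z k))) ∧
    (∀ x, Ψ x = ∑ k, ((B k).indicator 1 x.2 : ℝ) • M.toField (ψ k) x.1) ∧
    ∀ e, ζ e = ∑ k, ((B k).indicator 1 e : ℝ) • Z k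

/-- `Φ` can be approximated by simple integrands. -/
def IsXiApprox (ϱ : Measure E) (Φ : M.XiField T E G) : Prop :=
  ∀ ε : ℝ≥0∞, 0 < ε → ∃ Ψ ζ, IsSimpleXi ϱ Ψ ζ ∧ xiENorm ϱ (Φ - Ψ) < ε

theorem isMeasurableSeminorm_fst : IsMeasurableSeminorm
    fun x : PredSpace ℱ T U × E => M.predSeminorm T x.1 := fun h₁ h₂ =>
  (M.isMeasurableSeminorm_predSeminorm h₁ h₂).comp measurable_fst

theorem IsSimpleXi.zero : IsSimpleXi ϱ (0 : M.XiField T E G) 0 :=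
  ⟨Empty, inferInstance, Empty.elim, Empty.elim, Empty.elim, fun k => k.elim,
    fun x => by rw [Finset.univ_eq_empty, Finset.sum_empty]; rfl,
    fun e => by rw [Finset.univ_eq_empty, Finset.sum_empty]; rfl⟩

theorem IsSimpleXi.add {Ψ Ψ' : M.XiField T E G} {ζ ζ' : E → MartingaleProcess ℱ P T G}
    (h : IsSimpleXi ϱ Ψ ζ) (h' : IsSimpleXi ϱ Ψ' ζ') : IsSimpleXi ϱ (Ψ + Ψ') (ζ + ζ') := by
  obtain ⟨κ, _, B, ψ, Z, h1, h2, h3⟩ := h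
  obtain ⟨κ', _, B', ψ', Z', h1', h2', h3'⟩ := h'
  refine ⟨κ ⊕ κ', inferInstance, Sum.elim B B', Sum.elim ψ ψ', Sum.elim Z Z', ?_, fun x => ?_,
    fun e => ?_⟩
  · rintro (k | k)
    exacts [h1 k, h1' k]
  · rw [Fintype.sum_sum_type, Pi.add_apply, h2, h2']
    rfl
  · rw [Fintype.sum_sum_type, Pi.add_apply, h3, h3']
    rfl

theorem IsSimpleXi.isXiApprox {Ψ : M.XiField T E G} {ζ : E → MartingaleProcess ℱ P T G}
    (h : IsSimpleXi ϱ Ψ ζ) : IsXiApprox ϱ Ψ := fun ε hε =>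
  ⟨Ψ, ζ, h, by simpa [xiENorm, mixedENorm] using hε⟩

theorem IsXiApprox.zero : IsXiApprox ϱ (0 : M.XiField T E G) :=
  IsSimpleXi.zero.isXiApprox

variable [BorelSpace U] [TopologicalSpace.SeparableSpace G] [TopologicalSpace.SeparableSpace H]

theorem IsSimpleXi.isMeasurableXi {Ψ : M.XiField T E G} {ζ : E → MartingaleProcess ℱ P T G}
    (h : IsSimpleXi ϱ Ψ ζ) : IsMeasurableXi Ψ := by
  obtain ⟨κ, _, B, ψ, Z, h1, h2, h3⟩ := h
  rw [show Ψ = fun x => ∑ k, ((B k).indicator 1 x.2 : ℝ) • M.toField (ψ k) x.1 from funext h2]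
  refine IsMeasurableOperatorField.sum _ fun k _ => IsMeasurableOperatorField.smul ?_ ?_
  · exact (h1 k).2.2.isMeasurableOperatorField.comp measurable_fst
  · exact (measurable_one.indicator (h1 k).1).comp measurable_snd

theorem IsMeasurableXi.measurable_enorm {Φ : M.XiField T E G} (hΦ : IsMeasurableXi Φ) :
    Measurable fun x => ‖Φ x‖ₑ :=
  IsMeasurableOperatorField.measurable_enorm isMeasurableSeminorm_fst hΦ

theorem xiENorm_add_le {Φ Ψ : M.XiField T E G} (hΦ : IsMeasurableXi Φ) (hΨ : IsMeasurableXi Ψ) :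
    xiENorm ϱ (Φ + Ψ) ≤ xiENorm ϱ Φ + xiENorm ϱ Ψ :=
  (mixedENorm_mono fun x => enorm_add_le (Φ x) (Ψ x)).trans
    (mixedENorm_add_le hΦ.measurable_enorm hΨ.measurable_enorm)

theorem IsXiApprox.add {Φ Φ' : M.XiField T E G} (hΦ : IsMeasurableXi Φ) (hΦ' : IsMeasurableXi Φ')
    (h : IsXiApprox ϱ Φ) (h' : IsXiApprox ϱ Φ') : IsXiApprox ϱ (Φ + Φ') := by
  intro ε hε
  obtain ⟨Ψ, ζ, h1, h2⟩ := h (ε / 2) (ENNReal.half_pos hε.ne')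
  obtain ⟨Ψ', ζ', h1', h2'⟩ := h' (ε / 2) (ENNReal.half_pos hε.ne')
  refine ⟨Ψ + Ψ', ζ + ζ', h1.add h1', ?_⟩
  rw [add_sub_add_comm]
  refine (xiENorm_add_le (hΦ.sub h1.isMeasurableXi) (hΦ'.sub h1'.isMeasurableXi)).trans_lt ?_
  exact (ENNReal.add_lt_add h2 h2').trans_eq (ENNReal.add_halves ε)

/-- Dominated convergence preserves approximability. -/
theorem IsXiApprox.of_tendsto {Φ : M.XiField T E G} {Φn : ℕ → M.XiField T E G}
    (hΦ : IsMeasurableXi Φ) (hΦn : ∀ n, IsMeasurableXi (Φn n)) (h : ∀ n, IsXiApprox ϱ (Φn n))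
    {F : PredSpace ℱ T U × E → ℝ≥0∞} (hF : Measurable F)
    (hFfin : mixedENorm (M.predMeasure T) ϱ F ≠ ∞) (hle : ∀ n x, ‖Φ x - Φn n x‖ₑ ≤ F x)
    (hlim : ∀ e, ∀ᵐ p ∂(M.predMeasure T), Tendsto (fun n => Φn n (p, e)) atTop (𝓝 (Φ (p, e)))) :
    IsXiApprox ϱ Φ := by
  intro ε hε
  have h1 : Tendsto (fun n => xiENorm ϱ (Φ - Φn n)) atTop (𝓝 0) := by
    refine tendsto_mixedENorm_zero
      (fun n => IsMeasurableXi.measurable_enorm (Φ := Φ - Φn n) (hΦ.sub (hΦn n))) hF hle hFfin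
      fun e => ?_
    filter_upwards [hlim e] with p hp
    have h2 := ((tendsto_const_nhds (x := Φ (p, e))).sub hp).enorm
    simpa using h2
  obtain ⟨n, hn⟩ := (h1.eventually_lt_const (ENNReal.half_pos hε.ne')).exists
  obtain ⟨Ψ, ζ, h2, h3⟩ := h n (ε / 2) (ENNReal.half_pos hε.ne')
  refine ⟨Ψ, ζ, h2, ?_⟩
  rw [← sub_add_sub_cancel Φ (Φn n) Ψ]
  refine (xiENorm_add_le (hΦ.sub (hΦn n)) ((hΦn n).sub h2.isMeasurableXi)).trans_lt ?_
  exact (ENNReal.add_lt_add hn h3).trans_eq (ENNReal.add_halves ε)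

/-- The field `c(x) (k ↦ ⟨i_q h, k⟩ g)`. -/
def coefField (c : PredSpace ℱ T U × E → ℝ) (h : H) (g : G) : M.XiField T E G :=
  fun x => c x • HilbertSchmidt.rankOne ((M.predSeminorm T x.1).incl h) g

omit [BorelSpace U] in
theorem isMeasurableXi_coefField {c : PredSpace ℱ T U × E → ℝ} (hc : Measurable c) (h : H) (g : G) :
    IsMeasurableXi (coefField (M := M) c h g) :=
  ((IsGeneratedField.incl h).rankOne isMeasurableSeminorm_fst g).smul hc

/-- The box `(0, T] × Ω × A × B`. -/
def openBox (ℱ : Filtration ℝ≥0 mΩ) (T : ℝ≥0) (A : Set U) (B : Set E) :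
    Set (PredSpace ℱ T U × E) :=
  {x | (0 < x.1.1.1.1 ∧ x.1.2 ∈ A) ∧ x.2 ∈ B}

omit [BorelSpace U] in
theorem measurableSet_openBox {A : Set U} (hA : MeasurableSet A) {B : Set E}
    (hB : MeasurableSet B) : MeasurableSet (openBox ℱ T A B) :=
  ((measurable_predSpace_time.comp measurable_fst measurableSet_Ioi).inter
    (measurable_predSpace_snd.comp measurable_fst hA)).inter (measurable_snd hB)

omit [TopologicalSpace.SeparableSpace G] [TopologicalSpace.SeparableSpace H] in
-- The box has finite measure in the predictable and in the parameter direction. Constants on it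
-- serve as dominating functions.
theorem mixedENorm_openBox_lt_top {A : Set U} (hA : A ∈ M.ring) {B : Set E}
    (hB : MeasurableSet B) (hϱB : ϱ B < ∞) {K : ℝ≥0∞} (hK : K < ∞) :
    mixedENorm (M.predMeasure T) ϱ ((openBox ℱ T A B).indicator fun _ => K) < ∞ := by
  set S : Set (PredSpace ℱ T U) := {p | p.2 ∈ A} with hS
  have hSm : MeasurableSet S := measurable_predSpace_snd (measurableSet_of_mem_ring hA)
  have hSfin : M.predMeasure T S < ∞ := by
    have h1 : toPred ℱ ⁻¹' S = (Set.univ : Set (Set.Icc (0 : ℝ≥0) T × Ω)) ×ˢ A := by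
      ext p
      simp [hS, toPred]
    rw [predMeasure, Measure.map_apply measurable_toPred hSm, h1, prodMeasure, Measure.prod_prod]
    exact ENNReal.mul_lt_top (measure_lt_top _ _) (M.mu_lt_top A hA)
  have h2 : ∀ e, (∫⁻ p, (openBox ℱ T A B).indicator (fun _ => K) (p, e) ^ 2 ∂(M.predMeasure T))
      ^ (1 / 2 : ℝ) ≤ B.indicator (fun _ => (K ^ 2 * M.predMeasure T S) ^ (1 / 2 : ℝ)) e := by
    intro e
    by_cases he : e ∈ B
    · rw [Set.indicator_of_mem he, ← lintegral_indicator_const hSm]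
      gcongr with p
      by_cases hp : p ∈ S
      · rw [Set.indicator_of_mem hp]
        gcongr
        exact Set.indicator_le_self' (fun _ _ => zero_le) _
      · rw [Set.indicator_of_notMem (fun h => hp h.1.2)]
        simp
    · rw [Set.indicator_of_notMem he]
      have h3 : ∀ p : PredSpace ℱ T U, (openBox ℱ T A B).indicator (fun _ => K) (p, e) = 0 :=
        fun p => Set.indicator_of_notMem (fun h => he h.2) _
      simp [h3]
  refine (lintegral_mono h2).trans_lt ?_
  rw [lintegral_indicator_const hB]
  exact ENNReal.mul_lt_top (ENNReal.rpow_lt_top_of_nonneg (by norm_num) (by finiteness)) hϱB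

omit [BorelSpace U] [TopologicalSpace.SeparableSpace G] [TopologicalSpace.SeparableSpace H] in
theorem exists_enorm_rankOne_le (M : CylMartMeasure ℱ P H U) (T : ℝ≥0) (h : H) (g : G) :
    ∃ C : ℝ≥0∞, C < ∞ ∧ ∀ p : PredSpace ℱ T U,
      ‖HilbertSchmidt.rankOne ((M.predSeminorm T p).incl h) g‖ₑ ≤ C := by
  obtain ⟨C, hC0, hC⟩ := M.exists_val_le T
  refine ⟨ENNReal.ofReal (C * ‖h‖) * ‖g‖ₑ, by finiteness, fun p => ?_⟩
  rw [HilbertSchmidt.enorm_rankOne, ← ofReal_norm ((M.predSeminorm T p).incl h),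
    HilbertianSeminorm.norm_incl]
  gcongr
  exact hC _ p.1.1.2.2 _ _

section Box

variable {A : Set U} (hA : A ∈ M.ring) {B : Set E} (hB : MeasurableSet B) (hϱB : ϱ B < ∞)

include hA hB hϱB

/-- Dominated convergence: the coefficients differ by at most `2K` on the box and agree outside, and
the rank one fields are bounded uniformly in the point. -/
theorem isXiApprox_coefField_of_tendsto {c : PredSpace ℱ T U × E → ℝ}
    {cn : ℕ → PredSpace ℱ T U × E → ℝ} (hc : Measurable c) (hcn : ∀ n, Measurable (cn n))
    {K : ℝ} (hK : ∀ n x, ‖cn n x‖ ≤ K) (hsupp : ∀ n, ∀ x ∉ openBox ℱ T A B, cn n x = 0)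
    (hlim : ∀ x, Tendsto (fun n => cn n x) atTop (𝓝 (c x))) (h : H) (g : G)
    (happ : ∀ n, IsXiApprox ϱ (coefField (M := M) (cn n) h g)) :
    IsXiApprox ϱ (coefField (M := M) c h g) := by
  obtain ⟨C, hC, hCle⟩ := exists_enorm_rankOne_le M T h g
  refine IsXiApprox.of_tendsto (isMeasurableXi_coefField hc h g)
    (fun n => isMeasurableXi_coefField (hcn n) h g) happ
    (F := (openBox ℱ T A B).indicator fun _ => ENNReal.ofReal (2 * K) * C)
    (measurable_const.indicator (measurableSet_openBox (measurableSet_of_mem_ring hA) hB))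
    (mixedENorm_openBox_lt_top hA hB hϱB (by finiteness)).ne (fun n x => ?_) fun e => ?_
  · have h1 : coefField (M := M) c h g x - coefField (cn n) h g x
        = (c x - cn n x) • HilbertSchmidt.rankOne ((M.predSeminorm T x.1).incl h) g :=
      (sub_smul _ _ _).symm
    rw [h1]
    by_cases hx : x ∈ openBox ℱ T A B
    · rw [Set.indicator_of_mem hx, enorm_smul]
      refine mul_le_mul' ?_ (hCle x.1)
      rw [← ofReal_norm]
      refine ENNReal.ofReal_le_ofReal ((norm_sub_le _ _).trans ?_)
      have h2 := le_of_tendsto' (hlim x).norm fun n => hK n x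
      linarith [hK n x]
    · have h2 : c x = 0 := by
        refine tendsto_nhds_unique (hlim x) ?_
        simp only [fun n => hsupp n x hx]
        exact tendsto_const_nhds
      rw [h2, hsupp n x hx]
      simp
  · exact ae_of_all _ fun p => (hlim (p, e)).smul_const _

omit hϱB in
-- Inside the open box time is positive, so the generators at time 0 drop out, and `(i, ∞)` becomes
-- `(i, T]`, empty for `i ≥ T`. What is left is exactly a simple integrand.
theorem isXiApprox_boxes (hT : 0 < T)
    (hnull : ∀ N : Set Ω, P N = 0 → MeasurableSet[ℱ 0] N) (hϱB : ϱ B < ∞)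
    {D : Set (PredSpace ℱ T U × E)} (hD : D ∈ M.boxes T E) (h : H) (g : G) :
    IsXiApprox ϱ (coefField (M := M) ((D ∩ openBox ℱ T A B).indicator 1) h g) := by
  have hempty : D ∩ openBox ℱ T A B = ∅ →
      IsXiApprox ϱ (coefField (M := M) ((D ∩ openBox ℱ T A B).indicator 1) h g) := by
    intro h0
    have h1 : coefField (M := M) ((D ∩ openBox ℱ T A B).indicator 1) h g = 0 := by
      funext x
      simp [coefField, h0]
    rw [h1]
    exact .zero
  obtain ⟨D', ⟨D₁, hD₁, A', hA', rfl⟩, B', hB', rfl⟩ := hD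
  rcases hD₁ with ⟨F, hF, rfl⟩ | ⟨i, F, hF, rfl⟩
  · refine hempty (Set.eq_empty_of_forall_notMem fun x hx => ?_)
    exact hx.2.1.1.ne' hx.1.1.1.1
  rcases le_or_gt T i with hi | hi
  · refine hempty (Set.eq_empty_of_forall_notMem fun x hx => ?_)
    exact absurd (hx.1.1.1.1.trans_le x.1.1.1.2.2) (not_lt.2 hi)
  have hAA : A' ∩ A ∈ M.ring := by
    rcases hA' with rfl | hA'
    · rwa [Set.univ_inter]
    · exact M.isSetRing_ring.inter_mem hA' hA
  obtain ⟨X, hX⟩ := exists_isElementary_rect hT hnull hAA hi le_rfl hF h g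
  refine IsSimpleXi.isXiApprox (ζ := fun e => ∑ _k : Unit, ((B' ∩ B).indicator 1 e : ℝ) • X.rep)
    ⟨Unit, inferInstance, fun _ => B' ∩ B, fun _ r ω u => elemInd i T F (A' ∩ A) ((r, ω), u) •
      HilbertSchmidt.rankOne ((M.q r u).incl h) g, fun _ => X.rep, fun _ => ⟨hB'.inter hB,
      (measure_mono Set.inter_subset_right).trans_lt hϱB, ?_⟩, fun x => ?_, fun e => rfl⟩
  · rw [MartingaleSpace.mk_rep]
    exact hX
  · rw [Finset.univ_unique, Finset.sum_singleton]
    refine Eq.trans ?_ (smul_smul ((B' ∩ B).indicator 1 x.2 : ℝ) (elemInd i T F (A' ∩ A) x.1)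
      (HilbertSchmidt.rankOne ((M.predSeminorm T x.1).incl h) g)).symm
    refine congrArg (· • HilbertSchmidt.rankOne ((M.predSeminorm T x.1).incl h) g) ?_
    have h1 := elemInd_eq_indicator i T F (A' ∩ A) x.1
    have hx : (x ∈ (({p : Set.Icc (0 : ℝ≥0) T × Ω | i < p.1.1 ∧ p.2 ∈ F} ×ˢ A' :
        Set (PredSpace ℱ T U)) ×ˢ B') ∩ openBox ℱ T A B)
        ↔ x.2 ∈ B' ∩ B ∧ ((x.1.1.1.1 ∈ Set.Ioc i T ∧ x.1.1.2 ∈ F) ∧ x.1.2 ∈ A' ∩ A) := by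
      constructor
      · rintro ⟨⟨⟨⟨h1, h2⟩, h3⟩, h4⟩, ⟨h5, h6⟩, h7⟩
        exact ⟨⟨h4, h7⟩, ⟨⟨h1, x.1.1.1.2.2⟩, h2⟩, h3, h6⟩
      · rintro ⟨⟨h4, h7⟩, ⟨⟨h1, h8⟩, h2⟩, h3, h6⟩
        exact ⟨⟨⟨⟨h1, h2⟩, h3⟩, h4⟩, ⟨zero_le.trans_lt h1, h6⟩, h7⟩
    exact (indicator_one_eq_mul hx).trans (congrArg (((B' ∩ B).indicator 1 x.2 : ℝ) * ·) h1.symm)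

end Box

end CylMartMeasure
end

/-! ### Approximation: from boxes to all integrands. -/

noncomputable section

namespace CylMartMeasure

variable {Ω : Type*} {mΩ : MeasurableSpace Ω} {ℱ : Filtration ℝ≥0 mΩ} {P : Measure Ω}
  [IsProbabilityMeasure P] {T : ℝ≥0}
  {G : Type*} [NormedAddCommGroup G] [InnerProductSpace ℝ G] [CompleteSpace G]
  {H : Type*} [NormedAddCommGroup H] [InnerProductSpace ℝ H] [CompleteSpace H]
  {U : Type*} [TopologicalSpace U] [MeasurableSpace U]
  {M : CylMartMeasure ℱ P H U} {E : Type*} [MeasurableSpace E] {ϱ : Measure E}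

theorem coefField_add (c d : PredSpace ℱ T U × E → ℝ) (h : H) (g : G) :
    coefField (M := M) (c + d) h g = coefField c h g + coefField d h g :=
  funext fun _ => add_smul _ _ _

theorem coefField_zero (h : H) (g : G) :
    coefField (M := M) (0 : PredSpace ℱ T U × E → ℝ) h g = 0 :=
  funext fun _ => zero_smul _ _

theorem coefField_smul (a : ℝ) (c : PredSpace ℱ T U × E → ℝ) (h : H) (g : G) :
    coefField (M := M) (a • c) h g = coefField c (a • h) g := by
  funext x
  rw [coefField, coefField, map_smul, HilbertSchmidt.rankOne_smul_left, smul_smul, Pi.smul_apply,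
    smul_eq_mul, mul_comm]

variable [BorelSpace U] [TopologicalSpace.SeparableSpace G] [TopologicalSpace.SeparableSpace H]

section Box

variable {A : Set U} (hA : A ∈ M.ring) {B : Set E} (hB : MeasurableSet B) (hT : 0 < T)
  (hnull : ∀ N : Set Ω, P N = 0 → MeasurableSet[ℱ 0] N) (hϱB : ϱ B < ∞)

include hA hB hT hnull hϱB

theorem isXiApprox_openBox (h : H) (g : G) :
    IsXiApprox ϱ (coefField (M := M) ((openBox ℱ T A B).indicator 1) h g) := by
  have h1 := isXiApprox_boxes (M := M) (T := T) hA hB hT hnull hϱB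
    (Set.mem_image2_of_mem (Set.mem_image2_of_mem (Or.inr ⟨0, Set.univ, MeasurableSet.univ, rfl⟩)
      (Set.mem_insert _ _)) MeasurableSet.univ) h g
  rwa [Set.inter_eq_right.2] at h1
  exact fun x hx => ⟨⟨⟨hx.1.1, Set.mem_univ _⟩, Set.mem_univ _⟩, Set.mem_univ _⟩

/-- Dynkin's π-λ argument. The vector `h` is generalized because scalar factors are absorbed into
it. -/
theorem isXiApprox_measurableSet {D : Set (PredSpace ℱ T U × E)} (hD : MeasurableSet D) (h : H)
    (g : G) : IsXiApprox ϱ (coefField (M := M) ((D ∩ openBox ℱ T A B).indicator 1) h g) := by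
  have hbox := measurableSet_openBox (ℱ := ℱ) (T := T) (measurableSet_of_mem_ring hA) hB
  induction D, hD using MeasurableSpace.induction_on_inter
    (m := (inferInstance : MeasurableSpace (PredSpace ℱ T U × E)))
    (M.generateFrom_boxes T E) (M.isPiSystem_boxes T E) generalizing h with
  | empty =>
    rw [Set.empty_inter, Set.indicator_empty]
    rw [show (fun _ => 0 : PredSpace ℱ T U × E → ℝ) = 0 from rfl, coefField_zero]
    exact IsXiApprox.zero
  | basic D hD => exact isXiApprox_boxes hA hB hT hnull hϱB hD h g
  | compl D hD ih =>
    -- The complement is taken inside the box, where the norm stays finite; the factor `-1` moves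
    -- into `h`.
    have h1 : (Dᶜ ∩ openBox ℱ T A B).indicator (1 : PredSpace ℱ T U × E → ℝ)
        = (openBox ℱ T A B).indicator 1 + (-1 : ℝ) • (D ∩ openBox ℱ T A B).indicator 1 := by
      funext x
      by_cases h1 : x ∈ D <;> by_cases h2 : x ∈ openBox ℱ T A B <;> simp [h1, h2]
    rw [h1, coefField_add, coefField_smul]
    exact .add (isMeasurableXi_coefField (measurable_one.indicator hbox) _ _)
      (isMeasurableXi_coefField (measurable_one.indicator (hD.inter hbox)) _ _)
      (isXiApprox_openBox hA hB hT hnull hϱB h g) (ih _)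
  | iUnion f hf hfm ih =>
    -- Finite disjoint unions follow by additivity, and the countable union by dominated
    -- convergence.
    have hm : ∀ n, MeasurableSet ((⋃ i ∈ Finset.range n, f i) ∩ openBox ℱ T A B) := fun n =>
      (Finset.measurableSet_biUnion _ fun i _ => hfm i).inter hbox
    refine isXiApprox_coefField_of_tendsto hA hB hϱB
      (cn := fun n => ((⋃ i ∈ Finset.range n, f i) ∩ openBox ℱ T A B).indicator 1) (K := 1)
      (measurable_one.indicator ((MeasurableSet.iUnion hfm).inter hbox))
      (fun n => measurable_one.indicator (hm n)) (fun n x => ?_)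
      (fun n x hx => Set.indicator_of_notMem (fun h => hx h.2) _) (fun x => ?_) h g (fun n => ?_)
    · refine (norm_indicator_le_norm_self _ _).trans ?_
      simp
    · have h1 := ((tendsto_indicator_biUnion_finset f (1 : PredSpace ℱ T U × E → ℝ) x).mono_right
        (pure_le_nhds _)).comp tendsto_finset_range
      have h2 := h1.mul_const ((openBox ℱ T A B).indicator (1 : PredSpace ℱ T U × E → ℝ) x)
      simpa only [Set.inter_indicator_one, Pi.mul_apply, Function.comp_apply] using h2
    · induction n with
      | zero => simp only [Finset.range_zero, Finset.notMem_empty, Set.iUnion_of_empty, Set.iUnion_empty,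
        Set.empty_inter, Set.indicator_empty]; rw [show (fun _ => 0 : PredSpace ℱ T U × E → ℝ) = 0 from rfl, coefField_zero]; exact IsXiApprox.zero
      | succ n ihn =>
        have h1 : ((⋃ i ∈ Finset.range (n + 1), f i) ∩ openBox ℱ T A B).indicator (1 : PredSpace ℱ T U × E → ℝ)
            = (f n ∩ openBox ℱ T A B).indicator 1
              + ((⋃ i ∈ Finset.range n, f i) ∩ openBox ℱ T A B).indicator 1 := by
          rw [Finset.range_add_one, Finset.set_biUnion_insert, Set.union_inter_distrib_right]
          refine Set.indicator_union_of_disjoint ?_ _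
          refine Disjoint.mono Set.inter_subset_left Set.inter_subset_left ?_
          refine Set.disjoint_iUnion₂_right.2 fun i hi => hf ?_
          exact (Finset.mem_range.1 hi).ne'
        simp only [h1, coefField_add]
        exact .add (isMeasurableXi_coefField (measurable_one.indicator ((hfm n).inter hbox)) _ _)
          (isMeasurableXi_coefField (measurable_one.indicator (hm n)) _ _) (ih n h) ihn

theorem isXiApprox_simpleFunc (f : SimpleFunc (PredSpace ℱ T U × E) ℝ) (h : H) (g : G) :
    IsXiApprox ϱ (coefField (M := M) ((openBox ℱ T A B).indicator f) h g) := by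
  have hbox := measurableSet_openBox (ℱ := ℱ) (T := T) (measurableSet_of_mem_ring hA) hB
  induction f using SimpleFunc.induction generalizing h with
  | const a hD =>
    rename_i D
    have h1 : (openBox ℱ T A B).indicator
        ⇑(SimpleFunc.piecewise D hD (SimpleFunc.const _ a) (SimpleFunc.const _ 0))
        = a • (D ∩ openBox ℱ T A B).indicator (1 : PredSpace ℱ T U × E → ℝ) := by
      classical
      funext x
      by_cases h1 : x ∈ D <;> by_cases h2 : x ∈ openBox ℱ T A B <;> simp [h1, h2]
    rw [h1, coefField_smul]
    exact isXiApprox_measurableSet hA hB hT hnull hϱB hD _ g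
  | add _ ih ih' =>
    rename_i f f' _
    rw [SimpleFunc.coe_add, Set.indicator_add', coefField_add]
    exact .add (isMeasurableXi_coefField (f.measurable.indicator hbox) _ _)
      (isMeasurableXi_coefField (f'.measurable.indicator hbox) _ _) (ih h) (ih' h)

theorem isXiApprox_bounded {c : PredSpace ℱ T U × E → ℝ} (hc : Measurable c)
    (hsupp : ∀ x ∉ openBox ℱ T A B, c x = 0) {K : ℝ} (hK : ∀ x, ‖c x‖ ≤ K) (h : H) (g : G) :
    IsXiApprox ϱ (coefField (M := M) c h g) := by
  have hbox := measurableSet_openBox (ℱ := ℱ) (T := T) (measurableSet_of_mem_ring hA) hB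
  -- Truncation at level `K` requires `K ≥ 0`, which follows from the bound as soon as there is a
  -- point.
  have hK0 : 0 ≤ K ∨ IsEmpty (PredSpace ℱ T U × E) := by
    rcases isEmpty_or_nonempty (PredSpace ℱ T U × E) with h | ⟨⟨x⟩⟩
    · exact Or.inr h
    · exact Or.inl ((norm_nonneg _).trans (hK x))
  rcases hK0 with hK0 | hemp
  · refine isXiApprox_coefField_of_tendsto hA hB hϱB (K := K) hc
      (fun n => (SimpleFunc.measurable _).indicator hbox)
      (fun n x => (norm_indicator_le_norm_self _ _).trans
        (hc.stronglyMeasurable.norm_approxBounded_le hK0 n x))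
      (fun n x hx => Set.indicator_of_notMem hx _) (fun x => ?_) h g
      fun n => isXiApprox_simpleFunc hA hB hT hnull hϱB (hc.stronglyMeasurable.approxBounded K n) h g
    by_cases hx : x ∈ openBox ℱ T A B
    · simp only [Set.indicator_of_mem hx]
      exact hc.stronglyMeasurable.tendsto_approxBounded_of_norm_le (hK x)
    · simp only [Set.indicator_of_notMem hx, hsupp x hx]
      exact tendsto_const_nhds
  · have h1 : coefField (M := M) c h g = 0 := funext fun x => hemp.elim x
    rw [h1]
    exact IsXiApprox.zero

end Box

/-- `c Φ` can be approximated for all coefficients `c` that are small enough. -/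
def IsLocallyApprox (ϱ : Measure E) (Φ : M.XiField T E G) : Prop :=
  IsMeasurableXi Φ ∧ ∃ R : PredSpace ℱ T U × E → ℝ, Measurable R ∧ (∀ x, 0 ≤ R x) ∧
    ∀ A ∈ M.ring, ∀ B : Set E, MeasurableSet B → ϱ B < ∞ → ∀ c : PredSpace ℱ T U × E → ℝ,
      Measurable c → (∀ x ∉ openBox ℱ T A B, c x = 0) → (∃ K, ∀ x, |c x| * R x ≤ K) →
      IsXiApprox ϱ fun x => c x • Φ x

theorem IsLocallyApprox.zero : IsLocallyApprox ϱ (0 : M.XiField T E G) := by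
  refine ⟨IsSimpleXi.zero.isMeasurableXi (ϱ := ϱ), 0, measurable_zero, fun _ => le_rfl,
    fun A hA B hB hϱB c hc _ _ => ?_⟩
  have h : (fun x => c x • (0 : M.XiField T E G) x) = 0 := funext fun x => smul_zero _
  rw [h]
  exact IsXiApprox.zero

theorem IsLocallyApprox.add {Φ Ψ : M.XiField T E G} (hΦ : IsLocallyApprox ϱ Φ)
    (hΨ : IsLocallyApprox ϱ Ψ) : IsLocallyApprox ϱ fun x => Φ x + Ψ x := by
  obtain ⟨h1, R, hR, hR0, h2⟩ := hΦ
  obtain ⟨h1', R', hR', hR0', h2'⟩ := hΨ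
  refine ⟨h1.add h1', R + R', hR.add hR', fun x => add_nonneg (hR0 x) (hR0' x),
    fun A hA B hB hϱB c hc hsupp ⟨K, hK⟩ => ?_⟩
  simp only [smul_add]
  refine IsXiApprox.add (h1.smul hc) (h1'.smul hc) (h2 A hA B hB hϱB c hc hsupp ⟨K, fun x => ?_⟩)
    (h2' A hA B hB hϱB c hc hsupp ⟨K, fun x => ?_⟩)
  · refine le_trans ?_ (hK x)
    exact mul_le_mul_of_nonneg_left (le_add_of_nonneg_right (hR0' x)) (abs_nonneg _)
  · refine le_trans ?_ (hK x)
    exact mul_le_mul_of_nonneg_left (le_add_of_nonneg_left (hR0 x)) (abs_nonneg _)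

/-- The weight `R` becomes `|d| R`. Such weights allow unbounded coefficients, as Gram-Schmidt
produces them, without any integrability at this stage. -/
theorem IsLocallyApprox.smul {Φ : M.XiField T E G} (hΦ : IsLocallyApprox ϱ Φ)
    {d : PredSpace ℱ T U × E → ℝ} (hd : Measurable d) :
    IsLocallyApprox ϱ fun x => d x • Φ x := by
  obtain ⟨h1, R, hR, hR0, h2⟩ := hΦ
  refine ⟨h1.smul hd, fun x => |d x| * R x, hd.norm.mul hR,
    fun x => mul_nonneg (abs_nonneg _) (hR0 x), fun A hA B hB hϱB c hc hsupp ⟨K, hK⟩ => ?_⟩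
  simp only [smul_smul]
  refine h2 A hA B hB hϱB (fun x => c x * d x) (hc.mul hd)
    (fun x hx => by rw [hsupp x hx, zero_mul]) ⟨K, fun x => ?_⟩
  rw [abs_mul, mul_assoc]
  exact hK x

theorem IsLocallyApprox.sum {ι : Type*} (s : Finset ι) {Φ : ι → M.XiField T E G}
    (hΦ : ∀ i ∈ s, IsLocallyApprox ϱ (Φ i)) : IsLocallyApprox ϱ fun x => ∑ i ∈ s, Φ i x := by
  classical
  induction s using Finset.induction_on with
  | empty => exact IsLocallyApprox.zero
  | insert a s ha ih =>
    simp only [Finset.sum_insert ha]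
    exact (hΦ a (Finset.mem_insert_self a s)).add
      (ih fun i hi => hΦ i (Finset.mem_insert_of_mem hi))

/-- Induction over generated fields: constants are covered by bounded coefficients, and the class is
closed under sums and measurable multiples. -/
theorem isLocallyApprox_rankOne (hT : 0 < T)
    (hnull : ∀ N : Set Ω, P N = 0 → MeasurableSet[ℱ 0] N)
    {v : ∀ x : PredSpace ℱ T U × E, (M.predSeminorm T x.1).Space}
    (hv : IsGeneratedField (fun x : PredSpace ℱ T U × E => M.predSeminorm T x.1) v) (g : G) :
    IsLocallyApprox (M := M) ϱ fun x => HilbertSchmidt.rankOne (v x) g := by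
  refine IsGeneratedField.rec (motive := fun v _ => IsLocallyApprox (M := M) ϱ
    fun x => HilbertSchmidt.rankOne (v x) g) (fun h => ?_) (fun {v w} _ _ h1 h2 => ?_)
    (fun {c v} hc _ h1 => ?_) hv
  · refine ⟨(IsGeneratedField.incl h).rankOne isMeasurableSeminorm_fst g, 1, measurable_one,
      fun _ => zero_le_one, fun A hA B hB hϱB c hc hsupp ⟨K, hK⟩ => ?_⟩
    refine isXiApprox_bounded hA hB hT hnull hϱB hc hsupp (K := K) (fun x => ?_) h g
    have := hK x
    rwa [Pi.one_apply, mul_one] at this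
  · rw [show (fun x => HilbertSchmidt.rankOne (v x + w x) g) = fun x =>
      HilbertSchmidt.rankOne (v x) g + HilbertSchmidt.rankOne (w x) g from
      funext fun x => HilbertSchmidt.rankOne_add_left _ _ _]
    exact h1.add h2
  · rw [show (fun x => HilbertSchmidt.rankOne (c x • v x) g) = fun x =>
      c x • HilbertSchmidt.rankOne (v x) g from
      funext fun x => HilbertSchmidt.rankOne_smul_left _ _ _]
    exact h1.smul hc

theorem lamIcc_zero (M : CylMartMeasure ℱ P H U) (T : ℝ≥0) : M.lamIcc T {t : Set.Icc (0 : ℝ≥0) T | (t : ℝ≥0) = 0} = 0 := by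
  rw [lamIcc, (MeasurableEmbedding.subtype_coe measurableSet_Icc).comap_apply,
    Measure.restrict_apply' measurableSet_Ioc]
  convert measure_empty (μ := M.lam)
  refine Set.eq_empty_of_forall_notMem ?_
  rintro _ ⟨⟨t, ht, rfl⟩, h⟩
  exact h.1.ne' ht

/-- `λ` is restricted to `(0, T]`, so time 0 is null, and the sets `A n` cover `U` up to a null set.
Hence the cut-offs to open boxes exhaust the space. -/
theorem ae_mem_openBox {A : ℕ → Set U} (hA : ∀ n, A n ∈ M.ring) (hA0 : M.mu (⋃ n, A n)ᶜ = 0) :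
    ∀ᵐ p ∂(M.predMeasure T), 0 < p.1.1.1 ∧ p.2 ∈ ⋃ n, A n := by
  have hAm : MeasurableSet (⋃ n, A n) :=
    MeasurableSet.iUnion fun n => measurableSet_of_mem_ring (hA n)
  have h0 : MeasurableSet {p : PredSpace ℱ T U | 0 < p.1.1.1 ∧ p.2 ∈ ⋃ n, A n} :=
    (measurable_predSpace_time measurableSet_Ioi).inter (measurable_predSpace_snd hAm)
  refine (ae_map_iff measurable_toPred.aemeasurable h0).2 ?_
  have h1 : ∀ᵐ p ∂(M.prodMeasure T), p.2 ∈ ⋃ n, A n :=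
    Measure.quasiMeasurePreserving_snd.ae hA0
  have h2 : ∀ᵐ t : Set.Icc (0 : ℝ≥0) T ∂(M.lamIcc T), (t : ℝ≥0) ≠ 0 := by
    have := M.lamIcc_zero T
    simpa [ae_iff] using this
  have h3 : ∀ᵐ p ∂(M.prodMeasure T), (p.1.1 : ℝ≥0) ≠ 0 :=
    (Measure.quasiMeasurePreserving_fst (μ := (M.lamIcc T).prod P) (ν := M.mu)).ae
      ((Measure.quasiMeasurePreserving_fst (μ := M.lamIcc T) (ν := P)).ae h2)
  filter_upwards [h1, h3] with p hp hp'
  exact ⟨pos_iff_ne_zero.2 hp', hp⟩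

/-- Cut off to `R ≤ n`, to the first members of the cover and to a set of finite `ϱ` measure. The
cut-offs tend to 1 almost everywhere, and the errors are dominated by `‖Φ‖`. -/
theorem IsLocallyApprox.isXiApprox [SigmaFinite ϱ] {Φ : M.XiField T E G}
    (h : IsLocallyApprox ϱ Φ) (hfin : xiENorm ϱ Φ ≠ ∞) : IsXiApprox ϱ Φ := by
  obtain ⟨hΦ, R, hR, hR0, happ⟩ := h
  obtain ⟨A, hA, hA0⟩ := M.exists_cover
  have hbox : ∀ n : ℕ, MeasurableSet
      ({x | R x ≤ (n : ℝ)} ∩ openBox ℱ T (Set.accumulate A n) (spanningSets ϱ n)) := fun n =>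
    (measurableSet_le hR measurable_const).inter (measurableSet_openBox
      (measurableSet_of_mem_ring (M.isSetRing_ring.accumulate_mem hA n))
      (measurableSet_spanningSets ϱ n))
  set c : ℕ → PredSpace ℱ T U × E → ℝ := fun n =>
    ({x | R x ≤ (n : ℝ)} ∩ openBox ℱ T (Set.accumulate A n) (spanningSets ϱ n)).indicator 1 with hc
  have hcm : ∀ n, Measurable (c n) := fun n => measurable_one.indicator (hbox n)
  refine IsXiApprox.of_tendsto (Φn := fun n x => c n x • Φ x) hΦ (fun n => hΦ.smul (hcm n))
    (fun n => happ _ (M.isSetRing_ring.accumulate_mem hA n) _ (measurableSet_spanningSets ϱ n)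
      (measure_spanningSets_lt_top ϱ n) _ (hcm n)
      (fun x hx => Set.indicator_of_notMem (fun h => hx h.2) _) ⟨n, fun x => ?_⟩)
    hΦ.measurable_enorm hfin (fun n x => ?_) fun e => ?_
  · by_cases hx : x ∈ {x | R x ≤ (n : ℝ)} ∩ openBox ℱ T (Set.accumulate A n) (spanningSets ϱ n)
    · simpa [hc, Set.indicator_of_mem hx] using hx.1
    · simp [hc, Set.indicator_of_notMem hx]
  · by_cases hx : x ∈ {x | R x ≤ (n : ℝ)} ∩ openBox ℱ T (Set.accumulate A n) (spanningSets ϱ n)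
    · simp [hc, Set.indicator_of_mem hx]
    · simp [hc, Set.indicator_of_notMem hx]
  · filter_upwards [ae_mem_openBox hA hA0] with p hp
    obtain ⟨i, hi⟩ := Set.mem_iUnion.1 hp.2
    obtain ⟨j, hj⟩ := Set.mem_iUnion.1 ((iUnion_spanningSets ϱ).symm ▸ Set.mem_univ e)
    obtain ⟨k, hk⟩ := exists_nat_ge (R (p, e))
    refine tendsto_const_nhds.congr' ?_
    filter_upwards [eventually_ge_atTop i, eventually_ge_atTop j, eventually_ge_atTop k] with n hin
      hjn hkn
    have h1 : (p, e) ∈ {x | R x ≤ (n : ℝ)} ∩ openBox ℱ T (Set.accumulate A n) (spanningSets ϱ n) :=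
      ⟨hk.trans (Nat.cast_le.2 hkn), ⟨hp.1, Set.mem_accumulate.2 ⟨i, hin, hi⟩⟩,
        monotone_spanningSets ϱ hjn hj⟩
    simp [hc, Set.indicator_of_mem h1]

/-- Every integrand with a parameter can be approximated by simple ones. -/
theorem IsMeasurableXi.isXiApprox [SigmaFinite ϱ] (hT : 0 < T)
    (hnull : ∀ N : Set Ω, P N = 0 → MeasurableSet[ℱ 0] N) {Φ : M.XiField T E G}
    (hΦ : IsMeasurableXi Φ) (hfin : xiENorm ϱ Φ ≠ ∞) : IsXiApprox ϱ Φ := by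
  -- Truncation along the measurable Gram-Schmidt sequences yields finite sums of rank one fields;
  -- the errors tend to zero and are dominated by `2‖Φ‖`.
  set Φn : ℕ → M.XiField T E G := fun N x =>
    HilbertSchmidt.truncate (M.predSeminorm T x.1).orthoSeq (orthoSeq G) N (Φ x) with hΦn
  have hp := fun x : PredSpace ℱ T U × E => (M.predSeminorm T x.1).isParsevalSeq_orthoSeq
  have hG := isParsevalSeq_orthoSeq G
  have h1 : ∀ N, IsLocallyApprox ϱ (Φn N) := by
    intro N
    refine IsLocallyApprox.sum _ fun p _ => IsLocallyApprox.smul (isLocallyApprox_rankOne hT hnull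
      (IsGeneratedField.orthoSeq isMeasurableSeminorm_fst p.1) (orthoSeq G p.2)) ?_
    exact (IsGeneratedField.orthoSeq isMeasurableSeminorm_fst p.1).measurable_apply hΦ _
  refine IsXiApprox.of_tendsto hΦ (fun N => (h1 N).1) (fun N => (h1 N).isXiApprox ?_)
    (F := fun x => 2 * ‖Φ x‖ₑ) (hΦ.measurable_enorm.const_mul 2) ?_ (fun N x => ?_)
    fun e => ae_of_all _ fun p => HilbertSchmidt.tendsto_truncate (hp (p, e)) hG (Φ (p, e))
  · exact ((mixedENorm_mono fun x => HilbertSchmidt.enorm_truncate_le (hp x) hG N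
      (Φ x)).trans_lt hfin.lt_top).ne
  · rw [mixedENorm_const_mul (by simp)]
    exact ENNReal.mul_ne_top (by simp) hfin
  · refine enorm_sub_le.trans ?_
    rw [two_mul]
    exact add_le_add le_rfl (HilbertSchmidt.enorm_truncate_le (hp x) hG N (Φ x))

end CylMartMeasure
end

/-! ### Sections and Bochner integrals of integrands with a parameter. -/

noncomputable section

namespace CylMartMeasure

variable {Ω : Type*} {mΩ : MeasurableSpace Ω} {ℱ : Filtration ℝ≥0 mΩ} {P : Measure Ω}
  [IsProbabilityMeasure P] {T : ℝ≥0}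
  {G : Type*} [NormedAddCommGroup G] [InnerProductSpace ℝ G] [CompleteSpace G]
  {H : Type*} [NormedAddCommGroup H] [InnerProductSpace ℝ H] [CompleteSpace H]
  {U : Type*} [TopologicalSpace U] [MeasurableSpace U]
  {M : CylMartMeasure ℱ P H U} {E : Type*} [MeasurableSpace E] {ϱ : Measure E}

/-- The integrand `Φ(·, e)`. -/
def sect (Φ : M.XiField T E G) (e : E) : M.Integrand T G :=
  fun r ω u => Φ (toPred ℱ ((r, ω), u), e)

/-- The map `e ↦ Φ(r, ω, u, e)`, where `p = (r, ω, u)`. -/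
def slice (Φ : M.XiField T E G) (p : PredSpace ℱ T U) (e : E) :
    HilbertSchmidt (M.predSeminorm T p).Space G := Φ (p, e)

/-- The integrand `∫ Φ(·, e) ϱ(de)`. -/
def intXi (ϱ : Measure E) (Φ : M.XiField T E G) : M.Integrand T G :=
  fun r ω u => ∫ e, slice Φ (toPred ℱ ((r, ω), u)) e ∂ϱ

variable [BorelSpace U] [TopologicalSpace.SeparableSpace G] [TopologicalSpace.SeparableSpace H]

theorem lambdaENorm_eq_lintegral {Φ : M.Integrand T G}
    (hΦ : IsMeasurableOperatorField (M.toField Φ)) :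
    M.lambdaENorm Φ = (∫⁻ p, ‖M.toField Φ p‖ₑ ^ 2 ∂(M.predMeasure T)) ^ (1 / 2 : ℝ) := by
  rw [M.lambdaENorm_eq hΦ, eLpNorm_two_eq]
  simp only [enorm_norm]

theorem IsMeasurableXi.isMeasurable_sect {Φ : M.XiField T E G} (hΦ : IsMeasurableXi Φ) (e : E) :
    IsMeasurableOperatorField (M.toField (sect Φ e)) :=
  IsMeasurableOperatorField.comp (Φ := Φ) hΦ (f := fun p => (p, e)) measurable_prodMk_right

theorem xiENorm_eq {Φ : M.XiField T E G} (hΦ : IsMeasurableXi Φ) :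
    xiENorm ϱ Φ = ∫⁻ e, M.lambdaENorm (sect Φ e) ∂ϱ :=
  lintegral_congr fun e => (lambdaENorm_eq_lintegral (hΦ.isMeasurable_sect e)).symm

theorem IsMeasurableXi.measurable_lambdaENorm {Φ : M.XiField T E G} (hΦ : IsMeasurableXi Φ) :
    Measurable fun e => M.lambdaENorm (sect Φ e) := by
  have h : (fun e => M.lambdaENorm (sect Φ e))
      = fun e => (∫⁻ p, ‖Φ (p, e)‖ₑ ^ 2 ∂(M.predMeasure T)) ^ (1 / 2 : ℝ) :=
    funext fun e => lambdaENorm_eq_lintegral (hΦ.isMeasurable_sect e)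
  rw [h]
  exact measurable_rpow_lintegral_sq hΦ.measurable_enorm

theorem IsMeasurableXi.stronglyMeasurable_slice {Φ : M.XiField T E G} (hΦ : IsMeasurableXi Φ)
    (p : PredSpace ℱ T U) : StronglyMeasurable (slice Φ p) :=
  stronglyMeasurable_hilbertSchmidt (q := M.predSeminorm T p)
    (IsMeasurableOperatorField.comp (Φ := Φ) hΦ (f := fun e => (p, e)) measurable_prodMk_left)

variable [SFinite ϱ]

theorem IsMeasurableXi.measurable_lintegral_slice {Φ : M.XiField T E G} (hΦ : IsMeasurableXi Φ) :
    Measurable fun p => ∫⁻ e, ‖slice Φ p e‖ₑ ∂ϱ :=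
  hΦ.measurable_enorm.lintegral_prod_right'

/-- Minkowski's inequality. It is applied to the product measure, which is σ-finite, and transported
to the predictable σ-algebra. -/
theorem IsMeasurableXi.lintegral_slice_sq_le {Φ : M.XiField T E G} (hΦ : IsMeasurableXi Φ) :
    (∫⁻ p, (∫⁻ e, ‖slice Φ p e‖ₑ ∂ϱ) ^ 2 ∂(M.predMeasure T)) ^ (1 / 2 : ℝ) ≤ xiENorm ϱ Φ := by
  rw [lintegral_predMeasure_eq (hΦ.measurable_lintegral_slice.pow_const 2)]
  have h1 := lintegral_sq_lintegral_le (ν := M.prodMeasure T) (ϱ := ϱ)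
    (hΦ.measurable_enorm.comp ((measurable_toPred.comp measurable_fst).prodMk measurable_snd))
  refine h1.trans_eq (lintegral_congr fun e => ?_)
  exact congrArg (· ^ (1 / 2 : ℝ)) (lintegral_predMeasure_eq
    ((hΦ.measurable_enorm.comp measurable_prodMk_right).pow_const 2)).symm

theorem IsMeasurableXi.ae_integrable_slice {Φ : M.XiField T E G} (hΦ : IsMeasurableXi Φ)
    (hfin : xiENorm ϱ Φ ≠ ∞) : ∀ᵐ p ∂(M.predMeasure T), Integrable (slice Φ p) ϱ := by
  have h1 : ∫⁻ p, (∫⁻ e, ‖slice Φ p e‖ₑ ∂ϱ) ^ 2 ∂(M.predMeasure T) ≠ ∞ := by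
    intro h
    have h2 := hΦ.lintegral_slice_sq_le (ϱ := ϱ)
    rw [h, ENNReal.top_rpow_of_pos (by norm_num)] at h2
    exact hfin (top_le_iff.1 h2)
  filter_upwards [ae_lt_top (hΦ.measurable_lintegral_slice.pow_const 2) h1] with p hp
  refine ⟨(hΦ.stronglyMeasurable_slice p).aestronglyMeasurable, ?_⟩
  by_contra h2
  rw [not_lt_top_iff.1 h2] at hp
  simp at hp

/-- Matrix coefficients are continuous linear functionals and commute with the Bochner integral
where it exists. Elsewhere that integral is zero by convention, while the scalar one may exist;
hence the indicator of the set of integrability. -/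
theorem IsMeasurableXi.isMeasurable_intXi {Φ : M.XiField T E G} (hΦ : IsMeasurableXi Φ) :
    IsMeasurableOperatorField (M.toField (intXi ϱ Φ)) := by
  intro h g
  have hD : MeasurableSet {p : PredSpace ℱ T U | ∫⁻ e, ‖slice Φ p e‖ₑ ∂ϱ < ∞} :=
    hΦ.measurable_lintegral_slice measurableSet_Iio
  have h1 : Measurable fun p : PredSpace ℱ T U =>
      ∫ e, (inner ℝ (ContinuousLinearMap.adjoint (slice Φ p e).toCLM g)
        ((M.predSeminorm T p).incl h) : ℝ) ∂ϱ :=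
    (StronglyMeasurable.integral_prod_right' (ν := ϱ) (hΦ h g).stronglyMeasurable).measurable
  refine Eq.mp (congrArg Measurable (funext fun p => ?_)) (h1.indicator hD)
  have h2 : ∀ f : E → HilbertSchmidt (M.predSeminorm T p).Space G, Integrable f ϱ →
      ∫ e, (inner ℝ (ContinuousLinearMap.adjoint (f e).toCLM g)
        ((M.predSeminorm T p).incl h) : ℝ) ∂ϱ
        = inner ℝ (ContinuousLinearMap.adjoint (∫ e, f e ∂ϱ).toCLM g)
          ((M.predSeminorm T p).incl h) := by
    intro f hf
    simp only [ContinuousLinearMap.adjoint_inner_left]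
    exact ((innerSL ℝ g) ∘L (ContinuousLinearMap.apply ℝ G ((M.predSeminorm T p).incl h)) ∘L
      HilbertSchmidt.toCLML).integral_comp_comm hf
  by_cases hp : ∫⁻ e, ‖slice Φ p e‖ₑ ∂ϱ < ∞
  · refine (Set.indicator_of_mem (s := {p | ∫⁻ e, ‖slice Φ p e‖ₑ ∂ϱ < ∞}) hp _).trans ?_
    exact h2 _ ⟨(hΦ.stronglyMeasurable_slice p).aestronglyMeasurable, hp⟩
  · refine (Set.indicator_of_notMem (s := {p | ∫⁻ e, ‖slice Φ p e‖ₑ ∂ϱ < ∞}) hp _).trans ?_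
    have h3 : M.toField (intXi ϱ Φ) p = 0 :=
      integral_undef (f := slice Φ p) fun h => hp h.2
    rw [h3]
    simp

theorem IsMeasurableXi.lambdaENorm_intXi_le {Φ : M.XiField T E G} (hΦ : IsMeasurableXi Φ) :
    M.lambdaENorm (intXi ϱ Φ) ≤ xiENorm ϱ Φ := by
  rw [lambdaENorm_eq_lintegral hΦ.isMeasurable_intXi]
  refine le_trans (ENNReal.rpow_le_rpow (lintegral_mono fun p => ?_) (by norm_num))
    hΦ.lintegral_slice_sq_le
  exact pow_le_pow_left' (enorm_integral_le_lintegral_enorm (slice Φ p)) 2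

theorem IsMeasurableXi.isLambda2_intXi {Φ : M.XiField T E G} (hΦ : IsMeasurableXi Φ)
    (hfin : xiENorm ϱ Φ ≠ ∞) : M.IsLambda2 (intXi ϱ Φ) :=
  ⟨hΦ.isMeasurable_intXi, hΦ.lambdaENorm_intXi_le.trans_lt hfin.lt_top⟩

/-- Linearity of the Bochner integral holds where both slices are integrable, that is, almost
everywhere. -/
theorem lambdaENorm_intXi_sub_le {Φ Ψ : M.XiField T E G} (hΦ : IsMeasurableXi Φ)
    (hΨ : IsMeasurableXi Ψ) (hΦf : xiENorm ϱ Φ ≠ ∞) (hΨf : xiENorm ϱ Ψ ≠ ∞) :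
    M.lambdaENorm (intXi ϱ Φ - intXi ϱ Ψ) ≤ xiENorm ϱ (Φ - Ψ) := by
  have hd : IsMeasurableXi (Φ - Ψ) := IsMeasurableOperatorField.sub hΦ hΨ
  refine le_trans (le_of_eq ?_) (IsMeasurableXi.lambdaENorm_intXi_le hd)
  have hm : IsMeasurableOperatorField (M.toField (intXi ϱ Φ - intXi ϱ Ψ)) :=
    hΦ.isMeasurable_intXi.sub hΨ.isMeasurable_intXi
  rw [lambdaENorm_eq_lintegral hm, lambdaENorm_eq_lintegral (IsMeasurableXi.isMeasurable_intXi hd)]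
  congr 1
  refine lintegral_congr_ae ?_
  filter_upwards [hΦ.ae_integrable_slice hΦf, hΨ.ae_integrable_slice hΨf] with p h1 h2
  have h3 : M.toField (intXi ϱ Φ - intXi ϱ Ψ) p = M.toField (intXi ϱ (Φ - Ψ)) p :=
    (integral_sub h1 h2).symm
  rw [h3]

end CylMartMeasure
end

/-! ### Fubini for simple integrands with a parameter. -/

noncomputable section

namespace CylMartMeasure

variable {Ω : Type*} {mΩ : MeasurableSpace Ω} {ℱ : Filtration ℝ≥0 mΩ} {P : Measure Ω}
  [IsProbabilityMeasure P] {T : ℝ≥0}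
  {G : Type*} [NormedAddCommGroup G] [InnerProductSpace ℝ G] [CompleteSpace G]
  {H : Type*} [NormedAddCommGroup H] [InnerProductSpace ℝ H] [CompleteSpace H]
  {U : Type*} [TopologicalSpace U] [MeasurableSpace U]
  {M : CylMartMeasure ℱ P H U} {E : Type*} [MeasurableSpace E] {ϱ : Measure E}

theorem IsElementary.sum {κ : Type*} (s : Finset κ) {ψ : κ → M.Integrand T G}
    {X : κ → MartingaleSpace ℱ P T G} (h : ∀ k ∈ s, M.IsElementary (ψ k) (X k)) :
    M.IsElementary (∑ k ∈ s, ψ k) (∑ k ∈ s, X k) := by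
  classical
  induction s using Finset.induction_on with
  | empty => exact IsElementary.zero
  | insert a s ha ih =>
    rw [Finset.sum_insert ha, Finset.sum_insert ha]
    exact (h a (Finset.mem_insert_self a s)).add
      (ih fun i hi => h i (Finset.mem_insert_of_mem hi))

theorem IsElementary.sum_smul {κ : Type*} [Fintype κ] {c : κ → ℝ} {ψ : κ → M.Integrand T G}
    {X : κ → MartingaleSpace ℱ P T G} (h : ∀ k, M.IsElementary (ψ k) (X k))
    {Φ : M.Integrand T G} {Y : MartingaleSpace ℱ P T G}
    (hΦ : ∀ r ω u, Φ r ω u = ∑ k, c k • ψ k r ω u) (hY : Y = ∑ k, c k • X k) :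
    M.IsElementary Φ Y := by
  have h1 : Φ = ∑ k, c k • ψ k := by
    funext r ω u
    rw [hΦ, Finset.sum_apply, Finset.sum_apply, Finset.sum_apply]
    rfl
  rw [h1, hY]
  exact IsElementary.sum _ fun k _ => (h k).smul (c k)

namespace IsSimpleXi

variable {Ψ : M.XiField T E G} {ζ : E → MartingaleProcess ℱ P T G} (h : IsSimpleXi ϱ Ψ ζ)
include h

theorem isElementary_sect (e : E) :
    M.IsElementary (sect Ψ e) (SeparationQuotient.mk (ζ e)) := by
  obtain ⟨κ, _, B, ψ, Z, h1, h2, h3⟩ := h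
  refine IsElementary.sum_smul (c := fun k => (B k).indicator 1 e) (fun k => (h1 k).2.2)
    (fun r ω u => h2 (toPred ℱ ((r, ω), u), e)) ?_
  rw [h3]
  exact (map_sum (SeparationQuotient.mkCLM ℝ (MartingaleProcess ℱ P T G)) _ _).trans
    (Finset.sum_congr rfl fun k _ => map_smul _ _ _)

/-- Integrating `1_{B_k}` over `E` gives `ϱ(B_k)` both for the integrands and for their integrals.
The limiting argument starts from this identity. -/
theorem integrable_and_isElementary_integral [CompleteSpace (MartingaleSpace ℱ P T G)] :
    Integrable (fun e => SeparationQuotient.mk (ζ e)) ϱ ∧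
      M.IsElementary (intXi ϱ Ψ) (∫ e, SeparationQuotient.mk (ζ e) ∂ϱ) := by
  obtain ⟨κ, _, B, ψ, Z, h1, h2, h3⟩ := h
  have h4 : ∀ e, SeparationQuotient.mk (ζ e)
      = ∑ k, ((B k).indicator 1 e : ℝ) • SeparationQuotient.mk (Z k) := by
    intro e
    rw [h3]
    exact (map_sum (SeparationQuotient.mkCLM ℝ (MartingaleProcess ℱ P T G)) _ _).trans
      (Finset.sum_congr rfl fun k _ => map_smul _ _ _)
  have h5 : ∀ k, Integrable (fun e => ((B k).indicator 1 e : ℝ)) ϱ := fun k =>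
    (integrable_indicator_iff (h1 k).1).2 (integrableOn_const (h1 k).2.1.ne)
  have h6 : ∀ k, ∫ e, ((B k).indicator 1 e : ℝ) ∂ϱ = ϱ.real (B k) := fun k =>
    integral_indicator_one (h1 k).1
  simp only [h4]
  refine ⟨integrable_finsetSum _ fun k _ => (h5 k).smul_const _,
    IsElementary.sum_smul (c := fun k => ϱ.real (B k)) (fun k => (h1 k).2.2) (fun r ω u => ?_) ?_⟩
  · refine (integral_congr_ae (ae_of_all _ fun e => h2 (toPred ℱ ((r, ω), u), e))).trans ?_
    refine (integral_finsetSum _ fun k _ => (h5 k).smul_const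
      (M.toField (ψ k) (toPred ℱ ((r, ω), u)))).trans (Finset.sum_congr rfl fun k _ => ?_)
    refine (integral_smul_const _ (M.toField (ψ k) (toPred ℱ ((r, ω), u)))).trans ?_
    rw [h6]
    rfl
  · rw [integral_finsetSum _ fun k _ => (h5 k).smul_const _]
    refine Finset.sum_congr rfl fun k _ => ?_
    rw [integral_smul_const, h6]

theorem stronglyMeasurable_process (t : Set.Icc (0 : ℝ≥0) T) :
    StronglyMeasurable fun p : E × Ω => (ζ p.1).process t p.2 := by
  obtain ⟨κ, _, B, ψ, Z, h1, h2, h3⟩ := h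
  have h4 : (fun p : E × Ω => (ζ p.1).process t p.2)
      = fun p => ∑ k, ((B k).indicator 1 p.1 : ℝ) • (Z k).process t p.2 := by
    funext p
    rw [h3, map_sum, Finset.sum_apply, Finset.sum_apply]
    exact Finset.sum_congr rfl fun k _ => by rw [map_smul]; rfl
  rw [h4]
  refine Finset.stronglyMeasurable_fun_sum _ fun k _ => StronglyMeasurable.smul ?_ ?_
  · exact (stronglyMeasurable_one.indicator (h1 k).1).comp_measurable measurable_fst
  · exact ((Z k).stronglyMeasurable t).comp_measurable measurable_snd

variable [BorelSpace U] [TopologicalSpace.SeparableSpace G] [TopologicalSpace.SeparableSpace H]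

/-- The isometry read backwards: the norm of a section is the `L²` norm of its integral at `T`,
which is at most its norm in `𝓜²_T(G)`, an integrable function of `e`. -/
theorem xiENorm_ne_top [CompleteSpace (MartingaleSpace ℱ P T G)] : xiENorm ϱ Ψ ≠ ∞ := by
  rw [xiENorm_eq h.isMeasurableXi]
  refine ((lintegral_mono fun e => ?_).trans_lt h.integrable_and_isElementary_integral.1.2).ne
  rw [← (h.isElementary_sect e).eLpNorm_path]
  exact MartingaleSpace.eLpNorm_path_le _ _

end IsSimpleXi

/-- The geometric rate makes the errors summable for almost every `e`. -/
theorem IsXiApprox.exists_seq {Φ : M.XiField T E G} (h : IsXiApprox ϱ Φ) :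
    ∃ (Ψ : ℕ → M.XiField T E G) (ζ : ℕ → E → MartingaleProcess ℱ P T G),
      (∀ n, IsSimpleXi ϱ (Ψ n) (ζ n)) ∧ ∀ n, xiENorm ϱ (Φ - Ψ n) < 2⁻¹ ^ n := by
  choose Ψ ζ h1 h2 using fun n : ℕ => h (2⁻¹ ^ n) (ENNReal.pow_pos (by simp) n)
  exact ⟨Ψ, ζ, h1, h2⟩

end CylMartMeasure

/-! ### Jointly measurable pathwise limits. -/

section Limit

variable {Ω : Type*} {mΩ : MeasurableSpace Ω} {ℱ : Filtration ℝ≥0 mΩ} {P : Measure Ω}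
  [IsProbabilityMeasure P] {T : ℝ≥0}
  {G : Type*} [NormedAddCommGroup G] [InnerProductSpace ℝ G] [CompleteSpace G]
  {E : Type*} [MeasurableSpace E]

theorem stronglyMeasurable_iSup_dyadicSet {X : Set.Icc (0 : ℝ≥0) T → E × Ω → G}
    (hX : ∀ t, StronglyMeasurable (X t)) : Measurable fun p => ⨆ t ∈ dyadicSet T, ‖X t p‖ₑ :=
  Measurable.biSup _ (dyadicSet_countable T) fun t _ => (hX t).enorm

/-- The pathwise limit of a sequence of processes with a parameter can be chosen measurable. -/
theorem MartingaleProcess.exists_measurable_limit (hT : 0 < T)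
    {ζ : ℕ → E → MartingaleProcess ℱ P T G}
    (hζ : ∀ n t, StronglyMeasurable fun p : E × Ω => (ζ n p.1).process t p.2) :
    ∃ W : E → Set.Icc (0 : ℝ≥0) T → Ω → G,
      (∀ t, StronglyMeasurable fun p : E × Ω => W p.1 t p.2) ∧
      (∀ e ω, ∑' n, supENorm (ζ (n + 1) e - ζ n e).process ω ≠ ∞ →
        ∀ t, Tendsto (fun n => (ζ n e).process t ω) atTop (𝓝 (W e t ω))) ∧
      ∀ e ω, ∑' n, supENorm (ζ (n + 1) e - ζ n e).process ω = ∞ → ∀ t, W e t ω = 0 := by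
  classical
  set s : E × Ω → ℝ≥0∞ := fun p => ∑' n, supENorm (ζ (n + 1) p.1 - ζ n p.1).process p.2 with hs
  -- By càdlàg paths the suprema may be taken over dyadic times, so they are measurable in `(e, ω)`
  -- jointly.
  have hsm : Measurable s := by
    refine Measurable.tsum fun n => ?_
    have h1 : (fun p : E × Ω => supENorm (ζ (n + 1) p.1 - ζ n p.1).process p.2)
        = fun p => ⨆ t ∈ dyadicSet T, ‖(ζ (n + 1) p.1).process t p.2 - (ζ n p.1).process t p.2‖ₑ := by
      funext p
      refine (((ζ (n + 1) p.1 - ζ n p.1).process_mem.2.1 p.2).iSup_enorm_eq hT).trans ?_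
      rw [map_sub]
      rfl
    rw [h1]
    exact stronglyMeasurable_iSup_dyadicSet fun t => (hζ (n + 1) t).sub (hζ n t)
  have hlim : ∀ e ω, s (e, ω) ≠ ∞ → ∀ t, ∃ x, Tendsto (fun n => (ζ n e).process t ω) atTop (𝓝 x) := by
    intro e ω hfin t
    refine cauchySeq_tendsto_of_complete (cauchySeq_of_edist_le_of_tsum_ne_top
      (fun n => supENorm (ζ (n + 1) e - ζ n e).process ω) (fun n => ?_) hfin)
    rw [edist_comm, edist_eq_enorm_sub]
    have := le_iSup (fun t => ‖(ζ (n + 1) e - ζ n e).process t ω‖ₑ) t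
    rwa [map_sub] at this
  refine ⟨fun e t ω => if s (e, ω) = ∞ then 0 else limUnder atTop fun n => (ζ n e).process t ω,
    fun t => ?_, fun e ω h t => ?_, fun e ω h t => if_pos h⟩
  -- Cutting off on the measurable set where the series diverges turns `W` into an everywhere
  -- pointwise limit.
  · refine stronglyMeasurable_of_tendsto atTop
      (f := fun n => (s ⁻¹' {∞}ᶜ).indicator fun p => (ζ n p.1).process t p.2)
      (fun n => (hζ n t).indicator (hsm (measurableSet_singleton _).compl)) ?_
    refine tendsto_pi_nhds.2 fun p => ?_
    by_cases hp : s p = ∞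
    · simp [hp]
    · have h1 := tendsto_nhds_limUnder (hlim p.1 p.2 hp t)
      simpa [hp] using h1
  · have h1 := tendsto_nhds_limUnder (hlim e ω h t)
    simp only [show s (e, ω) ≠ ∞ from h, if_false]
    exact h1

end Limit
end

/-! ### Pathwise evaluation of Bochner integrals in `𝓜²_T(G)`. -/

noncomputable section

section Pathwise

variable {Ω : Type*} {mΩ : MeasurableSpace Ω} {ℱ : Filtration ℝ≥0 mΩ} {P : Measure Ω}
  [IsProbabilityMeasure P] {T : ℝ≥0}
  {G : Type*} [NormedAddCommGroup G] [InnerProductSpace ℝ G] [CompleteSpace G]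
  {E : Type*} [MeasurableSpace E] {ϱ : Measure E} [SFinite ϱ]
  {X : E → MartingaleSpace ℱ P T G} {J : E → Set.Icc (0 : ℝ≥0) T → Ω → G}

theorem IsMeasurableVersion.ae_eq_path (hJ : IsMeasurableVersion ϱ X J) :
    ∀ᵐ e ∂ϱ, ∀ᵐ ω ∂P, ∀ t, (X e).path t ω = J e t ω := by
  filter_upwards [hJ.2] with e ⟨Z, hZ, hZX⟩
  have h := MartingaleSpace.path_mk Z
  rwa [hZ, hZX] at h

/-- The dyadic supremum is measurable for all `e`, whereas it bounds the whole path only for the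
almost all `e` with càdlàg paths. -/
theorem IsMeasurableVersion.ae_enorm_le (hT : 0 < T) (hJ : IsMeasurableVersion ϱ X J) :
    ∀ᵐ e ∂ϱ, ∀ ω, IsCadlag (fun t => J e t ω) ∧
      ∀ t, ‖J e t ω‖ₑ ≤ ⨆ s ∈ dyadicSet T, ‖J e s ω‖ₑ := by
  filter_upwards [hJ.2] with e ⟨Z, hZ, hZX⟩ ω
  have h := Z.process_mem.2.1 ω
  rw [hZ] at h
  exact ⟨h, fun t => (le_iSup (fun t => ‖J e t ω‖ₑ) t).trans_eq (h.iSup_enorm_eq hT)⟩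

theorem IsMeasurableVersion.lintegral_le (hJ : IsMeasurableVersion ϱ X J) :
    ∫⁻ e, ∫⁻ ω, ⨆ s ∈ dyadicSet T, ‖J e s ω‖ₑ ∂P ∂ϱ ≤ ∫⁻ e, ‖X e‖ₑ ∂ϱ := by
  refine lintegral_mono_ae ?_
  filter_upwards [hJ.2] with e ⟨Z, hZ, hZX⟩
  have h1 : ‖X e‖ₑ = ‖Z‖ₑ := by
    rw [← hZX, ← ofReal_norm, ← ofReal_norm, SeparationQuotient.norm_mk]
  rw [h1]
  refine le_trans (lintegral_mono fun ω => ?_) Z.lintegral_supENorm_le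
  refine iSup₂_le fun s _ => ?_
  rw [← hZ]
  exact le_iSup (fun t => ‖Z.process t ω‖ₑ) s

/-- Tonelli turns integrability of `‖X e‖` into an integrable majorant in `e`, valid for all times
simultaneously, for almost every `ω`. -/
theorem IsMeasurableVersion.ae_lintegral_lt_top (hJ : IsMeasurableVersion ϱ X J)
    (hX : Integrable X ϱ) :
    ∀ᵐ ω ∂P, ∫⁻ e, ⨆ s ∈ dyadicSet T, ‖J e s ω‖ₑ ∂ϱ < ∞ := by
  have hS : Measurable fun p : E × Ω => ⨆ s ∈ dyadicSet T, ‖J p.1 s p.2‖ₑ :=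
    stronglyMeasurable_iSup_dyadicSet hJ.1
  have h1 := (hJ.lintegral_le).trans_lt hX.2
  rw [lintegral_lintegral_swap hS.aemeasurable] at h1
  exact ae_lt_top hS.lintegral_prod_left' h1.ne

theorem IsMeasurableVersion.integrable_prod (hT : 0 < T) (hJ : IsMeasurableVersion ϱ X J)
    (hX : Integrable X ϱ) (t : Set.Icc (0 : ℝ≥0) T) :
    Integrable (fun p : E × Ω => J p.1 t p.2) (ϱ.prod P) := by
  refine ⟨(hJ.1 t).aestronglyMeasurable, ?_⟩
  rw [HasFiniteIntegral, lintegral_prod _ (hJ.1 t).enorm.aemeasurable]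
  refine (lintegral_mono_ae ?_).trans_lt ((hJ.lintegral_le).trans_lt hX.2)
  filter_upwards [hJ.ae_enorm_le hT] with e he
  exact lintegral_mono fun ω => (he ω).2 t

/-- At a fixed time, the Bochner integral in `𝓜²_T(G)` can be computed pathwise. -/
theorem IsMeasurableVersion.integral_path_ae_eq [CompleteSpace (MartingaleSpace ℱ P T G)]
    (hT : 0 < T) (hJ : IsMeasurableVersion ϱ X J) (hX : Integrable X ϱ)
    (t : Set.Icc (0 : ℝ≥0) T) :
    (∫ e, X e ∂ϱ).path t =ᵐ[P] fun ω => ∫ e, J e t ω ∂ϱ := by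
  have hint := hJ.integrable_prod hT hX t
  -- It suffices to compare integrals over measurable `A`. The functional `X ↦ ∫_A X_t dP` is
  -- continuous, so it commutes with the Bochner integral, and Fubini on `E × A` does the rest.
  refine Integrable.ae_eq_of_forall_setIntegral_eq _ _
    ((MartingaleSpace.memLp_path _ t).integrable one_le_two) hint.integral_prod_right
    fun A hA _ => ?_
  have hr : Integrable (fun p : E × Ω => J p.1 t p.2) (ϱ.prod (P.restrict A)) := by
    have h := hint.restrict (s := Set.univ ×ˢ A)
    rwa [← Measure.prod_restrict, Measure.restrict_univ] at h
  calc ∫ ω in A, (∫ e, X e ∂ϱ).path t ω ∂P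
      = MartingaleSpace.setIntegralCLM A t (∫ e, X e ∂ϱ) := rfl
    _ = ∫ e, MartingaleSpace.setIntegralCLM A t (X e) ∂ϱ :=
        ((MartingaleSpace.setIntegralCLM A t).integral_comp_comm hX).symm
    _ = ∫ e, ∫ ω in A, J e t ω ∂P ∂ϱ := by
        refine integral_congr_ae ?_
        filter_upwards [hJ.ae_eq_path] with e he
        exact integral_congr_ae (ae_restrict_of_ae (he.mono fun ω h => h t))
    _ = ∫ ω in A, ∫ e, J e t ω ∂ϱ ∂P := integral_integral_swap hr

theorem MartingaleSpace.isCadlag_path (X : MartingaleSpace ℱ P T G) (ω : Ω) :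
    IsCadlag fun t => X.path t ω :=
  X.rep.process_mem.2.1 ω

theorem dyadicRight_le (t : Set.Icc (0 : ℝ≥0) T) : dyadicRight t ≤ 𝓝[Set.Ici t] t :=
  inf_le_left.trans (nhdsWithin_mono _ Set.Ioi_subset_Ici_self)

/-- Dominated convergence with the supremum over dyadic times as majorant and right continuity of `J
e · ω`. -/
theorem IsMeasurableVersion.tendsto_integral (hT : 0 < T) (hJ : IsMeasurableVersion ϱ X J) (ω : Ω)
    (hω : ∫⁻ e, ⨆ s ∈ dyadicSet T, ‖J e s ω‖ₑ ∂ϱ < ∞) (t : Set.Icc (0 : ℝ≥0) T) :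
    Tendsto (fun s => ∫ e, J e s ω ∂ϱ) (dyadicRight t) (𝓝 (∫ e, J e t ω ∂ϱ)) := by
  have hSω : Measurable fun e => ⨆ s ∈ dyadicSet T, ‖J e s ω‖ₑ :=
    Measurable.biSup _ (dyadicSet_countable T) fun s _ =>
      ((hJ.1 s).comp_measurable measurable_prodMk_right).enorm
  have : (dyadicRight t).IsCountablyGenerated :=
    inferInstanceAs (𝓝[>] t ⊓ 𝓟 (dyadicSet T)).IsCountablyGenerated
  have h1 : Integrable (fun e => (⨆ s ∈ dyadicSet T, ‖J e s ω‖ₑ).toReal) ϱ :=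
    integrable_toReal_of_lintegral_ne_top hSω.aemeasurable hω.ne
  have h2 : ∀ s, AEStronglyMeasurable (fun e => J e s ω) ϱ := fun s =>
    ((hJ.1 s).comp_measurable measurable_prodMk_right).aestronglyMeasurable
  have h3 : ∀ s, ∀ᵐ e ∂ϱ, ‖J e s ω‖ ≤ (⨆ s ∈ dyadicSet T, ‖J e s ω‖ₑ).toReal := by
    intro s
    filter_upwards [hJ.ae_enorm_le hT, ae_lt_top hSω hω.ne] with e he he'
    rw [← toReal_enorm]
    exact ENNReal.toReal_mono he'.ne ((he ω).2 s)
  have h4 : ∀ᵐ e ∂ϱ, Tendsto (fun s => J e s ω) (dyadicRight t) (𝓝 (J e t ω)) := by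
    filter_upwards [hJ.ae_enorm_le hT] with e he
    exact ((he ω).1 t).1.tendsto.mono_left (dyadicRight_le t)
  exact tendsto_integral_filter_of_dominated_convergence _ (Eventually.of_forall h2)
    (Eventually.of_forall h3) h1 h4

/-- The Bochner integral in `𝓜²_T(G)` can be computed pathwise. -/
theorem IsMeasurableVersion.integral_path [CompleteSpace (MartingaleSpace ℱ P T G)]
    (hT : 0 < T) (hJ : IsMeasurableVersion ϱ X J) (hX : Integrable X ϱ) :
    ∀ᵐ ω ∂P, ∀ t, Integrable (fun e => J e t ω) ϱ ∧
      (∫ e, X e ∂ϱ).path t ω = ∫ e, J e t ω ∂ϱ := by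
  -- One null set serves the countably many dyadic times; both sides being right limits along these
  -- times, equality extends to every `t`.
  have hD : ∀ᵐ ω ∂P, ∀ t ∈ dyadicSet T, (∫ e, X e ∂ϱ).path t ω = ∫ e, J e t ω ∂ϱ :=
    (ae_ball_iff (dyadicSet_countable T)).2 fun t _ => hJ.integral_path_ae_eq hT hX t
  filter_upwards [hD, hJ.ae_lintegral_lt_top hX] with ω h1 h2 t
  have hm : ∀ s, AEStronglyMeasurable (fun e => J e s ω) ϱ := fun s =>
    ((hJ.1 s).comp_measurable measurable_prodMk_right).aestronglyMeasurable
  refine ⟨⟨hm t, (lintegral_mono_ae ?_).trans_lt h2⟩, ?_⟩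
  · filter_upwards [hJ.ae_enorm_le hT] with e he using (he ω).2 t
  rcases eq_or_lt_of_le (le_lastTime t) with h | h
  · rw [h]
    exact h1 _ (lastTime_mem_dyadicSet T)
  have := dyadicRight_neBot hT h
  have h3 : Tendsto (fun s => (∫ e, X e ∂ϱ).path s ω) (dyadicRight t)
      (𝓝 ((∫ e, X e ∂ϱ).path t ω)) :=
    (((∫ e, X e ∂ϱ).isCadlag_path ω) t).1.tendsto.mono_left (dyadicRight_le t)
  refine tendsto_nhds_unique (h3.congr' ?_) (hJ.tendsto_integral hT ω h2 t)
  have h5 : dyadicSet T ∈ dyadicRight t := mem_inf_of_right (mem_principal_self _)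
  filter_upwards [h5] with s hs using h1 s hs

end Pathwise
end

/-! ### Passage to the limit and the theorem. -/

noncomputable section

theorem MartingaleSpace.enorm_mk {Ω : Type*} {mΩ : MeasurableSpace Ω} {ℱ : Filtration ℝ≥0 mΩ}
    {P : Measure Ω} {T : ℝ≥0}
    {G : Type*} [NormedAddCommGroup G] [InnerProductSpace ℝ G] [CompleteSpace G]
    (Z : MartingaleProcess ℱ P T G) :
    ‖(SeparationQuotient.mk Z : MartingaleSpace ℱ P T G)‖ₑ = ‖Z‖ₑ := by
  rw [← ofReal_norm, ← ofReal_norm, SeparationQuotient.norm_mk]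

namespace CylMartMeasure

variable {Ω : Type*} {mΩ : MeasurableSpace Ω} {ℱ : Filtration ℝ≥0 mΩ} {P : Measure Ω}
  [IsProbabilityMeasure P] {T : ℝ≥0}
  {G : Type*} [NormedAddCommGroup G] [InnerProductSpace ℝ G] [CompleteSpace G]
  {H : Type*} [NormedAddCommGroup H] [InnerProductSpace ℝ H] [CompleteSpace H]
  {U : Type*} [TopologicalSpace U] [MeasurableSpace U]
  {M : CylMartMeasure ℱ P H U} {E : Type*} [MeasurableSpace E] {ϱ : Measure E}
  [BorelSpace U] [TopologicalSpace.SeparableSpace G] [TopologicalSpace.SeparableSpace H]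

omit [IsProbabilityMeasure P] [BorelSpace U] [TopologicalSpace.SeparableSpace G]
  [TopologicalSpace.SeparableSpace H] in
theorem sect_sub (Φ Ψ : M.XiField T E G) (e : E) : sect (Φ - Ψ) e = sect Φ e - sect Ψ e := rfl

theorem IsElementary.isStochasticIntegral {Ψ : M.Integrand T G} {X : MartingaleSpace ℱ P T G}
    (h : M.IsElementary Ψ X) : M.IsStochasticIntegral Ψ X := by
  refine ⟨h.isLambda2, fun ε hε => ⟨Ψ, X, h.isSimpleIntegral, ?_, ?_⟩⟩
  · rw [sub_self]
    simpa [lambdaENorm] using hε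
  · rw [sub_self]
    simpa using hε

theorem IsStochasticIntegral.enorm_le (hT : 0 < T) {Φ : M.Integrand T G}
    {X : MartingaleSpace ℱ P T G} (h : M.IsStochasticIntegral Φ X) :
    ‖X‖ₑ ≤ 2 * M.lambdaENorm Φ := by
  have := h.enorm_sub_le hT IsElementary.zero.isStochasticIntegral
  rwa [sub_zero, sub_zero] at this

theorem IsMeasurableXi.ae_isLambda2 {Φ : M.XiField T E G} (hΦ : IsMeasurableXi Φ)
    (hfin : xiENorm ϱ Φ ≠ ∞) : ∀ᵐ e ∂ϱ, M.IsLambda2 (sect Φ e) := by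
  rw [xiENorm_eq hΦ] at hfin
  filter_upwards [ae_lt_top hΦ.measurable_lambdaENorm hfin] with e he
  exact ⟨hΦ.isMeasurable_sect e, he⟩

section Sequence

variable {Φ : M.XiField T E G} (hΦ : IsMeasurableXi Φ) {Ψ : ℕ → M.XiField T E G}
  {ζ : ℕ → E → MartingaleProcess ℱ P T G} (hΨ : ∀ n, IsSimpleXi ϱ (Ψ n) (ζ n))
  (hlt : ∀ n, xiENorm ϱ (Φ - Ψ n) < 2⁻¹ ^ n)

include hΦ hΨ

theorem isMeasurableXi_sub (n : ℕ) : IsMeasurableXi (Φ - Ψ n) :=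
  IsMeasurableOperatorField.sub hΦ (hΨ n).isMeasurableXi

include hlt

/-- The errors integrate over `E` to at most `2⁻ⁿ`, so their sum is integrable and hence finite
almost everywhere. -/
theorem ae_tsum_lambdaENorm_ne_top :
    ∀ᵐ e ∂ϱ, ∑' n, M.lambdaENorm (sect Φ e - sect (Ψ n) e) ≠ ∞ := by
  have hm : ∀ n, Measurable fun e => M.lambdaENorm (sect Φ e - sect (Ψ n) e) := by
    intro n
    simp only [← sect_sub]
    exact IsMeasurableXi.measurable_lambdaENorm (isMeasurableXi_sub hΦ hΨ n)
  have h1 : ∫⁻ e, ∑' n, M.lambdaENorm (sect Φ e - sect (Ψ n) e) ∂ϱ ≠ ∞ := by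
    rw [lintegral_tsum fun n => (hm n).aemeasurable]
    have h2 : ∀ n, ∫⁻ e, M.lambdaENorm (sect Φ e - sect (Ψ n) e) ∂ϱ ≤ 2⁻¹ ^ n := fun n =>
      (xiENorm_eq (isMeasurableXi_sub hΦ hΨ n)).symm.le.trans (hlt n).le
    refine ((ENNReal.tsum_le_tsum h2).trans_lt ?_).ne
    rw [ENNReal.tsum_geometric, ENNReal.one_sub_inv_two]
    simp
  filter_upwards [ae_lt_top (Measurable.tsum hm) h1] with e he using he.ne

/-- Consecutive approximants differ by at most twice the sum of their two errors, by the bound for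
simple integrals. -/
theorem tsum_enorm_sub_ne_top (hT : 0 < T) {e : E}
    (he : ∑' n, M.lambdaENorm (sect Φ e - sect (Ψ n) e) ≠ ∞) :
    ∑' n, ‖ζ (n + 1) e - ζ n e‖ₑ ≠ ∞ := by
  have h1 : ∀ n, ‖ζ (n + 1) e - ζ n e‖ₑ ≤ 2 * (M.lambdaENorm (sect Φ e - sect (Ψ (n + 1)) e)
      + M.lambdaENorm (sect Φ e - sect (Ψ n) e)) := by
    intro n
    rw [← MartingaleSpace.enorm_mk, SeparationQuotient.mk_sub]
    refine ((((hΨ (n + 1)).isElementary_sect e).sub ((hΨ n).isElementary_sect e)).enorm_le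
      hT).trans ?_
    refine mul_le_mul_right ?_ _
    rw [lambdaENorm_sub_comm (sect Φ e)]
    exact lambdaENorm_triangle M ((hΨ (n + 1)).isMeasurableXi.isMeasurable_sect e)
      (hΦ.isMeasurable_sect e) ((hΨ n).isMeasurableXi.isMeasurable_sect e)
  refine ((ENNReal.tsum_le_tsum h1).trans_lt ?_).ne
  rw [ENNReal.tsum_mul_left, ENNReal.tsum_add]
  have h2 := (ENNReal.tsum_comp_le_tsum_of_injective (add_left_injective 1)
    fun n => M.lambdaENorm (sect Φ e - sect (Ψ n) e)).trans_lt he.lt_top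
  exact ENNReal.mul_lt_top (by simp) (ENNReal.add_lt_top.2 ⟨h2, he.lt_top⟩)

/-- The measurable pathwise limit `W` is fixed before `e`. For almost every `e` the series of
increments converges in norm, so `W e` represents the limit martingale, which is the stochastic
integral of the section. -/
theorem exists_version_of_seq (hT : 0 < T)
    (hnull : ∀ N : Set Ω, P N = 0 → MeasurableSet[ℱ 0] N) (hfin : xiENorm ϱ Φ ≠ ∞) :
    ∃ W : E → Set.Icc (0 : ℝ≥0) T → Ω → G,
      (∀ t, StronglyMeasurable fun p : E × Ω => W p.1 t p.2) ∧
      ∀ᵐ e ∂ϱ, ∃ Y : MartingaleProcess ℱ P T G, Y.process = W e ∧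
        M.IsStochasticIntegral (sect Φ e) (SeparationQuotient.mk Y) ∧
        Tendsto (fun n => SeparationQuotient.mk (ζ n e)) atTop
          (𝓝 (SeparationQuotient.mk Y : MartingaleSpace ℱ P T G)) := by
  obtain ⟨W, hW1, hW2, hW3⟩ := MartingaleProcess.exists_measurable_limit hT (ζ := ζ)
    fun n t => (hΨ n).stronglyMeasurable_process t
  refine ⟨W, hW1, ?_⟩
  filter_upwards [ae_tsum_lambdaENorm_ne_top hΦ hΨ hlt, hΦ.ae_isLambda2 hfin] with e he hΛ
  obtain ⟨Y, hY1, hY2⟩ := MartingaleProcess.exists_limit hT hnull (fun n => ζ n e)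
    (tsum_enorm_sub_ne_top hΦ hΨ hlt hT he) (hW2 e) (hW3 e)
  have h1 : Tendsto (fun n => ‖(SeparationQuotient.mk Y : MartingaleSpace ℱ P T G)
      - SeparationQuotient.mk (ζ n e)‖ₑ) atTop (𝓝 0) := by
    refine hY2.congr fun n => ?_
    rw [← SeparationQuotient.mk_sub, MartingaleSpace.enorm_mk, enorm_sub_rev]
  refine ⟨Y, hY1, isStochasticIntegral_of_tendsto hΛ (fun n => (hΨ n).isElementary_sect e)
    (ENNReal.tendsto_atTop_zero_of_tsum_ne_top he) h1, ?_⟩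
  rw [tendsto_iff_edist_tendsto_0]
  simp only [edist_eq_enorm_sub]
  exact h1.congr fun n => enorm_sub_rev _ _

end Sequence

variable [SigmaFinite ϱ] (hT : 0 < T) (hnull : ∀ N : Set Ω, P N = 0 → MeasurableSet[ℱ 0] N)
  {Φ : M.XiField T E G} (hΦ : IsMeasurableXi Φ) (hfin : xiENorm ϱ Φ ≠ ∞)

include hT hnull hΦ hfin

theorem ae_isStochasticIntegral : ∀ᵐ e ∂ϱ,
    M.IsStochasticIntegral (sect Φ e) (M.stochasticIntegral (sect Φ e)) := by
  obtain ⟨Ψ, ζ, hΨ, hlt⟩ := (hΦ.isXiApprox hT hnull hfin).exists_seq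
  obtain ⟨W, hW, h⟩ := exists_version_of_seq hΦ hΨ hlt hT hnull hfin
  filter_upwards [h] with e ⟨Y, hY, hI, hlim⟩
  rwa [hI.stochasticIntegral_eq hT]

theorem exists_isMeasurableVersion : ∃ J : E → Set.Icc (0 : ℝ≥0) T → Ω → G,
    IsMeasurableVersion ϱ (fun e => M.stochasticIntegral (sect Φ e)) J := by
  obtain ⟨Ψ, ζ, hΨ, hlt⟩ := (hΦ.isXiApprox hT hnull hfin).exists_seq
  obtain ⟨W, hW, h⟩ := exists_version_of_seq hΦ hΨ hlt hT hnull hfin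
  refine ⟨W, hW, ?_⟩
  filter_upwards [h] with e ⟨Y, hY, hI, hlim⟩
  exact ⟨Y, hY, (hI.stochasticIntegral_eq hT).symm⟩

/-- Almost everywhere the integrals are limits of those of the approximants, which are simple
functions of `e` with values in `𝓜²_T(G)`; this gives strong measurability. The norm is dominated by
`2‖Φ(e)‖`. -/
theorem integrable_stochasticIntegral :
    Integrable (fun e => M.stochasticIntegral (sect Φ e)) ϱ := by
  have := MartingaleSpace.completeSpace (P := P) (G := G) hT hnull
  obtain ⟨Ψ, ζ, hΨ, hlt⟩ := (hΦ.isXiApprox hT hnull hfin).exists_seq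
  obtain ⟨W, hW, h⟩ := exists_version_of_seq hΦ hΨ hlt hT hnull hfin
  refine ⟨aestronglyMeasurable_of_tendsto_ae atTop
    (fun n => (hΨ n).integrable_and_isElementary_integral.1.aestronglyMeasurable) ?_, ?_⟩
  · filter_upwards [h] with e ⟨Y, hY, hI, hlim⟩
    rwa [hI.stochasticIntegral_eq hT]
  · have h1 : ∫⁻ e, 2 * M.lambdaENorm (sect Φ e) ∂ϱ < ∞ := by
      rw [lintegral_const_mul _ hΦ.measurable_lambdaENorm, ← xiENorm_eq hΦ]
      exact ENNReal.mul_lt_top (by simp) hfin.lt_top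
    refine (lintegral_mono_ae ?_).trans_lt h1
    filter_upwards [ae_isStochasticIntegral hT hnull hΦ hfin] with e he using he.enorm_le hT

/-- The stochastic integral of `∫ Φ(·, e) ϱ(de)` is the Bochner integral of the stochastic
integrals. -/
theorem isStochasticIntegral_intXi : M.IsStochasticIntegral (intXi ϱ Φ)
    (∫ e, M.stochasticIntegral (sect Φ e) ∂ϱ) := by
  have := MartingaleSpace.completeSpace (P := P) (G := G) hT hnull
  obtain ⟨Ψ, ζ, hΨ, hlt⟩ := (hΦ.isXiApprox hT hnull hfin).exists_seq
  have hS := fun n => (hΨ n).integrable_and_isElementary_integral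
  have h0 : Tendsto (fun n => xiENorm ϱ (Φ - Ψ n)) atTop (𝓝 0) :=
    tendsto_of_tendsto_of_tendsto_of_le_of_le tendsto_const_nhds
      (ENNReal.tendsto_pow_atTop_nhds_zero_of_lt_one (by simp)) (fun _ => zero_le)
      fun n => (hlt n).le
  have h2 : Tendsto (fun n => 2 * xiENorm ϱ (Φ - Ψ n)) atTop (𝓝 0) := by
    simpa using ENNReal.Tendsto.const_mul h0 (Or.inr (by simp : (2 : ℝ≥0∞) ≠ ∞))
  -- The integrals over `E` of the simple `Ψ n` approximate on both sides: the integrands by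
  -- Minkowski, the martingales by the bound with factor 2.
  refine isStochasticIntegral_of_tendsto (hΦ.isLambda2_intXi hfin) (fun n => (hS n).2)
    (tendsto_of_tendsto_of_tendsto_of_le_of_le tendsto_const_nhds h0 (fun _ => zero_le)
      fun n => lambdaENorm_intXi_sub_le hΦ (hΨ n).isMeasurableXi hfin (hΨ n).xiENorm_ne_top)
    (tendsto_of_tendsto_of_tendsto_of_le_of_le tendsto_const_nhds h2 (fun _ => zero_le)
      fun n => ?_)
  have hd := isMeasurableXi_sub hΦ hΨ n
  change _ ≤ 2 * xiENorm ϱ (Φ - Ψ n)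
  rw [← integral_sub (integrable_stochasticIntegral hT hnull hΦ hfin) (hS n).1, xiENorm_eq hd,
    ← lintegral_const_mul _ (IsMeasurableXi.measurable_lambdaENorm hd)]
  refine (enorm_integral_le_lintegral_enorm _).trans (lintegral_mono_ae ?_)
  filter_upwards [ae_isStochasticIntegral hT hnull hΦ hfin] with e he
  exact he.enorm_sub_le hT ((hΨ n).isElementary_sect e).isStochasticIntegral

end CylMartMeasure

theorem mainTheorem5
    {Ω : Type*} {mΩ : MeasurableSpace Ω} {P : Measure Ω} [IsProbabilityMeasure P]
    {ℱ : Filtration ℝ≥0 mΩ} [ℱ.IsRightContinuous]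
    (hnull : ∀ N : Set Ω, P N = 0 → MeasurableSet[ℱ 0] N)
    {H : Type*} [NormedAddCommGroup H] [InnerProductSpace ℝ H] [CompleteSpace H]
    [TopologicalSpace.SeparableSpace H]
    {G : Type*} [NormedAddCommGroup G] [InnerProductSpace ℝ G] [CompleteSpace G]
    [TopologicalSpace.SeparableSpace G]
    {U : Type*} [TopologicalSpace U] [MeasurableSpace U] [BorelSpace U]
    (M : CylMartMeasure ℱ P H U) {T : ℝ≥0} (hT : 0 < T)
    {E : Type*} [MeasurableSpace E] (ϱ : Measure E) [SigmaFinite ϱ]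
    (Φ : ∀ (r : Set.Icc (0 : ℝ≥0) T) (_ : Ω) (u : U), E → HilbertSchmidt (M.q r u).Space G)
    (hΦ : M.IsXi ϱ Φ) :
    -- (1) the integral of `Φ` over `E` exists and belongs to `Λ²(M, T; H, G)`
    ((∀ᵐ p ∂((M.lamIcc T).prod P).prod M.mu,
        Integrable (fun e => Φ p.1.1 p.1.2 p.2 e) ϱ) ∧
      M.IsLambda2 (fun r ω u => ∫ e, Φ r ω u e ∂ϱ)) ∧
    -- (2) `e ↦ I(Φ(e))` is Bochner integrable and its integral can be computed pathwise
    ((∀ᵐ e ∂ϱ, M.IsStochasticIntegral (fun r ω u => Φ r ω u e)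
        (M.stochasticIntegral fun r ω u => Φ r ω u e)) ∧
      Integrable (fun e => M.stochasticIntegral fun r ω u => Φ r ω u e) ϱ ∧
      (∃ J : E → Set.Icc (0 : ℝ≥0) T → Ω → G,
        IsMeasurableVersion ϱ (fun e => M.stochasticIntegral fun r ω u => Φ r ω u e) J) ∧
      ∀ J : E → Set.Icc (0 : ℝ≥0) T → Ω → G,
        IsMeasurableVersion ϱ (fun e => M.stochasticIntegral fun r ω u => Φ r ω u e) J →
        ∀ᵐ ω ∂P, ∀ t, Integrable (fun e => J e t ω) ϱ ∧
          (∫ e, (M.stochasticIntegral fun r ω u => Φ r ω u e) ∂ϱ).path t ω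
            = ∫ e, J e t ω ∂ϱ) ∧
    -- (3) the stochastic integral of the integral is the integral of the stochastic integrals
    (M.IsStochasticIntegral (fun r ω u => ∫ e, Φ r ω u e ∂ϱ)
        (M.stochasticIntegral fun r ω u => ∫ e, Φ r ω u e ∂ϱ) ∧
      ∀ J : E → Set.Icc (0 : ℝ≥0) T → Ω → G,
        IsMeasurableVersion ϱ (fun e => M.stochasticIntegral fun r ω u => Φ r ω u e) J →
        ∀ᵐ ω ∂P, ∀ t,
          (M.stochasticIntegral fun r ω u => ∫ e, Φ r ω u e ∂ϱ).path t ω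
            = ∫ e, J e t ω ∂ϱ) := by
  set Φ' : M.XiField T E G := fun x => Φ x.1.1.1 x.1.1.2 x.1.2 x.2 with hΦ'
  have hm : CylMartMeasure.IsMeasurableXi Φ' := hΦ.1
  have hfin : CylMartMeasure.xiENorm ϱ Φ' ≠ ∞ := by
    rw [CylMartMeasure.xiENorm_eq hm]
    exact hΦ.2.ne
  have := MartingaleSpace.completeSpace (P := P) (G := G) hT hnull
  have hint := CylMartMeasure.integrable_stochasticIntegral hT hnull hm hfin
  have hI := CylMartMeasure.isStochasticIntegral_intXi hT hnull hm hfin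
  have hae := CylMartMeasure.ae_isStochasticIntegral hT hnull hm hfin
  have hex := CylMartMeasure.exists_isMeasurableVersion hT hnull hm hfin
  have hI' := hI.stochasticIntegral_eq hT
  -- The exceptional set found on the predictable space is null for the full product measure, of
  -- which the predictable one is the image.
  refine ⟨⟨ae_of_ae_map measurable_toPred.aemeasurable (hm.ae_integrable_slice hfin),
    hm.isLambda2_intXi hfin⟩, ⟨hae.mono fun _ he => he, hint, hex,
      fun J hJ => hJ.integral_path hT hint⟩, ?_, fun J hJ => ?_⟩
  · exact hI'.symm ▸ hI
  · filter_upwards [hJ.integral_path hT hint] with ω hω t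
    exact (congrArg (fun X : MartingaleSpace ℱ P T G => X.path t ω) hI').trans (hω t).2
end
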